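/- **Setting.** Let $m>1$, $n\ge 2$ be real, $F(u)=\frac1{2n}|1-u^2|^n$, and let either (double degeneracy) $D(u)=|1-u^2|^m$, or (single degeneracy) $D(u)=|1-u|^m$. On a bounded interval $[a,b]$ consider, for $\varepsilon>0$, $$u_t=\varepsilon^2(D(u)u_x)_x-\tfrac{\varepsilon^2}{2}D'(u)u_x^2-F'(u),\qquad u_x(a,t)=u_x(b,t)=0,\qquad u(x,0)=u_0(x), \tag{P}$$ with the energy $E_\varepsilon[w]=\int_a^b\big[\frac\varepsilon2D(w)w_x^2+\frac{F(w)}\varepsilon\big]dx$ and $\gamma=\int_{-1}^1\sqrt{2D(s)F(s)}\,ds$. A *solution* of (P) is a function $u$ on $[a,b]\times[0,\infty)$ with values in $[-1,1]$ that lies in $C([0,\infty),H^1(a,b))\cap H^1((\tau,T),W^{1,4}(a,b))$ for all $0<\tau<T$, and that is a strong solution on every $Q_T=(a,b)\times(0,T)$. Strong solution means: with $\Psi_1'=D$, $\Psi_2'=\sqrt{(D')^+}$, $\Psi_3'=\sqrt{(D')^-}$, $\Psi_i(-1)=0$, we have $u_t\in L^2(Q_T)$, $\Psi_1(u)\in L^2((0,T),H^2(a,b))$,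 $\Psi_2(u),\Psi_3(u)\in L^1_{loc}((0,T),W^{1,1}_{loc}(a,b))$, the equation $u_t=\varepsilon^2\Psi_1(u)_{xx}-\frac{\varepsilon^2}2(\Psi_2(u)_x)^2+\frac{\varepsilon^2}2(\Psi_3(u)_x)^2-F'(u)$ holds a.e. in $Q_T$, $u(\cdot,0)=u_0$, and $\Psi_1(u)_x$ has zero trace at $x=a$ and $x=b$. Let $v:[a,b]\to\{-1,1\}$ be piecewise constant with exactly $N\ge1$ jumps, at $a<h_1<\dots<h_N<b$, and let $r>0$ satisfy $h_i+r<h_{i+1}-r$ for $1\le i<N$, $a\le h_1-r$ and $h_N+r\le b$. Let $\theta$ be one of the following: - **(E1)** double degeneracy, $m>2$, $n=m+2$: $\theta(\varepsilon)=\exp(-A\sqrt n/\varepsilon)$ with $A\in(0,2r)$; - **(E2)** double degeneracy, $m\in(1,2]$, $n=m+2$: $\theta(\varepsilon)=\exp(-A/\varepsilon)$ with $A\in(0,2r)$; - **(E3)** single degeneracy, $m\in(1,2]$, $n=2$: $\theta(\varepsilon)=\exp(-A/\varepsilon)$ with $A\in(0,2^{\frac{2-m}2}r)$; - **(E4)**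 double degeneracy, $n>m+2$: $\theta(\varepsilon)=\varepsilon^{k_{j+1}}$ for some integer $j\ge1$, where $k_2=\alpha$, $k_{j+1}=\alpha(k_j+1)$ for $j\ge2$, and $\alpha=\frac{n+m+2}{2n}$; - **(E5)** single degeneracy, $n>2$: $\theta(\varepsilon)=\varepsilon^{k_{j+1}}$ for some integer $j\ge1$, where $k_{j+1}=\frac{n+2}{2n}(k_j+1)$ for $j\ge2$, and $k_2$ is either $\frac{n+1}{2n}$ or $\frac{n+2}{2n}$. For a closed set $K\subset\mathbb R\setminus\{-1,1\}$ and $w:[a,b]\to\mathbb R$ put $I_K[w]=w^{-1}(K)$, and let $d$ be the Hausdorff distance of subsets of $\mathbb R$, with $d(\emptyset,\emptyset)=0$ and $d(X,\emptyset)=\infty$ for $X\neq\emptyset$. **Theorem.** For small $\varepsilon>0$ let $u^\varepsilon$ be a solution of (P) with initial datum $u_0^\varepsilon\in H^1(a,b)$, and suppose that $$\lim_{\varepsilon\to0^+}\|u_0^\varepsilon-v\|_{L^1(a,b)}=0\qquad\text{and}\qquad E_\varepsilon[u_0^\varepsilon]\le N\gamma+C\theta(\varepsilon)\ \text{ for all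 small }\varepsilon>0,$$ with a constant $C>0$. Given $\delta_1\in(0,r)$ and a closed set $K\subset\mathbb R\setminus\{-1,1\}$, set $$t_\varepsilon(\delta_1)=\inf\{t\ge0:\ d(I_K[u^\varepsilon(\cdot,t)],I_K[u^\varepsilon_0])>\delta_1\}\qquad(\inf\emptyset=+\infty).$$ Then there is $\varepsilon_0>0$ such that $t_\varepsilon(\delta_1)>\theta(\varepsilon)^{-1}$ for all $\varepsilon\in(0,\varepsilon_0)$. -/

import Mathlib

open Set Filter Topology MeasureTheory

namespace DegenerateAllenCahn

/-- Whether the diffusivity vanishes at both wells `u = ± 1`, or only at `u = 1`. -/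
inductive Degeneracy where
  | double
  | single

/-- The diffusivity `D`: `|1 - u²|^m` (double degeneracy) or `|1 - u|^m` (single degeneracy). -/
noncomputable def diffusivity (κ : Degeneracy) (m : ℝ) (u : ℝ) : ℝ :=
  match κ with
  | .double => |1 - u ^ 2| ^ m
  | .single => |1 - u| ^ m

/-- The double well potential `F(u) = |1 - u²|^n / (2n)`. -/
noncomputable def potential (n : ℝ) (u : ℝ) : ℝ :=
  1 / (2 * n) * |1 - u ^ 2| ^ n

/-- The Ginzburg--Landau energy `∫ₐᵇ [ε/2 D(w) w_x² + F(w)/ε] dx`. It is only used for (the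
continuous representative of) `w ∈ H¹(a,b)`, for which `deriv w` is almost everywhere the weak
derivative. -/
noncomputable def energy (D F : ℝ → ℝ) (ε a b : ℝ) (w : ℝ → ℝ) : ℝ :=
  ∫ x in a..b, (ε / 2 * D (w x) * (deriv w x) ^ 2 + F (w x) / ε)

/-- The energy `γ = ∫_{-1}^{1} √(2 D F)` of one transition between `-1` and `1`. -/
noncomputable def transitionEnergy (D F : ℝ → ℝ) : ℝ :=
  ∫ s in (-1)..1, Real.sqrt (2 * D s * F s)

/-! ### The functions of the filtration form of the equation -/

/-- `Ψ₁' = D`, `Ψ₁(-1) = 0`. -/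
noncomputable def psi₁ (D : ℝ → ℝ) (s : ℝ) : ℝ :=
  ∫ y in (-1)..s, D y

/-- `(Ψ₂')²` is the positive part of `D'`, `Ψ₂(-1) = 0`. -/
noncomputable def psi₂ (D : ℝ → ℝ) (s : ℝ) : ℝ :=
  ∫ y in (-1)..s, Real.sqrt (max (deriv D y) 0)

/-- `(Ψ₃')²` is the negative part of `D'`, `Ψ₃(-1) = 0`. -/
noncomputable def psi₃ (D : ℝ → ℝ) (s : ℝ) : ℝ :=
  ∫ y in (-1)..s, Real.sqrt (max (-deriv D y) 0)

/-! ### Sobolev spaces on an interval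

Elements of Sobolev spaces on a bounded interval are represented by their continuous
representatives; `W^{1,1}(a,b)` is the space of absolutely continuous functions on `[a,b]`. -/

/-- `f ∈ W^{1,1}(a,b)` (as a function on `[a,b]`), with weak derivative `g`. -/
def HasSobolevDeriv (a b : ℝ) (f g : ℝ → ℝ) : Prop :=
  IntervalIntegrable g volume a b ∧ ∀ x ∈ Icc a b, f x = f a + ∫ y in a..x, g y

/-- `f ∈ H¹(a,b)`. -/
def MemH1 (a b : ℝ) (f : ℝ → ℝ) : Prop :=
  ∃ g : ℝ → ℝ, HasSobolevDeriv a b f g ∧ MemLp g 2 (volume.restrict (Ioo a b))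

/-- The squared norm of `f ∈ H¹(a,b)`. -/
noncomputable def h1NormSq (a b : ℝ) (f : ℝ → ℝ) : ℝ :=
  ∫ x in a..b, ((f x) ^ 2 + (deriv f x) ^ 2)

/-! ### Functions of time and space

A function of `(t, x)` is a map `ℝ → ℝ → ℝ`, the first argument being the time. -/

/-- The space-time rectangle `(τ,T) × (a,b)`. -/
def spaceTime (a b τ T : ℝ) : Set (ℝ × ℝ) := Ioo τ T ×ˢ Ioo a b

/-- `g ∈ L²((τ,T), L⁴(a,b))`. -/
def MemL2L4 (a b τ T : ℝ) (g : ℝ → ℝ → ℝ) : Prop :=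
  AEStronglyMeasurable (Function.uncurry g) (volume.restrict (spaceTime a b τ T)) ∧
    ∫⁻ t in Ioo τ T, (eLpNorm (g t) 4 (volume.restrict (Ioo a b))) ^ 2 < ⊤

/-- `u ∈ H¹((τ,T), W^{1,4}(a,b))`: both `u` and its time derivative `v` belong to
`L²((τ,T), W^{1,4}(a,b))`. Here `u` is the representative that is continuous in time, so that
`u(t) = u(s) + ∫_s^t v(σ) dσ` in `W^{1,4}(a,b)`, that is, at every `x ∈ [a,b]`. -/
def MemH1W14 (a b τ T : ℝ) (u : ℝ → ℝ → ℝ) : Prop :=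
  ∃ ux v vx : ℝ → ℝ → ℝ,
    MemL2L4 a b τ T u ∧ MemL2L4 a b τ T ux ∧ MemL2L4 a b τ T v ∧ MemL2L4 a b τ T vx ∧
    (∀ᵐ t ∂(volume.restrict (Ioo τ T)), HasSobolevDeriv a b (u t) (ux t)) ∧
    (∀ᵐ t ∂(volume.restrict (Ioo τ T)), HasSobolevDeriv a b (v t) (vx t)) ∧
    ∀ s ∈ Icc τ T, ∀ t ∈ Icc τ T, ∀ x ∈ Icc a b, u t x = u s x + ∫ σ in s..t, v σ x

/-- `u` is a strong solution on `(a,b) × (0,T)` of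
`u_t = ε² Ψ₁(u)_xx - ε²/2 (Ψ₂(u)_x)² + ε²/2 (Ψ₃(u)_x)² - F'(u)`
with homogeneous Neumann boundary conditions and initial datum `u₀`. -/
structure IsStrongSolution (D F : ℝ → ℝ) (ε a b T : ℝ) (u₀ : ℝ → ℝ) (u : ℝ → ℝ → ℝ) :
    Prop where
  measurable :
    AEStronglyMeasurable (Function.uncurry u) (volume.restrict (spaceTime a b 0 T))
  bounded : ∀ t ∈ Icc 0 T, ∀ x ∈ Icc a b, u t x ∈ Icc (-1 : ℝ) 1
  /-- The initial condition. The trace at `t = 0` is the value at `t = 0`, because `u` is continuous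
  in time with values in `L²(a,b)` by the first conjunct of `equation`. -/
  initial : ∀ x ∈ Icc a b, u 0 x = u₀ x
  /-- `ut`, `w`, `wx`, `p`, `q` are `u_t`, `Ψ₁(u)_x`, `Ψ₁(u)_xx`, `Ψ₂(u)_x`, `Ψ₃(u)_x`. -/
  equation : ∃ ut w wx p q : ℝ → ℝ → ℝ,
    -- `u ∈ H¹((0,T), L²(a,b))` with time derivative `ut`
    (MemLp (Function.uncurry ut) 2 (volume.restrict (spaceTime a b 0 T)) ∧
      ∀ s ∈ Icc 0 T, ∀ t ∈ Icc 0 T, ∀ᵐ x ∂(volume.restrict (Ioo a b)),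
        u t x = u s x + ∫ σ in s..t, ut σ x) ∧
    -- `Ψ₁(u) ∈ L²((0,T), H²(a,b))`
    (MemLp (fun z : ℝ × ℝ => psi₁ D (u z.1 z.2)) 2 (volume.restrict (spaceTime a b 0 T)) ∧
      MemLp (Function.uncurry w) 2 (volume.restrict (spaceTime a b 0 T)) ∧
      MemLp (Function.uncurry wx) 2 (volume.restrict (spaceTime a b 0 T)) ∧
      ∀ᵐ t ∂(volume.restrict (Ioo 0 T)),
        HasSobolevDeriv a b (fun x => psi₁ D (u t x)) (w t) ∧
        HasSobolevDeriv a b (w t) (wx t)) ∧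
    -- `Ψ₂(u), Ψ₃(u) ∈ L¹_loc((0,T), W^{1,1}_loc(a,b))`
    (LocallyIntegrableOn (fun z : ℝ × ℝ => psi₂ D (u z.1 z.2)) (spaceTime a b 0 T) ∧
      LocallyIntegrableOn (fun z : ℝ × ℝ => psi₃ D (u z.1 z.2)) (spaceTime a b 0 T) ∧
      LocallyIntegrableOn (Function.uncurry p) (spaceTime a b 0 T) ∧
      LocallyIntegrableOn (Function.uncurry q) (spaceTime a b 0 T) ∧
      ∀ᵐ t ∂(volume.restrict (Ioo 0 T)), ∀ c d : ℝ, a < c → c < d → d < b →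
        HasSobolevDeriv c d (fun x => psi₂ D (u t x)) (p t) ∧
        HasSobolevDeriv c d (fun x => psi₃ D (u t x)) (q t)) ∧
    -- the equation holds almost everywhere
    (∀ᵐ z ∂(volume.restrict (spaceTime a b 0 T)),
      ut z.1 z.2 = ε ^ 2 * wx z.1 z.2 - ε ^ 2 / 2 * (p z.1 z.2) ^ 2
        + ε ^ 2 / 2 * (q z.1 z.2) ^ 2 - deriv F (u z.1 z.2)) ∧
    -- the trace of `Ψ₁(u)_x ∈ L²((0,T), H¹(a,b))` on the lateral boundary vanishes
    (∀ᵐ t ∂(volume.restrict (Ioo 0 T)), w t a = 0 ∧ w t b = 0)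

/-- The solutions whose long-time behaviour is studied: global strong solutions that are
sufficiently smooth, namely in `H¹_loc((0,∞), W^{1,4}(a,b)) ∩ C([0,∞), H¹(a,b))`. (This contains
all strong solutions that are in `H¹((0,T), W^{1,4}(a,b))` for every `T`.) -/
structure IsSolution (D F : ℝ → ℝ) (ε a b : ℝ) (u₀ : ℝ → ℝ) (u : ℝ → ℝ → ℝ) : Prop where
  strong : ∀ T : ℝ, 0 < T → IsStrongSolution D F ε a b T u₀ u
  regular : ∀ τ T : ℝ, 0 < τ → τ < T → MemH1W14 a b τ T u
  memH1 : ∀ t : ℝ, 0 ≤ t → MemH1 a b (u t)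
  continuous : ∀ s : ℝ, 0 ≤ s →
    Tendsto (fun t => h1NormSq a b (fun x => u t x - u s x)) (𝓝[Ici 0] s) (𝓝 0)

/-! ### Transition layers -/

/-- `v : [a,b] → {-1,1}` is piecewise constant, with exactly `N` jumps, located at
`a < h 0 < h 1 < ⋯ < h (N-1) < b`. -/
def IsStep (a b : ℝ) {N : ℕ} (h : Fin N → ℝ) (v : ℝ → ℝ) : Prop :=
  StrictMono h ∧ (∀ i, h i ∈ Ioo a b) ∧ (∀ x ∈ Icc a b, v x = -1 ∨ v x = 1) ∧
    ∃ σ : ℝ, (σ = -1 ∨ σ = 1) ∧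
      ∀ x ∈ Icc a b, (∀ i, x ≠ h i) →
        v x = σ * (-1) ^ (Finset.univ.filter (fun i => h i < x)).card

/-- `r > 0`, consecutive jumps are at distance greater than `2r` from each other, and all jumps are
at distance at least `r` from the end points of `[a,b]`. -/
def IsSeparated (a b : ℝ) {N : ℕ} (h : Fin N → ℝ) (r : ℝ) : Prop :=
  0 < r ∧ (∀ i j, i < j → h i + r < h j - r) ∧ (∀ i, a ≤ h i - r) ∧ ∀ i, h i + r ≤ b

/-- The sequence `k₂ = κ`, `k_{j+1} = α (k_j + 1)`, shifted: `algExponent α κ i` is `k_{i+2}`. -/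
noncomputable def algExponent (α κ : ℝ) : ℕ → ℝ
  | 0 => κ
  | i + 1 => α * (algExponent α κ i + 1)

/-- The admissible rates `θ`, according to the exponents `m`, `n` and the type of degeneracy. -/
inductive IsRate (r m n : ℝ) : Degeneracy → (ℝ → ℝ) → Prop where
  | double_exp_large (A : ℝ) : 2 < m → n = m + 2 → 0 < A → A < 2 * r →
      IsRate r m n .double (fun ε => Real.exp (-(A * Real.sqrt n / ε)))
  | double_exp_small (A : ℝ) : 1 < m → m ≤ 2 → n = m + 2 → 0 < A → A < 2 * r →
      IsRate r m n .double (fun ε => Real.exp (-(A / ε)))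
  | single_exp (A : ℝ) : 1 < m → m ≤ 2 → n = 2 → 0 < A → A < (2 : ℝ) ^ ((2 - m) / 2) * r →
      IsRate r m n .single (fun ε => Real.exp (-(A / ε)))
  | double_alg (i : ℕ) : 1 < m → m + 2 < n →
      IsRate r m n .double (fun ε =>
        ε ^ algExponent ((n + m + 2) / (2 * n)) ((n + m + 2) / (2 * n)) i)
  | single_alg (i : ℕ) (κ : ℝ) : 1 < m → 2 < n →
      (κ = (n + 1) / (2 * n) ∨ κ = (n + 2) / (2 * n)) →
      IsRate r m n .single (fun ε => ε ^ algExponent ((n + 2) / (2 * n)) κ i)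

/-- The family `u₀ ε` has an `N`-transition layer structure, with limit `v` and rate `θ`. -/
def HasLayerStructure (D F θ : ℝ → ℝ) (a b : ℝ) (N : ℕ) (v : ℝ → ℝ) (u₀ : ℝ → ℝ → ℝ) : Prop :=
  (∀ᶠ ε in 𝓝[>] (0 : ℝ), MemH1 a b (u₀ ε)) ∧
  Tendsto (fun ε => ∫ x in a..b, |u₀ ε x - v x|) (𝓝[>] 0) (𝓝 0) ∧
  ∃ C : ℝ, 0 < C ∧ ∀ᶠ ε in 𝓝[>] (0 : ℝ),
    energy D F ε a b (u₀ ε) ≤ N * transitionEnergy D F + C * θ ε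

/-- The interface `I_K[w] = w⁻¹(K)` of `w : [a,b] → ℝ`. -/
def interfaceSet (a b : ℝ) (K : Set ℝ) (w : ℝ → ℝ) : Set ℝ :=
  {x ∈ Icc a b | w x ∈ K}

/-- The infimum (`⊤` if there is none) of the times `t ≥ 0` at which the Hausdorff distance between
the interfaces of `u(t)` and of `u₀` exceeds `δ`. -/
noncomputable def exitTime (a b : ℝ) (K : Set ℝ) (u₀ : ℝ → ℝ) (u : ℝ → ℝ → ℝ) (δ : ℝ) : EReal :=
  sInf ((fun t : ℝ => (t : EReal)) '' {t : ℝ | 0 ≤ t ∧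
    ENNReal.ofReal δ < Metric.hausdorffEDist (interfaceSet a b K (u t)) (interfaceSet a b K u₀)})

end DegenerateAllenCahn

/-! The energy dissipates at the rate `ε⁻¹ ∫ u_t²`, so Cauchy–Schwarz on the space-time rectangle
bounds the squared `L¹` distance covered up to time `t` by `t (b - a) ε (E(0) - E(t))`
(`IsSolution.sq_integral_abs_sub_le`). The initial energy is at most `Nγ + Cθ`. If every function
`L¹`-close to `v` has energy at least `Nγ - C'θ` (`energy_lower_bound`), then a solution still close
to `v` has lost only `O(θ)`, and up to time `2/θ` it has moved by `O(√ε)` in `L¹`. A continuity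
argument in `slow_motion` removes the circularity. Closeness in `L¹` then locates the interface. A
value in `K` far from all jumps would cost a fixed energy beyond `Nγ` (`interface_near_jumps`), and
a function close to `v` takes each value in `(-1, 1)` near each jump (`exists_eq_near_jump`).

The lower bound is a calibration argument. Let `V` be the cost of the optimal transition from a
well. The Modica–Mortola inequality on an interval around a jump gives `γ` minus the costs still
separating the end values from the wells. The tails of the layer, of length about `r`, recover these
costs: with `g = tanh(l (x - z)/ε)`, up to orientation, the field `g (V(w) - ω)` calibrates the
energy as soon as `l (V - ω) ≤ F` near the wells (`tail_aux`). The total defect of a layer is `2ω +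
4γ exp(-2l(r-η)/ε)`, and nothing is assumed about the values of `w` at the ends of the layer.

It remains to choose `l` and `ω`. With `x = 1 - s²` one has `V ≤ C x^(k+1)` near the wells and `F =
x^n/(2n)`. If `k + 1 = n`, a constant `l` and `ω = 0` work and the defect is exponentially small
(`hasTailRate_exp`). If `k + 1 < n`, taking `l = ε^(1-ς)` and `ω` of order `l^β` with `β =
(k+1)/(n-k-1)` gives any algebraic rate with exponent below `β` (`hasTailRate_rpow`). The exponents
`k_j` stay below `β`, the fixed point of their recursion, so the energy estimate needs no induction
on `j`. -/

namespace DegenerateAllenCahn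

/-! ### Calculus of Sobolev functions on an interval -/

/-- An absolutely continuous function is bounded on `[a,b]`, so only a Lipschitz constant of `φ` on
a compact interval is needed. -/
theorem absolutelyContinuous_comp_of_hasDerivAt {f φ φ' : ℝ → ℝ} {a b : ℝ}
    (hf : AbsolutelyContinuousOnInterval f a b) (hφ : ∀ s, HasDerivAt φ (φ' s) s)
    (hφ' : Continuous φ') : AbsolutelyContinuousOnInterval (fun x => φ (f x)) a b := by
  obtain ⟨M, hM⟩ := hf.exists_bound
  have hφd : deriv φ = φ' := funext fun s => (hφ s).deriv
  have hC : ContDiff ℝ 1 φ := by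
    rw [contDiff_one_iff_deriv]
    exact ⟨fun s => (hφ s).differentiableAt, by rwa [hφd]⟩
  obtain ⟨L, hL⟩ := hC.contDiffOn.exists_lipschitzOnWith (by decide) (convex_Icc (-M) M)
    isCompact_Icc
  have hmem : ∀ x ∈ uIcc a b, f x ∈ Icc (-M) M := fun x hx => abs_le.1 (hM x hx)
  rw [absolutelyContinuousOnInterval_iff] at hf ⊢
  intro ε hε
  obtain ⟨δ, hδ, h⟩ := hf (ε / (L + 1)) (by positivity)
  refine ⟨δ, hδ, fun E hE hlt => ?_⟩
  have h1 := h E hE hlt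
  calc ∑ i ∈ Finset.range E.1, dist (φ (f (E.2 i).1)) (φ (f (E.2 i).2))
      ≤ ∑ i ∈ Finset.range E.1, L * dist (f (E.2 i).1) (f (E.2 i).2) := by
        refine Finset.sum_le_sum fun i hi => ?_
        exact hL.dist_le_mul _ (hmem _ (hE.1 i hi).1) _ (hmem _ (hE.1 i hi).2)
    _ = L * ∑ i ∈ Finset.range E.1, dist (f (E.2 i).1) (f (E.2 i).2) := by
        rw [Finset.mul_sum]
    _ ≤ (L + 1) * ∑ i ∈ Finset.range E.1, dist (f (E.2 i).1) (f (E.2 i).2) := by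
        gcongr
        simp
    _ < (L + 1) * (ε / (L + 1)) := by gcongr
    _ = ε := by field_simp

/-- The fundamental theorem of calculus for absolutely continuous functions. It reduces the chain
and product rules for weak derivatives to classical differentiation at almost every point. -/
theorem hasSobolevDeriv_of_absolutelyContinuous {f g : ℝ → ℝ} {a b : ℝ} (hab : a ≤ b)
    (hf : AbsolutelyContinuousOnInterval f a b)
    (hg : ∀ᵐ x ∂(volume.restrict (Ioo a b)), HasDerivAt f (g x) x) :
    HasSobolevDeriv a b f g := by
  have hd : ∀ᵐ x ∂(volume.restrict (Ioo a b)), deriv f x = g x := hg.mono fun x hx => hx.deriv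
  have hd' : deriv f =ᵐ[volume.restrict (Ioc a b)] g := by
    rwa [restrict_Ioo_eq_restrict_Ioc] at hd
  constructor
  · have := hf.intervalIntegrable_deriv
    rw [intervalIntegrable_iff_integrableOn_Ioc_of_le hab] at this ⊢
    exact this.congr hd'
  · intro x hx
    have h1 : AbsolutelyContinuousOnInterval f a x :=
      hf.mono (by rw [uIcc_of_le hab, uIcc_of_le hx.1]; exact Icc_subset_Icc_right hx.2)
    rw [← intervalIntegral.integral_congr_ae_restrict (f := deriv f), h1.integral_deriv_eq_sub]
    · ring
    · rw [uIoc_of_le hx.1]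
      exact ae_restrict_of_ae_restrict_of_subset (Ioc_subset_Ioc_right hx.2) hd'

namespace HasSobolevDeriv

variable {f g f₁ g₁ : ℝ → ℝ} {a b : ℝ}

theorem absolutelyContinuous (h : HasSobolevDeriv a b f g) (hab : a ≤ b) :
    AbsolutelyContinuousOnInterval f a b := by
  have h1 : AbsolutelyContinuousOnInterval (fun x => ∫ y in a..x, g y) a b :=
    h.1.absolutelyContinuousOnInterval_intervalIntegral left_mem_uIcc
  have h2 : AbsolutelyContinuousOnInterval (fun _ => f a) a b :=
    (LipschitzWith.const (f a)).lipschitzOnWith.absolutelyContinuousOnInterval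
  have h3 := h2.add h1
  have hEq : ∀ x ∈ uIcc a b, f x = f a + ∫ y in a..x, g y := by
    intro x hx
    rw [uIcc_of_le hab] at hx
    exact h.2 x hx
  rw [absolutelyContinuousOnInterval_iff] at h3 ⊢
  intro ε hε
  obtain ⟨δ, hδ, h⟩ := h3 ε hε
  refine ⟨δ, hδ, fun E hE hlt => ?_⟩
  have := h E hE hlt
  refine lt_of_eq_of_lt (Finset.sum_congr rfl fun i hi => ?_) this
  rw [hEq _ (hE.1 i hi).1, hEq _ (hE.1 i hi).2]
  rfl

theorem continuousOn (h : HasSobolevDeriv a b f g) (hab : a ≤ b) : ContinuousOn f (Icc a b) := by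
  have := (h.absolutelyContinuous hab).continuousOn
  rwa [uIcc_of_le hab] at this

theorem ae_hasDerivAt (h : HasSobolevDeriv a b f g) (hab : a ≤ b) :
    ∀ᵐ x ∂(volume.restrict (Ioo a b)), HasDerivAt f (g x) x := by
  rw [ae_restrict_iff' measurableSet_Ioo]
  filter_upwards [h.1.ae_hasDerivAt_integral] with x hx hxm
  have h1 := (hx (by rw [uIcc_of_le hab]; exact Ioo_subset_Icc_self hxm) a left_mem_uIcc).const_add
    (f a)
  refine h1.congr_of_eventuallyEq ?_
  filter_upwards [Ioo_mem_nhds hxm.1 hxm.2] with y hy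
  exact h.2 y (Ioo_subset_Icc_self hy)

theorem ae_deriv_eq (h : HasSobolevDeriv a b f g) (hab : a ≤ b) :
    deriv f =ᵐ[volume.restrict (Ioo a b)] g :=
  (h.ae_hasDerivAt hab).mono fun _ hx => hx.deriv

/-- Uniqueness of the weak derivative; it later identifies the abstract fluxes of a strong solution
with expressions in `u` and `ux`. -/
theorem ae_eq (h : HasSobolevDeriv a b f g) (h₁ : HasSobolevDeriv a b f g₁) (hab : a ≤ b) :
    g =ᵐ[volume.restrict (Ioo a b)] g₁ :=
  (h.ae_deriv_eq hab).symm.trans (h₁.ae_deriv_eq hab)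

theorem congr_deriv (h : HasSobolevDeriv a b f g) (hab : a ≤ b)
    (hg : g =ᵐ[volume.restrict (Ioo a b)] g₁) : HasSobolevDeriv a b f g₁ := by
  refine hasSobolevDeriv_of_absolutelyContinuous hab (h.absolutelyContinuous hab) ?_
  filter_upwards [h.ae_hasDerivAt hab, hg] with x hx hx'
  rwa [← hx']

theorem integral_eq (h : HasSobolevDeriv a b f g) (hab : a ≤ b) :
    ∫ x in a..b, g x = f b - f a := by
  rw [h.2 b (right_mem_Icc.2 hab)]
  ring

theorem mono (h : HasSobolevDeriv a b f g) {c d : ℝ} (hac : a ≤ c) (hcd : c ≤ d) (hdb : d ≤ b) :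
    HasSobolevDeriv c d f g := by
  have hab : a ≤ b := hac.trans (hcd.trans hdb)
  refine hasSobolevDeriv_of_absolutelyContinuous hcd
    ((h.absolutelyContinuous hab).mono ?_) ?_
  · rw [uIcc_of_le hab, uIcc_of_le hcd]
    exact Icc_subset_Icc hac hdb
  · exact ae_restrict_of_ae_restrict_of_subset (Ioo_subset_Ioo hac hdb) (h.ae_hasDerivAt hab)

theorem comp (h : HasSobolevDeriv a b f g) (hab : a ≤ b) {φ φ' : ℝ → ℝ}
    (hφ : ∀ s, HasDerivAt φ (φ' s) s) (hφ' : Continuous φ') :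
    HasSobolevDeriv a b (fun x => φ (f x)) (fun x => φ' (f x) * g x) := by
  refine hasSobolevDeriv_of_absolutelyContinuous hab
    (absolutelyContinuous_comp_of_hasDerivAt (h.absolutelyContinuous hab) hφ hφ') ?_
  filter_upwards [h.ae_hasDerivAt hab] with x hx
  exact (hφ (f x)).comp x hx

theorem mul (h : HasSobolevDeriv a b f g) (h₁ : HasSobolevDeriv a b f₁ g₁) (hab : a ≤ b) :
    HasSobolevDeriv a b (fun x => f x * f₁ x) (fun x => g x * f₁ x + f x * g₁ x) := by
  refine hasSobolevDeriv_of_absolutelyContinuous hab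
    ((h.absolutelyContinuous hab).mul (h₁.absolutelyContinuous hab)) ?_
  filter_upwards [h.ae_hasDerivAt hab, h₁.ae_hasDerivAt hab] with x hx hx₁
  exact hx.mul hx₁

theorem sub (h : HasSobolevDeriv a b f g) (h₁ : HasSobolevDeriv a b f₁ g₁) (hab : a ≤ b) :
    HasSobolevDeriv a b (fun x => f x - f₁ x) (fun x => g x - g₁ x) := by
  refine hasSobolevDeriv_of_absolutelyContinuous hab
    ((h.absolutelyContinuous hab).sub (h₁.absolutelyContinuous hab)) ?_
  filter_upwards [h.ae_hasDerivAt hab, h₁.ae_hasDerivAt hab] with x hx hx₁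
  exact hx.sub hx₁

theorem of_hasDerivAt (hab : a ≤ b) (hf : ∀ s, HasDerivAt f (g s) s) (hg : Continuous g) :
    HasSobolevDeriv a b f g := by
  have hid : HasSobolevDeriv a b (fun x => x) (fun _ => 1) := by
    refine ⟨intervalIntegrable_const, fun x _ => by simp⟩
  simpa using hid.comp hab hf hg

/-- Oscillation bound: a Sobolev function is bounded by the `L¹` norms of itself and of its
derivative. -/
theorem abs_le (h : HasSobolevDeriv a b f g) (hab : a < b) {x : ℝ} (hx : x ∈ Icc a b) :
    |f x| ≤ (b - a)⁻¹ * (∫ y in a..b, |f y|) + ∫ y in a..b, |g y| := by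
  have hc := h.continuousOn hab.le
  have hgi : IntervalIntegrable (fun y => |g y|) volume a b := h.1.abs
  have key : ∀ y ∈ Icc a b, |f x| ≤ |f y| + ∫ z in a..b, |g z| := by
    intro y hy
    have hsub : uIcc y x ⊆ uIcc a b := by
      rw [uIcc_of_le hab.le]; exact uIcc_subset_Icc hy hx
    have h1 : f x - f y = ∫ z in y..x, g z := by
      rw [h.2 x hx, h.2 y hy, add_sub_add_left_eq_sub]
      refine intervalIntegral.integral_interval_sub_left (h.1.mono_set ?_) (h.1.mono_set ?_)
      · rw [uIcc_of_le hab.le]; exact uIcc_subset_Icc (left_mem_Icc.2 hab.le) hx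
      · rw [uIcc_of_le hab.le]; exact uIcc_subset_Icc (left_mem_Icc.2 hab.le) hy
    have h2 : |f x - f y| ≤ ∫ z in a..b, |g z| := by
      rw [h1]
      refine (intervalIntegral.norm_integral_le_integral_norm_uIoc (f := g) (μ := volume)).trans ?_
      rw [intervalIntegral.integral_of_le hab.le]
      refine setIntegral_mono_set ?_ ?_ ?_
      · exact (intervalIntegrable_iff_integrableOn_Ioc_of_le hab.le).1 hgi
      · exact Eventually.of_forall fun z => abs_nonneg _
      · refine LE.le.eventuallyLE ?_
        rw [← uIoc_of_le hab.le]
        exact uIoc_subset_uIoc_of_uIcc_subset_uIcc hsub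
    have := abs_sub_abs_le_abs_sub (f x) (f y)
    linarith
  have h3 : ∫ y in a..b, |f x| ≤ ∫ y in a..b, (|f y| + ∫ z in a..b, |g z|) := by
    refine intervalIntegral.integral_mono_on hab.le intervalIntegrable_const ?_ key
    refine IntervalIntegrable.add ?_ intervalIntegrable_const
    exact (hc.abs.mono (by rw [uIcc_of_le hab.le])).intervalIntegrable
  rw [intervalIntegral.integral_add
    ((hc.abs.mono (by rw [uIcc_of_le hab.le])).intervalIntegrable) intervalIntegrable_const] at h3
  simp only [intervalIntegral.integral_const, smul_eq_mul] at h3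
  have hba : 0 < b - a := sub_pos.2 hab
  have := mul_le_mul_of_nonneg_left h3 (inv_nonneg.2 hba.le)
  rw [inv_mul_cancel_left₀ hba.ne', mul_add, inv_mul_cancel_left₀ hba.ne'] at this
  exact this

end HasSobolevDeriv

/-! ### Lower bounds for the energy -/

/-- The energy density. -/
noncomputable def energyDensity (D F : ℝ → ℝ) (ε : ℝ) (w : ℝ → ℝ) (x : ℝ) : ℝ :=
  ε / 2 * D (w x) * (deriv w x) ^ 2 + F (w x) / ε

theorem MemH1.hasSobolevDeriv {a b : ℝ} {w : ℝ → ℝ} (hw : MemH1 a b w) (hab : a ≤ b) :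
    HasSobolevDeriv a b w (deriv w) := by
  obtain ⟨g, hg, -⟩ := hw
  exact hg.congr_deriv hab (hg.ae_deriv_eq hab).symm

theorem MemH1.memLp_deriv {a b : ℝ} {w : ℝ → ℝ} (hw : MemH1 a b w) (hab : a ≤ b) :
    MemLp (deriv w) 2 (volume.restrict (Ioo a b)) := by
  obtain ⟨g, hg, hg2⟩ := hw
  exact hg2.ae_eq (hg.ae_deriv_eq hab).symm

theorem MemH1.continuousOn {a b : ℝ} {w : ℝ → ℝ} (hw : MemH1 a b w) (hab : a ≤ b) :
    ContinuousOn w (Icc a b) :=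
  (hw.hasSobolevDeriv hab).continuousOn hab

theorem MemH1.intervalIntegrable_comp {a b : ℝ} {w : ℝ → ℝ} (hw : MemH1 a b w) (hab : a ≤ b)
    {φ : ℝ → ℝ} (hφ : Continuous φ) :
    IntervalIntegrable (fun x => φ (w x)) volume a b := by
  refine ContinuousOn.intervalIntegrable ?_
  rw [uIcc_of_le hab]
  exact hφ.comp_continuousOn (hw.continuousOn hab)

theorem MemH1.intervalIntegrable_comp_mul_deriv_sq {a b : ℝ} {w : ℝ → ℝ} (hw : MemH1 a b w)
    (hab : a ≤ b) {φ : ℝ → ℝ} (hφ : Continuous φ) :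
    IntervalIntegrable (fun x => φ (w x) * (deriv w x) ^ 2) volume a b := by
  have h1 : IntervalIntegrable (fun x => (deriv w x) ^ 2) volume a b :=
    (intervalIntegrable_iff_integrableOn_Ioo_of_le hab).2 (hw.memLp_deriv hab).integrable_sq
  refine h1.continuousOn_mul ?_
  rw [uIcc_of_le hab]
  exact hφ.comp_continuousOn (hw.continuousOn hab)

theorem MemH1.intervalIntegrable_energyDensity {a b : ℝ} {w : ℝ → ℝ} (hw : MemH1 a b w)
    (hab : a ≤ b) {D F : ℝ → ℝ} (hD : Continuous D) (hF : Continuous F) (ε : ℝ) :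
    IntervalIntegrable (energyDensity D F ε w) volume a b := by
  have h1 := (hw.intervalIntegrable_comp_mul_deriv_sq hab hD).const_mul (ε / 2)
  have h2 := (hw.intervalIntegrable_comp hab hF).div_const ε
  refine (h1.add h2).congr fun x _ => ?_
  simp only [energyDensity]
  ring

theorem MemH1.mono {a b c d : ℝ} {w : ℝ → ℝ} (hw : MemH1 a b w) (hac : a ≤ c) (hcd : c ≤ d)
    (hdb : d ≤ b) : MemH1 c d w := by
  obtain ⟨g, hg, hg2⟩ := hw
  exact ⟨g, hg.mono hac hcd hdb,
    hg2.mono_measure (Measure.restrict_mono (Ioo_subset_Ioo hac hdb) le_rfl)⟩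

/-- Pointwise Modica--Mortola inequality with a weight `g`. -/
theorem modicaMortola_pointwise {D F ε p g σ : ℝ} (hD : 0 ≤ D) (hF : 0 ≤ F) (hε : 0 < ε)
    (hσ : σ ^ 2 = 1) :
    g * (σ * Real.sqrt (2 * D * F) * p) ≤ ε / 2 * D * p ^ 2 + g ^ 2 * (F / ε) := by
  have hP : Real.sqrt (2 * D * F) = Real.sqrt D * Real.sqrt (2 * F) := by
    rw [← Real.sqrt_mul hD]; ring_nf
  have hA := Real.sq_sqrt hD
  have hB : Real.sqrt (2 * F) ^ 2 = 2 * F := Real.sq_sqrt (by positivity)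
  set A := Real.sqrt D
  set B := Real.sqrt (2 * F)
  have hFB : F = B ^ 2 / 2 := by linarith
  -- Completing the square: after expansion, with `σ² = 1`, this is the claim.
  have : 0 ≤ (ε * A * p - σ * g * B) ^ 2 / (2 * ε) := by positivity
  have h2 : (ε * A * p - σ * g * B) ^ 2 / (2 * ε)
      = ε / 2 * A ^ 2 * p ^ 2 + g ^ 2 * (B ^ 2 / 2 / ε) * σ ^ 2 - g * (σ * (A * B) * p) := by
    field_simp; ring
  rw [hP, ← hA, hFB]
  rw [h2, hσ, mul_one] at this
  linarith

variable {D F : ℝ → ℝ} {ε : ℝ}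

theorem energyDensity_nonneg (hD0 : ∀ s, 0 ≤ D s) (hF0 : ∀ s, 0 ≤ F s) (hε : 0 < ε)
    (w : ℝ → ℝ) (x : ℝ) : 0 ≤ energyDensity D F ε w x := by
  have := hD0 (w x)
  have := hF0 (w x)
  unfold energyDensity
  positivity

/-- Calibration of the energy by `g(x) (V(w) - ω)`, where `V` is a primitive of `± √(2DF)`. -/
theorem calibration (hD : Continuous D) (hF : Continuous F) (hD0 : ∀ s, 0 ≤ D s)
    (hF0 : ∀ s, 0 ≤ F s) (hε : 0 < ε) {c d : ℝ} (hcd : c ≤ d) {w : ℝ → ℝ} (hw : MemH1 c d w)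
    {V g g' : ℝ → ℝ} {σ τ ω : ℝ} (hσ : σ ^ 2 = 1) (hτ : τ ^ 2 = 1)
    (hV : ∀ s, HasDerivAt V (σ * Real.sqrt (2 * D s * F s)) s)
    (hg : ∀ x, HasDerivAt g (g' x) x) (hg' : Continuous g')
    (hcal : ∀ x ∈ Icc c d, τ * g' x * (V (w x) - ω) ≤ (1 - g x ^ 2) * (F (w x) / ε)) :
    τ * (g d * (V (w d) - ω) - g c * (V (w c) - ω)) ≤ ∫ x in c..d, energyDensity D F ε w x := by
  have hP : Continuous fun s => σ * Real.sqrt (2 * D s * F s) := by fun_prop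
  have hVω : ∀ s, HasDerivAt (fun s => V s - ω) (σ * Real.sqrt (2 * D s * F s)) s :=
    fun s => (hV s).sub_const ω
  have hS := (HasSobolevDeriv.of_hasDerivAt hcd hg hg').mul
    ((hw.hasSobolevDeriv hcd).comp hcd hVω hP) hcd
  rw [← hS.integral_eq hcd, ← intervalIntegral.integral_const_mul]
  -- The derivative of the field has two terms. The one containing `w'` uses up `ε/2 D w'² + g²
  -- F/ε`; the one containing `g'` must fit into the remaining `(1 - g²) F/ε`, which is `hcal`.
  refine intervalIntegral.integral_mono_on hcd (hS.1.const_mul τ)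
    (hw.intervalIntegrable_energyDensity hcd hD hF ε) fun x hx => ?_
  have h1 := hcal x hx
  have h2 := modicaMortola_pointwise (p := deriv w x) (g := g x) (hD0 (w x)) (hF0 (w x)) hε
    (σ := τ * σ) (by rw [mul_pow, hσ, hτ, one_mul])
  unfold energyDensity
  linarith

/-- Calibration with `g = 1`, once for each sign `τ`. -/
theorem sub_le_energyDensity (hD : Continuous D) (hF : Continuous F) (hD0 : ∀ s, 0 ≤ D s)
    (hF0 : ∀ s, 0 ≤ F s) (hε : 0 < ε) {c d : ℝ} (hcd : c ≤ d) {w : ℝ → ℝ} (hw : MemH1 c d w)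
    {V : ℝ → ℝ} {σ : ℝ} (hσ : σ ^ 2 = 1)
    (hV : ∀ s, HasDerivAt V (σ * Real.sqrt (2 * D s * F s)) s) :
    |V (w d) - V (w c)| ≤ ∫ x in c..d, energyDensity D F ε w x := by
  have h : ∀ τ : ℝ, τ ^ 2 = 1 →
      τ * (V (w d) - V (w c)) ≤ ∫ x in c..d, energyDensity D F ε w x := by
    intro τ hτ
    simpa using calibration hD hF hD0 hF0 hε hcd hw (g := fun _ => 1) (g' := fun _ => 0) (ω := 0)
      hσ hτ hV (fun x => hasDerivAt_const x 1) continuous_const (by simp)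
  rw [abs_le]
  have h1 := h 1 (by norm_num)
  have h2 := h (-1) (by norm_num)
  constructor <;> linarith

theorem one_sub_tanh_le (y : ℝ) : 1 - Real.tanh y ≤ 2 * Real.exp (-(2 * y)) := by
  have h1 : 0 < Real.exp y := Real.exp_pos y
  have h2 : 0 < Real.exp (-y) := Real.exp_pos _
  have h3 : Real.exp (-(2 * y)) = Real.exp (-y) / Real.exp y := by
    rw [← Real.exp_sub]; ring_nf
  rw [Real.tanh_eq, h3]
  rw [show 1 - (Real.exp y - Real.exp (-y)) / (Real.exp y + Real.exp (-y))
    = 2 * Real.exp (-y) / (Real.exp y + Real.exp (-y)) by field_simp; ring]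
  rw [mul_div_assoc]
  gcongr
  linarith

/-- Replacing `tanh y` by `1` loses `(1 - tanh y)(V - ω) ≤ (1 - tanh y) V`, which is exponentially
small in `y`. -/
theorem sub_sub_le_tanh_mul {y V ω Γ : ℝ} (hy : 0 ≤ y) (hV : 0 ≤ V) (hVΓ : V ≤ Γ) (hω : 0 ≤ ω) :
    V - ω - 2 * Γ * Real.exp (-(2 * y)) ≤ Real.tanh y * (V - ω) := by
  have h1 := one_sub_tanh_le y
  have h2 : Real.tanh y ≤ 1 := (Real.tanh_lt_one y).le
  have h3 : 0 ≤ Real.tanh y := by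
    rw [Real.tanh_eq_sinh_div_cosh]
    exact div_nonneg (Real.sinh_nonneg_iff.2 hy) (Real.cosh_pos y).le
  have h4 := Real.exp_pos (-(2 * y))
  nlinarith [mul_le_mul_of_nonneg_right h1 hV, mul_le_mul_of_nonneg_right hVΓ h4.le]

/-- The energy of a tail near a well, in terms of the rate `l` with which `F` controls the
primitive `V` of `± √(2DF)` near the well. -/
theorem tail_aux (hD : Continuous D) (hF : Continuous F) (hD0 : ∀ s, 0 ≤ D s)
    (hF0 : ∀ s, 0 ≤ F s) (hε : 0 < ε) {c d : ℝ} (hcd : c ≤ d) {w : ℝ → ℝ} (hw : MemH1 c d w)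
    {V : ℝ → ℝ} {σ τ ω l : ℝ} (z : ℝ) (hσ : σ ^ 2 = 1) (hτ : τ ^ 2 = 1)
    (hV : ∀ s, HasDerivAt V (σ * Real.sqrt (2 * D s * F s)) s)
    (hl : ∀ x ∈ Icc c d, l * (V (w x) - ω) ≤ F (w x)) :
    τ * (Real.tanh (l * (τ * (d - z)) / ε) * (V (w d) - ω)
      - Real.tanh (l * (τ * (c - z)) / ε) * (V (w c) - ω))
      ≤ ∫ x in c..d, energyDensity D F ε w x := by
  -- Since `tanh' = 1 - tanh²`, the factor `1 - g²` appears on both sides of the calibration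
  -- condition, which then reduces to `l (V - ω) ≤ F`.
  have hg : ∀ x, HasDerivAt (fun x => Real.tanh (l * (τ * (x - z)) / ε))
      ((1 - Real.tanh (l * (τ * (x - z)) / ε) ^ 2) * (l * τ / ε)) x := by
    intro x
    have h1 : HasDerivAt (fun x => l * (τ * (x - z)) / ε) (l * τ / ε) x := by
      have := ((((hasDerivAt_id x).sub_const z).const_mul τ).const_mul l).div_const ε
      simpa using this
    have h2 : ∀ y, HasDerivAt Real.tanh (1 - Real.tanh y ^ 2) y := by
      intro y
      have hc : Real.cosh y ≠ 0 := (Real.cosh_pos y).ne'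
      have h3 := (Real.hasDerivAt_sinh y).div (Real.hasDerivAt_cosh y) hc
      have h4 : Real.tanh = fun y => Real.sinh y / Real.cosh y :=
        funext Real.tanh_eq_sinh_div_cosh
      rw [h4]
      refine h3.congr_deriv ?_
      field_simp
    exact (h2 _).comp x h1
  refine calibration hD hF hD0 hF0 hε hcd hw hσ hτ hV hg ?_ ?_
  · have : Continuous Real.tanh := by
      rw [funext Real.tanh_eq_sinh_div_cosh]
      exact Real.continuous_sinh.div Real.continuous_cosh fun y => (Real.cosh_pos y).ne'
    fun_prop
  · intro x hx
    have h1 := hl x hx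
    have h2 : 0 ≤ 1 - Real.tanh (l * (τ * (x - z)) / ε) ^ 2 := by
      have := Real.tanh_sq_lt_one (l * (τ * (x - z)) / ε)
      linarith
    have h3 := mul_le_mul_of_nonneg_left (div_le_div_of_nonneg_right h1 hε.le) h2
    refine le_trans (le_of_eq ?_) h3
    linear_combination (1 - Real.tanh (l * (τ * (x - z)) / ε) ^ 2) * (l / ε) * (V (w x) - ω) * hτ

/-- Continuous nonnegative coefficients, positive between the wells. -/
structure AdmissibleCoefficients (D F : ℝ → ℝ) : Prop where
  continuous_D : Continuous D
  continuous_F : Continuous F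
  nonneg_D : ∀ s, 0 ≤ D s
  nonneg_F : ∀ s, 0 ≤ F s
  pos : ∀ s ∈ Ioo (-1 : ℝ) 1, 0 < D s * F s

/-- The energy `|∫_σ^s √(2DF)|` of an optimal transition between the well `σ ∈ {-1, 1}` and
`s ∈ [-1, 1]`. -/
noncomputable def transitionCost (D F : ℝ → ℝ) (σ s : ℝ) : ℝ :=
  -σ * ∫ y in σ..s, Real.sqrt (2 * D y * F y)

/-- Near each of the wells, `F` controls the transition cost with rate `l`, up to an error `ω`. -/
def TailBound (D F : ℝ → ℝ) (v₀ l ω : ℝ) : Prop :=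
  ∀ σ : ℝ, σ = -1 ∨ σ = 1 → ∀ s ∈ Icc (-1 : ℝ) 1, transitionCost D F σ s ≤ v₀ →
    l * (transitionCost D F σ s - ω) ≤ F s

theorem sq_eq_one_of_sign {σ : ℝ} (hσ : σ = -1 ∨ σ = 1) : σ ^ 2 = 1 := by
  rcases hσ with rfl | rfl <;> norm_num

theorem neg_sign {σ : ℝ} (hσ : σ = -1 ∨ σ = 1) : -σ = -1 ∨ -σ = 1 := by
  rcases hσ with rfl | rfl <;> norm_num

/-! ### Transition costs, and the energy of tails and of single layers -/

namespace AdmissibleCoefficients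

variable {D F : ℝ → ℝ} (H : AdmissibleCoefficients D F)
include H

theorem continuous_sqrt : Continuous fun s => Real.sqrt (2 * D s * F s) := by
  have := H.continuous_D
  have := H.continuous_F
  fun_prop

theorem hasDerivAt_transitionCost (σ s : ℝ) :
    HasDerivAt (transitionCost D F σ) (-σ * Real.sqrt (2 * D s * F s)) s :=
  (H.continuous_sqrt.integral_hasStrictDerivAt σ s).hasDerivAt.const_mul (-σ)

theorem continuous_transitionCost (σ : ℝ) : Continuous (transitionCost D F σ) :=
  continuous_iff_continuousAt.2 fun s => (H.hasDerivAt_transitionCost σ s).continuousAt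

/-- Complementarity of the costs to the two wells: being cheap to reach from one well means costing
almost `γ` from the other. -/
theorem transitionCost_add {σ : ℝ} (hσ : σ = -1 ∨ σ = 1) (s : ℝ) :
    transitionCost D F σ s + transitionCost D F (-σ) s = transitionEnergy D F := by
  have hi : ∀ x y : ℝ, IntervalIntegrable (fun s => Real.sqrt (2 * D s * F s)) volume x y :=
    fun x y => H.continuous_sqrt.intervalIntegrable x y
  have h1 := intervalIntegral.integral_add_adjacent_intervals (hi (-1) s) (hi s 1)
  have h2 := intervalIntegral.integral_symm (f := fun s => Real.sqrt (2 * D s * F s))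
    (μ := volume) s 1
  unfold transitionCost transitionEnergy
  rcases hσ with rfl | rfl
  · simp only [neg_neg]
    linarith
  · simp only [neg_neg]
    linarith

omit H in
theorem transitionCost_nonneg {σ : ℝ} (hσ : σ = -1 ∨ σ = 1) {s : ℝ} (hs : s ∈ Icc (-1 : ℝ) 1) :
    0 ≤ transitionCost D F σ s := by
  unfold transitionCost
  rcases hσ with rfl | rfl
  · have := intervalIntegral.integral_nonneg (μ := volume) hs.1
      fun y _ => Real.sqrt_nonneg (2 * D y * F y)
    linarith
  · have := intervalIntegral.integral_nonneg (μ := volume) hs.2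
      fun y _ => Real.sqrt_nonneg (2 * D y * F y)
    rw [intervalIntegral.integral_symm]
    linarith

theorem transitionCost_le {σ : ℝ} (hσ : σ = -1 ∨ σ = 1) {s : ℝ} (hs : s ∈ Icc (-1 : ℝ) 1) :
    transitionCost D F σ s ≤ transitionEnergy D F := by
  have h1 := H.transitionCost_add hσ s
  have h2 := transitionCost_nonneg (D := D) (F := F) (neg_sign hσ) hs
  linarith

theorem transitionCost_pos {σ : ℝ} (hσ : σ = -1 ∨ σ = 1) {s : ℝ} (hs : s ∈ Ioo (-1 : ℝ) 1) :
    0 < transitionCost D F σ s := by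
  have hP : ∀ y ∈ Ioo (-1 : ℝ) 1, 0 < Real.sqrt (2 * D y * F y) := fun y hy =>
    Real.sqrt_pos.2 (by have := H.pos y hy; linarith)
  unfold transitionCost
  rcases hσ with rfl | rfl
  · have := intervalIntegral.intervalIntegral_pos_of_pos_on
      (H.continuous_sqrt.intervalIntegrable (-1) s)
      (fun y hy => hP y ⟨hy.1, hy.2.trans hs.2⟩) hs.1
    linarith
  · have := intervalIntegral.intervalIntegral_pos_of_pos_on
      (H.continuous_sqrt.intervalIntegrable s 1)
      (fun y hy => hP y ⟨hs.1.trans hy.1, hy.2⟩) hs.2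
    rw [intervalIntegral.integral_symm]
    linarith

omit H in
theorem transitionCost_self (σ : ℝ) : transitionCost D F σ σ = 0 := by
  simp [transitionCost]

theorem exists_transitionCost_le {κ : ℝ} (hκ : 0 < κ) :
    ∃ ρ : ℝ, 0 < ρ ∧ ∀ σ : ℝ, σ = -1 ∨ σ = 1 → ∀ s, |s - σ| < ρ → transitionCost D F σ s ≤ κ := by
  have h : ∀ σ : ℝ, ∃ ρ : ℝ, 0 < ρ ∧ ∀ s, |s - σ| < ρ → transitionCost D F σ s ≤ κ := by
    intro σ
    obtain ⟨ρ, hρ, h⟩ := Metric.continuousAt_iff.1 (H.continuous_transitionCost σ).continuousAt κ hκ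
    refine ⟨ρ, hρ, fun s hs => ?_⟩
    have := h (x := s) (by rwa [Real.dist_eq])
    rw [transitionCost_self, Real.dist_eq, sub_zero] at this
    exact (le_abs_self _).trans this.le
  obtain ⟨ρ₁, h1, h1'⟩ := h (-1)
  obtain ⟨ρ₂, h2, h2'⟩ := h 1
  refine ⟨min ρ₁ ρ₂, lt_min h1 h2, ?_⟩
  rintro σ (rfl | rfl) s hs
  · exact h1' s (hs.trans_le (min_le_left _ _))
  · exact h2' s (hs.trans_le (min_le_right _ _))

theorem transitionEnergy_nonneg : 0 ≤ transitionEnergy D F := by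
  have h1 := transitionCost_nonneg (D := D) (F := F) (σ := 1) (Or.inr rfl) (s := 1) (by norm_num)
  exact h1.trans (H.transitionCost_le (Or.inr rfl) (by norm_num))

variable {ε : ℝ} {w : ℝ → ℝ}

theorem integral_energyDensity_nonneg (hε : 0 < ε) {c d : ℝ} (hcd : c ≤ d) :
    0 ≤ ∫ x in c..d, energyDensity D F ε w x :=
  intervalIntegral.integral_nonneg hcd fun x _ =>
    energyDensity_nonneg H.nonneg_D H.nonneg_F hε w x

theorem transitionCost_sub_le (hε : 0 < ε) {c d : ℝ} (hcd : c ≤ d) (hw : MemH1 c d w)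
    {σ : ℝ} (hσ : σ = -1 ∨ σ = 1) :
    |transitionCost D F σ (w d) - transitionCost D F σ (w c)|
      ≤ ∫ x in c..d, energyDensity D F ε w x :=
  sub_le_energyDensity H.continuous_D H.continuous_F H.nonneg_D H.nonneg_F hε hcd hw
    (by rw [neg_sq]; exact sq_eq_one_of_sign hσ) (H.hasDerivAt_transitionCost σ)

theorem integral_mono_right (hε : 0 < ε) {c d x : ℝ} (hcx : c ≤ x) (hxd : x ≤ d)
    (hw : MemH1 c d w) :
    ∫ y in c..x, energyDensity D F ε w y ≤ ∫ y in c..d, energyDensity D F ε w y := by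
  rw [← intervalIntegral.integral_add_adjacent_intervals (b := x)
    ((hw.mono le_rfl hcx hxd).intervalIntegrable_energyDensity hcx H.continuous_D H.continuous_F ε)
    ((hw.mono hcx hxd le_rfl).intervalIntegrable_energyDensity hxd H.continuous_D H.continuous_F ε)]
  have := H.integral_energyDensity_nonneg (w := w) hε hxd
  linarith

theorem integral_mono_left (hε : 0 < ε) {c d x : ℝ} (hcx : c ≤ x) (hxd : x ≤ d)
    (hw : MemH1 c d w) :
    ∫ y in x..d, energyDensity D F ε w y ≤ ∫ y in c..d, energyDensity D F ε w y := by
  rw [← intervalIntegral.integral_add_adjacent_intervals (b := x)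
    ((hw.mono le_rfl hcx hxd).intervalIntegrable_energyDensity hcx H.continuous_D H.continuous_F ε)
    ((hw.mono hcx hxd le_rfl).intervalIntegrable_energyDensity hxd H.continuous_D H.continuous_F ε)]
  have := H.integral_energyDensity_nonneg (w := w) hε hcx
  linarith

/-- Calibrate with a `tanh` that vanishes at the outer end `d`, so that the value `w d` plays no
role. The tail then pays the cost that separates `w c` from the well, up to the errors `ω` and an
exponential in the length of the tail. -/
theorem tail_right (hε : 0 < ε) {c d : ℝ} (hcd : c ≤ d) (hw : MemH1 c d w)
    (hwb : ∀ x ∈ Icc c d, w x ∈ Icc (-1 : ℝ) 1) {v₀ l ω : ℝ} (hl : 0 ≤ l) (hω : 0 ≤ ω)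
    (hT : TailBound D F v₀ l ω) {σ : ℝ} (hσ : σ = -1 ∨ σ = 1)
    (hc : transitionCost D F σ (w c) ≤ v₀ / 2) :
    transitionCost D F σ (w c) - ω - 2 * transitionEnergy D F * Real.exp (-(2 * (l * (d - c) / ε)))
      ≤ ∫ x in c..d, energyDensity D F ε w x := by
  have hγ := H.transitionEnergy_nonneg
  have hexp := Real.exp_pos (-(2 * (l * (d - c) / ε)))
  by_cases hx : ∀ x ∈ Icc c d, transitionCost D F σ (w x) ≤ v₀
  · have h1 := tail_aux H.continuous_D H.continuous_F H.nonneg_D H.nonneg_F hε hcd hw (τ := -1)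
      (ω := ω) (l := l) d (by rw [neg_sq]; exact sq_eq_one_of_sign hσ) (by norm_num)
      (H.hasDerivAt_transitionCost σ) (fun x hx' => hT σ hσ _ (hwb x hx') (hx x hx'))
    have h2 : 0 ≤ l * (d - c) / ε := div_nonneg (mul_nonneg hl (sub_nonneg.2 hcd)) hε.le
    have h3 := sub_sub_le_tanh_mul h2 (transitionCost_nonneg hσ (hwb c (left_mem_Icc.2 hcd)))
      (H.transitionCost_le hσ (hwb c (left_mem_Icc.2 hcd))) hω
    rw [show l * (-1 * (c - d)) / ε = l * (d - c) / ε by ring,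
      show l * (-1 * (d - d)) / ε = 0 by ring, Real.tanh_zero] at h1
    linarith
  -- If `w` leaves the region where the tail bound is available, the cost rises from at most `v₀/2`
  -- to more than `v₀`, and this rise alone pays for the cost at `c`.
  · push Not at hx
    obtain ⟨x, hx, hv⟩ := hx
    have h1 := H.transitionCost_sub_le hε hx.1 (hw.mono le_rfl hx.1 hx.2) hσ
    have h2 := H.integral_mono_right hε hx.1 hx.2 hw
    have h3 := le_abs_self (transitionCost D F σ (w x) - transitionCost D F σ (w c))
    have : 0 ≤ 2 * transitionEnergy D F * Real.exp (-(2 * (l * (d - c) / ε))) := by positivity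
    linarith

theorem tail_left (hε : 0 < ε) {c d : ℝ} (hcd : c ≤ d) (hw : MemH1 c d w)
    (hwb : ∀ x ∈ Icc c d, w x ∈ Icc (-1 : ℝ) 1) {v₀ l ω : ℝ} (hl : 0 ≤ l) (hω : 0 ≤ ω)
    (hT : TailBound D F v₀ l ω) {σ : ℝ} (hσ : σ = -1 ∨ σ = 1)
    (hd : transitionCost D F σ (w d) ≤ v₀ / 2) :
    transitionCost D F σ (w d) - ω - 2 * transitionEnergy D F * Real.exp (-(2 * (l * (d - c) / ε)))
      ≤ ∫ x in c..d, energyDensity D F ε w x := by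
  have hγ := H.transitionEnergy_nonneg
  have hexp := Real.exp_pos (-(2 * (l * (d - c) / ε)))
  by_cases hx : ∀ x ∈ Icc c d, transitionCost D F σ (w x) ≤ v₀
  · have h1 := tail_aux H.continuous_D H.continuous_F H.nonneg_D H.nonneg_F hε hcd hw (τ := 1)
      (ω := ω) (l := l) c (by rw [neg_sq]; exact sq_eq_one_of_sign hσ) (by norm_num)
      (H.hasDerivAt_transitionCost σ) (fun x hx' => hT σ hσ _ (hwb x hx') (hx x hx'))
    have h2 : 0 ≤ l * (d - c) / ε := div_nonneg (mul_nonneg hl (sub_nonneg.2 hcd)) hε.le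
    have h3 := sub_sub_le_tanh_mul h2 (transitionCost_nonneg hσ (hwb d (right_mem_Icc.2 hcd)))
      (H.transitionCost_le hσ (hwb d (right_mem_Icc.2 hcd))) hω
    rw [show l * (1 * (d - c)) / ε = l * (d - c) / ε by ring,
      show l * (1 * (c - c)) / ε = 0 by ring, Real.tanh_zero] at h1
    linarith
  · push Not at hx
    obtain ⟨x, hx, hv⟩ := hx
    have h1 := H.transitionCost_sub_le hε hx.2 (hw.mono hx.1 hx.2 le_rfl) hσ
    have h2 := H.integral_mono_left hε hx.1 hx.2 hw
    have h3 := neg_abs_le (transitionCost D F σ (w d) - transitionCost D F σ (w x))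
    have : 0 ≤ 2 * transitionEnergy D F * Real.exp (-(2 * (l * (d - c) / ε))) := by positivity
    linarith

/-- The increment of the cost from `σ` bounds the energy below; `transitionCost_add` at the end `d`
turns it into the deviation from a full transition. -/
theorem middle (hε : 0 < ε) {c d : ℝ} (hcd : c ≤ d) (hw : MemH1 c d w)
    {σ : ℝ} (hσ : σ = -1 ∨ σ = 1) :
    transitionEnergy D F - transitionCost D F σ (w c) - transitionCost D F (-σ) (w d)
      ≤ ∫ x in c..d, energyDensity D F ε w x := by
  have h1 := H.transitionCost_sub_le hε hcd hw hσ
  have h2 := le_abs_self (transitionCost D F σ (w d) - transitionCost D F σ (w c))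
  have h3 := H.transitionCost_add hσ (w d)
  linarith

/-- Lower bound for the energy of one transition layer. -/
theorem layer (hε : 0 < ε) {h r η y₁ y₂ : ℝ} (hηr : η ≤ r) (hy₁ : y₁ ∈ Ioo (h - η) h)
    (hy₂ : y₂ ∈ Ioo h (h + η)) (hw : MemH1 (h - r) (h + r) w)
    (hwb : ∀ x ∈ Icc (h - r) (h + r), w x ∈ Icc (-1 : ℝ) 1) {v₀ l ω : ℝ} (hl : 0 ≤ l)
    (hω : 0 ≤ ω) (hT : TailBound D F v₀ l ω) {σ : ℝ} (hσ : σ = -1 ∨ σ = 1)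
    (h₁ : transitionCost D F σ (w y₁) ≤ v₀ / 2) (h₂ : transitionCost D F (-σ) (w y₂) ≤ v₀ / 2) :
    transitionEnergy D F
        - (2 * ω + 4 * transitionEnergy D F * Real.exp (-(2 * (l * (r - η) / ε))))
      ≤ ∫ x in (h - r)..(h + r), energyDensity D F ε w x := by
  have hγ := H.transitionEnergy_nonneg
  obtain ⟨a1, a2⟩ := hy₁
  obtain ⟨b1, b2⟩ := hy₂
  have i1 : h - r ≤ y₁ := by linarith
  have i2 : y₁ ≤ y₂ := by linarith
  have i3 : y₂ ≤ h + r := by linarith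
  have m1 := hw.mono le_rfl i1 (i2.trans i3)
  have m2 := hw.mono i1 i2 i3
  have m3 := hw.mono (i1.trans i2) i3 le_rfl
  -- The costs at `y₁` and `y₂` missing from the middle piece are exactly those paid by the two
  -- tails, so they cancel in the sum.
  have e1 := H.tail_left hε i1 m1 (fun x hx => hwb x ⟨hx.1, hx.2.trans (i2.trans i3)⟩) hl hω hT
    hσ h₁
  have e2 := H.middle hε i2 m2 hσ
  have e3 := H.tail_right hε i3 m3 (fun x hx => hwb x ⟨(i1.trans i2).trans hx.1, hx.2⟩) hl hω hT
    (neg_sign hσ) h₂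
  have n1 := m1.intervalIntegrable_energyDensity i1 H.continuous_D H.continuous_F ε
  have n2 := m2.intervalIntegrable_energyDensity i2 H.continuous_D H.continuous_F ε
  have n3 := m3.intervalIntegrable_energyDensity i3 H.continuous_D H.continuous_F ε
  rw [← intervalIntegral.integral_add_adjacent_intervals (n1.trans n2) n3,
    ← intervalIntegral.integral_add_adjacent_intervals n1 n2]
  -- Both tails have length at least `r - η`; two exponentials with factor `2γ` give the factor
  -- `4γ`.
  have hexp : ∀ q, r - η ≤ q → transitionEnergy D F * Real.exp (-(2 * (l * q / ε)))
      ≤ transitionEnergy D F * Real.exp (-(2 * (l * (r - η) / ε))) := by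
    intro q hq
    gcongr
  have x1 := hexp (y₁ - (h - r)) (by linarith)
  have x2 := hexp (h + r - y₂) (by linarith)
  linarith

end AdmissibleCoefficients

theorem sum_integral_le_integral {ι : Type*} [Fintype ι] {f : ℝ → ℝ} {a b : ℝ} (hab : a ≤ b)
    (hf : IntervalIntegrable f volume a b) (hf0 : ∀ x, 0 ≤ f x) (c d : ι → ℝ)
    (hac : ∀ i, a ≤ c i) (hcd : ∀ i, c i ≤ d i) (hdb : ∀ i, d i ≤ b)
    (hdisj : Pairwise fun i j => d i ≤ c j ∨ d j ≤ c i) :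
    ∑ i, ∫ x in (c i)..(d i), f x ≤ ∫ x in a..b, f x := by
  rw [intervalIntegrable_iff_integrableOn_Ioc_of_le hab] at hf
  have h1 : ∀ i, Ioc (c i) (d i) ⊆ Ioc a b := fun i => Ioc_subset_Ioc (hac i) (hdb i)
  simp_rw [intervalIntegral.integral_of_le hab, intervalIntegral.integral_of_le (hcd _)]
  rw [← integral_iUnion_fintype (fun i => measurableSet_Ioc) _ (fun i => hf.mono_set (h1 i))]
  · exact setIntegral_mono_set hf (Eventually.of_forall hf0)
      (LE.le.eventuallyLE (iUnion_subset h1))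
  · intro i j hij
    rcases hdisj hij with h | h
    · exact Set.disjoint_left.2 fun x hx hx' => by linarith [hx.2, hx'.1]
    · exact Set.disjoint_left.2 fun x hx hx' => by linarith [hx.1, hx'.2]

/-! ### Functions close to a step function -/

namespace IsStep

variable {a b : ℝ} {N : ℕ} {h : Fin N → ℝ} {v : ℝ → ℝ} (hv : IsStep a b h v)
include hv

/-- Between consecutive jumps the step function is constant. -/
theorem exists_eq_const {c d : ℝ} (hac : a ≤ c) (hdb : d ≤ b) (hcd : ∀ i, h i ≤ c ∨ d ≤ h i) :
    ∃ σ : ℝ, (σ = -1 ∨ σ = 1) ∧ ∀ x ∈ Ioo c d, v x = σ := by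
  obtain ⟨-, -, -, σ, hσ, hvx⟩ := hv
  refine ⟨σ * (-1) ^ (Finset.univ.filter (fun i => h i ≤ c)).card, ?_, fun x hx => ?_⟩
  · rcases hσ with rfl | rfl <;>
    rcases neg_one_pow_eq_or ℝ (Finset.univ.filter (fun i => h i ≤ c)).card with e | e <;>
    rw [e] <;> norm_num
  · rw [hvx x ⟨hac.trans hx.1.le, hx.2.le.trans hdb⟩]
    · congr 3
      ext i
      simp only [Finset.mem_filter, Finset.mem_univ, true_and]
      constructor
      · intro hi
        rcases hcd i with h1 | h1
        · exact h1
        · linarith [hx.2]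
      · intro hi
        exact hi.trans_lt hx.1
    · intro i hi
      rcases hcd i with h1 | h1
      · linarith [hx.1]
      · linarith [hx.2]

/-- The step function changes sign at every jump. -/
theorem exists_jump {r : ℝ} (hr : IsSeparated a b h r) (i : Fin N) :
    ∃ σ : ℝ, (σ = -1 ∨ σ = 1) ∧ (∀ x ∈ Ioo (h i - r) (h i), v x = σ) ∧
      ∀ x ∈ Ioo (h i) (h i + r), v x = -σ := by
  obtain ⟨hr0, hsep, hra, hrb⟩ := hr
  obtain ⟨-, -, -, σ, hσ, hvx⟩ := hv
  have hlt : ∀ j, j < i → h j < h i - r := fun j hj => by linarith [hsep j i hj]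
  have hgt : ∀ j, i < j → h i + r < h j := fun j hj => by linarith [hsep i j hj]
  refine ⟨σ * (-1) ^ (Finset.univ.filter (fun j => j < i)).card, ?_, fun x hx => ?_, fun x hx => ?_⟩
  · rcases hσ with rfl | rfl <;>
    rcases neg_one_pow_eq_or ℝ (Finset.univ.filter (fun j => j < i)).card with e | e <;>
    rw [e] <;> norm_num
  · have key : ∀ j, h j < x ↔ j < i := by
      intro j
      rcases lt_trichotomy j i with hj | rfl | hj
      · exact iff_of_true ((hlt j hj).trans hx.1) hj
      · exact iff_of_false (by linarith [hx.2]) (lt_irrefl j)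
      · exact iff_of_false (by linarith [hx.2, hgt j hj]) hj.not_gt
    rw [hvx x ⟨by linarith [hx.1, hra i], by linarith [hx.2, hrb i]⟩]
    · simp only [key]
    · intro j hj
      rcases lt_trichotomy j i with hj' | rfl | hj'
      · linarith [hlt j hj', hx.1]
      · linarith [hx.2]
      · linarith [hx.2, hgt j hj']
  · have key : ∀ j, h j < x ↔ j = i ∨ j < i := by
      intro j
      rcases lt_trichotomy j i with hj | rfl | hj
      · exact iff_of_true (by linarith [hlt j hj, hx.1]) (Or.inr hj)
      · exact iff_of_true hx.1 (Or.inl rfl)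
      · exact iff_of_false (by linarith [hx.2, hgt j hj]) (by
          rintro (rfl | h'')
          · exact lt_irrefl _ hj
          · exact lt_asymm hj h'')
    rw [hvx x ⟨by linarith [hx.1, hra i], by linarith [hx.2, hrb i]⟩]
    · simp only [key]
      rw [Finset.filter_or, Finset.card_union_of_disjoint, Finset.filter_eq' Finset.univ i]
      · simp [pow_add]
      · rw [Finset.disjoint_filter]
        rintro j - rfl
        exact lt_irrefl j
    · intro j hj
      rcases lt_trichotomy j i with hj' | rfl | hj'
      · linarith [hlt j hj', hx.1]
      · linarith [hx.1]
      · linarith [hx.2, hgt j hj']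

theorem intervalIntegrable (hab : a ≤ b) : IntervalIntegrable v volume a b := by
  obtain ⟨-, -, -, σ, hσ, hvx⟩ := hv
  rw [intervalIntegrable_iff_integrableOn_Ioo_of_le hab]
  -- A product with one sign flip per jump is a bounded measurable function agreeing with `v` on
  -- `(a,b)` off the finite set of jumps.
  set V : ℝ → ℝ := fun x => σ * ∏ i, if h i < x then (-1 : ℝ) else 1 with hV
  have hVm : Measurable V := by
    refine Measurable.const_mul (Finset.measurable_prod _ fun i _ => ?_) σ
    exact Measurable.ite measurableSet_Ioi measurable_const measurable_const
  have hVb : ∀ x, ‖V x‖ ≤ 1 := by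
    intro x
    have h1 : ∀ i, |(if h i < x then (-1 : ℝ) else 1)| = 1 := by intro i; split_ifs <;> norm_num
    have h2 : |σ| = 1 := by rcases hσ with rfl | rfl <;> norm_num
    rw [Real.norm_eq_abs, hV, abs_mul, Finset.abs_prod, h2, one_mul]
    simp [h1]
  have hVi : IntegrableOn V (Ioo a b) :=
    Measure.integrableOn_of_bounded (by simp) hVm.aestronglyMeasurable
      (Eventually.of_forall hVb)
  refine hVi.congr ?_
  have hfin : (range h).Countable := (finite_range h).countable
  rw [EventuallyEq, ae_restrict_iff' measurableSet_Ioo]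
  filter_upwards [hfin.ae_notMem volume] with x hx hxm
  rw [hvx x (Ioo_subset_Icc_self hxm) (fun i hi => hx ⟨i, hi.symm⟩), hV]
  simp [Finset.prod_ite]

end IsStep

/-- Chebyshev: `|w - σ| ≥ ρ` on all of `(c,d)` would force an `L¹` distance of at least `ρ (d - c)`.
-/
theorem exists_abs_sub_lt {a b c d : ℝ} {w v : ℝ → ℝ} (hac : a ≤ c) (hcd : c < d) (hdb : d ≤ b)
    (hi : IntervalIntegrable (fun x => |w x - v x|) volume a b) {σ ρ : ℝ}
    (hv : ∀ x ∈ Ioo c d, v x = σ) (hlt : ∫ x in a..b, |w x - v x| < ρ * (d - c)) :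
    ∃ y ∈ Ioo c d, |w y - σ| < ρ := by
  by_contra! hcon
  have hab : a ≤ b := hac.trans (hcd.le.trans hdb)
  rw [intervalIntegrable_iff_integrableOn_Ioo_of_le hab] at hi
  rw [intervalIntegral.integral_of_le hab, integral_Ioc_eq_integral_Ioo] at hlt
  have h1 : ∫ _ in Ioo c d, ρ ≤ ∫ x in Ioo c d, |w x - v x| := by
    refine setIntegral_mono_on (by simp) (hi.mono_set (Ioo_subset_Ioo hac hdb)) measurableSet_Ioo ?_
    intro x hx
    rw [hv x hx]
    exact hcon x hx
  have h2 : ∫ x in Ioo c d, |w x - v x| ≤ ∫ x in Ioo a b, |w x - v x| :=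
    setIntegral_mono_set hi (Eventually.of_forall fun x => abs_nonneg _)
      (LE.le.eventuallyLE (Ioo_subset_Ioo hac hdb))
  simp only [integral_const, smul_eq_mul, measureReal_restrict_apply_univ,
    Real.volume_real_Ioo_of_le hcd.le] at h1
  linarith

/-! ### Energy and interface of functions close to the step function -/

section Layers

variable {D F : ℝ → ℝ} {a b : ℝ} {N : ℕ} {h : Fin N → ℝ} {v : ℝ → ℝ} {r : ℝ}

/-- A function that is close to the step function is close to the wells on both sides of every
jump. -/
theorem exists_near_wells (H : AdmissibleCoefficients D F) (hab : a ≤ b) (hv : IsStep a b h v)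
    (hr : IsSeparated a b h r) {η κ : ℝ} (hη : 0 < η) (hηr : η ≤ r) (hκ : 0 < κ) :
    ∃ δ : ℝ, 0 < δ ∧ ∀ w : ℝ → ℝ, MemH1 a b w → ∫ x in a..b, |w x - v x| ≤ δ →
      (∀ i, ∃ σ : ℝ, (σ = -1 ∨ σ = 1) ∧ ∃ y₁ ∈ Ioo (h i - η) (h i), ∃ y₂ ∈ Ioo (h i) (h i + η),
        transitionCost D F σ (w y₁) ≤ κ ∧ transitionCost D F (-σ) (w y₂) ≤ κ ∧
        |w y₁ - σ| ≤ κ ∧ |w y₂ - -σ| ≤ κ) ∧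
      ∀ c, a ≤ c → c + η ≤ b → (∀ i, h i ≤ c ∨ c + η ≤ h i) → ∃ σ : ℝ, (σ = -1 ∨ σ = 1) ∧
        ∃ y ∈ Ioo c (c + η), transitionCost D F σ (w y) ≤ κ := by
  obtain ⟨ρ₀, hρ₀, hcost₀⟩ := H.exists_transitionCost_le hκ
  obtain ⟨ρ, hρ, hρκ, hcost⟩ : ∃ ρ : ℝ, 0 < ρ ∧ ρ ≤ κ ∧ ∀ σ : ℝ, σ = -1 ∨ σ = 1 →
      ∀ s, |s - σ| < ρ → transitionCost D F σ s ≤ κ :=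
    ⟨min ρ₀ κ, lt_min hρ₀ hκ, min_le_right _ _, fun σ hσ s hs =>
      hcost₀ σ hσ s (hs.trans_le (min_le_left _ _))⟩
  -- Every window has length `η`, so an `L¹` distance below `ρη` suffices in each of them.
  refine ⟨ρ * η / 2, by positivity, fun w hw hδ => ⟨fun i => ?_, fun c hac hcb hc => ?_⟩⟩
  all_goals
    have hi : IntervalIntegrable (fun x => |w x - v x|) volume a b :=
      ((hw.intervalIntegrable_comp hab continuous_id).sub (hv.intervalIntegrable hab)).abs
    have hlt : ∫ x in a..b, |w x - v x| < ρ * η := by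
      have : 0 < ρ * η := by positivity
      linarith
  · obtain ⟨σ, hσ, hl, hr'⟩ := hv.exists_jump hr i
    obtain ⟨hr0, -, hra, hrb⟩ := hr
    obtain ⟨y₁, hy₁, h1⟩ := exists_abs_sub_lt (c := h i - η) (d := h i) (σ := σ) (ρ := ρ)
      (by linarith [hra i]) (by linarith) (by linarith [hrb i]) hi
      (fun x hx => hl x ⟨by linarith [hx.1], hx.2⟩) (by rwa [sub_sub_cancel])
    obtain ⟨y₂, hy₂, h2⟩ := exists_abs_sub_lt (c := h i) (d := h i + η) (σ := -σ) (ρ := ρ)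
      (by linarith [hra i]) (by linarith) (by linarith [hrb i]) hi
      (fun x hx => hr' x ⟨hx.1, by linarith [hx.2]⟩) (by rwa [add_sub_cancel_left])
    exact ⟨σ, hσ, y₁, hy₁, y₂, hy₂, hcost σ hσ _ h1, hcost _ (neg_sign hσ) _ h2,
      (h1.trans_le hρκ).le, (h2.trans_le hρκ).le⟩
  · obtain ⟨σ, hσ, hc'⟩ := hv.exists_eq_const hac hcb hc
    obtain ⟨y, hy, h1⟩ := exists_abs_sub_lt (c := c) (d := c + η) (σ := σ) (ρ := ρ)
      hac (by linarith) hcb hi hc' (by rwa [add_sub_cancel_left])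
    exact ⟨σ, hσ, y, hy, hcost σ hσ _ h1⟩

theorem IsSeparated.le_or_le (hr : IsSeparated a b h r) {η : ℝ} (hη : η ≤ r) :
    Pairwise fun i j => h i + η ≤ h j - η ∨ h j + η ≤ h i - η := by
  intro i j hij
  rcases lt_or_gt_of_ne hij with hlt | hlt
  · left; linarith [hr.2.1 i j hlt]
  · right; linarith [hr.2.1 j i hlt]

/-- The energy of a function close to a step function with `N` jumps is at least the energy of `N`
transitions, up to a small error. -/
theorem energy_lower_bound (H : AdmissibleCoefficients D F) (hab : a ≤ b) (hv : IsStep a b h v)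
    (hr : IsSeparated a b h r) {η v₀ : ℝ} (hη : 0 < η) (hηr : η ≤ r) (hv₀ : 0 < v₀) :
    ∃ δ : ℝ, 0 < δ ∧ ∀ ε l ω : ℝ, 0 < ε → 0 ≤ l → 0 ≤ ω → TailBound D F v₀ l ω →
      ∀ w : ℝ → ℝ, MemH1 a b w → (∀ x ∈ Icc a b, w x ∈ Icc (-1 : ℝ) 1) →
        ∫ x in a..b, |w x - v x| ≤ δ →
      N * transitionEnergy D F
        - N * (2 * ω + 4 * transitionEnergy D F * Real.exp (-(2 * (l * (r - η) / ε))))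
        ≤ energy D F ε a b w := by
  obtain ⟨δ, hδ, key⟩ := exists_near_wells H hab hv hr hη hηr (half_pos hv₀)
  refine ⟨δ, hδ, fun ε l ω hε hl hω hT w hw hwb hwv => ?_⟩
  obtain ⟨hk, -⟩ := key w hw hwv
  have hr0 := hr.1
  have hra := hr.2.2.1
  have hrb := hr.2.2.2
  have hlay : ∀ i, transitionEnergy D F
      - (2 * ω + 4 * transitionEnergy D F * Real.exp (-(2 * (l * (r - η) / ε))))
      ≤ ∫ x in (h i - r)..(h i + r), energyDensity D F ε w x := by
    intro i
    obtain ⟨σ, hσ, y₁, hy₁, y₂, hy₂, h1, h2, -, -⟩ := hk i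
    exact H.layer hε hηr hy₁ hy₂ (hw.mono (hra i) (by linarith) (hrb i))
      (fun x hx => hwb x ⟨(hra i).trans hx.1, hx.2.trans (hrb i)⟩) hl hω hT hσ h1 h2
  have hsum := sum_integral_le_integral hab
    (hw.intervalIntegrable_energyDensity hab H.continuous_D H.continuous_F ε)
    (energyDensity_nonneg H.nonneg_D H.nonneg_F hε w) (fun i => h i - r) (fun i => h i + r)
    hra (fun i => by linarith) hrb (hr.le_or_le le_rfl)
  have hs := Finset.sum_le_sum fun i (_ : i ∈ Finset.univ) => hlay i
  rw [Finset.sum_const, Finset.card_univ, Fintype.card_fin, nsmul_eq_mul] at hs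
  have : energy D F ε a b w = ∫ x in a..b, energyDensity D F ε w x := rfl
  rw [this]
  linarith

/-- The part of `K` in `[-1,1]` is compact and avoids the wells, so the continuous positive cost has
a positive minimum on it. -/
theorem exists_transitionCost_ge (H : AdmissibleCoefficients D F) {K : Set ℝ} (hK : IsClosed K)
    (hK1 : K ⊆ {-1, 1}ᶜ) : ∃ c : ℝ, 0 < c ∧ ∀ σ : ℝ, σ = -1 ∨ σ = 1 →
      ∀ s ∈ K ∩ Icc (-1) 1, c ≤ transitionCost D F σ s := by
  have hc : IsCompact (K ∩ Icc (-1 : ℝ) 1) := isCompact_Icc.inter_left hK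
  have h1 : ∀ σ : ℝ, σ = -1 ∨ σ = 1 → ∃ c : ℝ, 0 < c ∧
      ∀ s ∈ K ∩ Icc (-1) 1, c ≤ transitionCost D F σ s := by
    intro σ hσ
    have hpos : ∀ s ∈ K ∩ Icc (-1 : ℝ) 1, 0 < transitionCost D F σ s := by
      intro s hs
      have hs1 := hK1 hs.1
      simp only [mem_compl_iff, mem_insert_iff, mem_singleton_iff, not_or] at hs1
      exact H.transitionCost_pos hσ
        ⟨lt_of_le_of_ne hs.2.1 (Ne.symm hs1.1), lt_of_le_of_ne hs.2.2 hs1.2⟩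
    rcases (K ∩ Icc (-1 : ℝ) 1).eq_empty_or_nonempty with he | hne
    · exact ⟨1, one_pos, by simp [he]⟩
    · obtain ⟨s, hs, hmin⟩ := hc.exists_isMinOn hne (H.continuous_transitionCost σ).continuousOn
      exact ⟨_, hpos s hs, fun t ht => hmin ht⟩
  obtain ⟨c₁, h1', h1''⟩ := h1 (-1) (Or.inl rfl)
  obtain ⟨c₂, h2', h2''⟩ := h1 1 (Or.inr rfl)
  refine ⟨min c₁ c₂, lt_min h1' h2', ?_⟩
  rintro σ (rfl | rfl) s hs
  · exact (min_le_left _ _).trans (h1'' s hs)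
  · exact (min_le_right _ _).trans (h2'' s hs)

/-- Localization of the interface of a function that is close to a step function and has almost
minimal energy. -/
theorem interface_near_jumps (H : AdmissibleCoefficients D F) (hab : a ≤ b) (hv : IsStep a b h v)
    (hN : 0 < N) (hr : IsSeparated a b h r) {K : Set ℝ} (hK : IsClosed K) (hK1 : K ⊆ {-1, 1}ᶜ)
    {η : ℝ} (hη : 0 < η) :
    ∃ δ κ : ℝ, 0 < δ ∧ 0 < κ ∧ ∀ ε : ℝ, 0 < ε →
      ∀ w : ℝ → ℝ, MemH1 a b w → (∀ x ∈ Icc a b, w x ∈ Icc (-1 : ℝ) 1) →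
        ∫ x in a..b, |w x - v x| ≤ δ → energy D F ε a b w ≤ N * transitionEnergy D F + κ →
      ∀ x ∈ Icc a b, w x ∈ K → ∃ i, |x - h i| ≤ η := by
  obtain ⟨c, hc, hcost⟩ := exists_transitionCost_ge H hK hK1
  have hr0 := hr.1
  have hra := hr.2.2.1
  have hrb := hr.2.2.2
  -- Half of `η` for the windows at the jumps and half for the window at `x`: a point at distance
  -- more than `η` from the jumps then has a window disjoint from theirs.
  have hη0 : 0 < min η r / 2 := half_pos (lt_min hη hr0)
  have hη1 : min η r / 2 ≤ η / 2 := by linarith [min_le_left η r]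
  have hη2 : min η r / 2 ≤ r / 2 := by linarith [min_le_right η r]
  set η₀ := min η r / 2
  have hN0 : (0 : ℝ) ≤ N := Nat.cast_nonneg N
  -- There are `2N + 1` losses of size `κ₀`: two in each transition and one in the extra interval
  -- near `x`. Together they are `c/2`, which leaves an energy of at least `Nγ + c/2`, above the
  -- allowed `Nγ + c/4`.
  have hκ0 : 0 < c / (2 * (2 * N + 1)) := by positivity
  obtain ⟨δ, hδ, key⟩ := exists_near_wells H hab hv hr hη0 (by linarith) hκ0
  refine ⟨δ, c / 4, hδ, by positivity, fun ε hε w hw hwb hwv hE x hx hxK => ?_⟩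
  by_contra! hcon
  obtain ⟨hk, hk'⟩ := key w hw hwv
  set κ₀ := c / (2 * (2 * N + 1)) with hκ₀
  have hκ₀' : κ₀ * (2 * N + 1) = c / 2 := by rw [hκ₀]; field_simp
  choose σ hσ y₁ hy₁ y₂ hy₂ hc₁ hc₂ _ _ using hk
  have hmid : ∀ i, transitionEnergy D F - 2 * κ₀
      ≤ ∫ x in (y₁ i)..(y₂ i), energyDensity D F ε w x := by
    intro i
    have := H.middle hε (w := w) (c := y₁ i) (d := y₂ i) ((hy₁ i).2.trans (hy₂ i).1).le
      (hw.mono (by linarith [hra i, (hy₁ i).1]) ((hy₁ i).2.trans (hy₂ i).1).le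
        (by linarith [hrb i, (hy₂ i).2])) (hσ i)
    linarith [hc₁ i, hc₂ i]
  -- Next to `x`, on a side that fits into `[a,b]`, there is a point where `w` is near a well.
  -- Passing from a value in `K` to that value costs at least `c - κ₀`.
  obtain ⟨p, q, hap, hpq, hqb, hpx, hqx, hpqE⟩ : ∃ p q : ℝ, a ≤ p ∧ p ≤ q ∧ q ≤ b ∧ x - η₀ ≤ p ∧
      q ≤ x + η₀ ∧ c - κ₀ ≤ ∫ x in p..q, energyDensity D F ε w x := by
    have hi0 : η₀ + η₀ ≤ b - a := by
      have := hra ⟨0, hN⟩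
      have := hrb ⟨0, hN⟩
      linarith
    have hfar : ∀ i, h i ≤ x - η₀ ∨ x + η₀ ≤ h i := by
      intro i
      rcases lt_abs.1 (hcon i) with h1 | h1
      · left; linarith
      · right; linarith
    by_cases hxb : x + η₀ ≤ b
    · obtain ⟨s, hs, y, hy, hcy⟩ := hk' x hx.1 hxb (fun i => (hfar i).imp (by intro; linarith) id)
      refine ⟨x, y, hx.1, hy.1.le, hy.2.le.trans hxb, by linarith, hy.2.le, ?_⟩
      have h1 := H.transitionCost_sub_le hε hy.1.le (hw.mono hx.1 hy.1.le (hy.2.le.trans hxb)) hs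
      have h2 := neg_abs_le (transitionCost D F s (w y) - transitionCost D F s (w x))
      have h3 := hcost s hs (w x) ⟨hxK, hwb x hx⟩
      linarith
    · have hxa : a ≤ x - η₀ := by linarith
      obtain ⟨s, hs, y, hy, hcy⟩ := hk' (x - η₀) hxa (by linarith [hx.2])
        (fun i => (hfar i).imp id (by intro; linarith))
      have hyx : y ≤ x := by linarith [hy.2]
      refine ⟨y, x, hxa.trans hy.1.le, hyx, hx.2, hy.1.le, by linarith, ?_⟩
      have h1 := H.transitionCost_sub_le hε hyx (hw.mono (hxa.trans hy.1.le) hyx hx.2) hs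
      have h2 := le_abs_self (transitionCost D F s (w x) - transitionCost D F s (w y))
      have h3 := hcost s hs (w x) ⟨hxK, hwb x hx⟩
      linarith
  -- The index `none` stands for the extra interval `[p,q]`, the others for the transitions.
  have hsum := sum_integral_le_integral (ι := Option (Fin N)) hab
    (hw.intervalIntegrable_energyDensity hab H.continuous_D H.continuous_F ε)
    (energyDensity_nonneg H.nonneg_D H.nonneg_F hε w)
    (fun o => o.elim p y₁) (fun o => o.elim q y₂) ?_ ?_ ?_ ?_
  · rw [Fintype.sum_option] at hsum
    have hs := Finset.sum_le_sum fun i (_ : i ∈ Finset.univ) => hmid i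
    rw [Finset.sum_const, Finset.card_univ, Fintype.card_fin, nsmul_eq_mul] at hs
    have he : energy D F ε a b w = ∫ x in a..b, energyDensity D F ε w x := rfl
    rw [he] at hE
    simp only [Option.elim] at hsum
    nlinarith
  · rintro (_ | i)
    · exact hap
    · show a ≤ y₁ i
      linarith [hra i, (hy₁ i).1]
  · rintro (_ | i)
    · exact hpq
    · exact ((hy₁ i).2.trans (hy₂ i).1).le
  · rintro (_ | i)
    · exact hqb
    · show y₂ i ≤ b
      linarith [hrb i, (hy₂ i).2]
  · have hsep : ∀ i, q ≤ y₁ i ∨ y₂ i ≤ p := by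
      intro i
      rcases lt_abs.1 (hcon i) with h1 | h1
      · right; linarith [(hy₂ i).2]
      · left; linarith [(hy₁ i).1]
    rintro (_ | i) (_ | j) hij
    · exact absurd rfl hij
    · exact hsep j
    · exact (hsep i).symm
    · have hij' : i ≠ j := fun e => hij (by rw [e])
      show y₂ i ≤ y₁ j ∨ y₂ j ≤ y₁ i
      rcases hr.le_or_le (η := η₀) (by linarith) hij' with h1 | h1
      · left; linarith [(hy₂ i).2, (hy₁ j).1]
      · right; linarith [(hy₂ j).2, (hy₁ i).1]

/-- A function close to a step function takes every value in `(-1, 1)` near every jump. -/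
theorem exists_eq_near_jump (H : AdmissibleCoefficients D F) (hab : a ≤ b) (hv : IsStep a b h v)
    (hr : IsSeparated a b h r) {k : ℝ} (hk : k ∈ Ioo (-1 : ℝ) 1) {η : ℝ} (hη : 0 < η) :
    ∃ δ : ℝ, 0 < δ ∧ ∀ w : ℝ → ℝ, MemH1 a b w → ∫ x in a..b, |w x - v x| ≤ δ →
      ∀ i, ∃ x ∈ Icc a b, w x = k ∧ |x - h i| ≤ η := by
  have hr0 := hr.1
  have hra := hr.2.2.1
  have hrb := hr.2.2.2
  -- Within this distance of opposite wells, the two values of `w` lie on either side of `k`, as the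
  -- intermediate value theorem requires.
  have hκ : 0 < min (1 - k) (1 + k) := lt_min (by linarith [hk.2]) (by linarith [hk.1])
  obtain ⟨δ, hδ, key⟩ := exists_near_wells H hab hv hr (lt_min hη hr0) (min_le_right _ _) hκ
  have hη1 := min_le_left η r
  have hη2 := min_le_right η r
  have hk1 := min_le_left (1 - k) (1 + k)
  have hk2 := min_le_right (1 - k) (1 + k)
  refine ⟨δ, hδ, fun w hw hwv i => ?_⟩
  obtain ⟨σ, hσ, y₁, hy₁, y₂, hy₂, -, -, h1, h2⟩ := (key w hw hwv).1 i
  have hle : y₁ ≤ y₂ := (hy₁.2.trans hy₂.1).le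
  have hsub : Icc y₁ y₂ ⊆ Icc a b :=
    Icc_subset_Icc (by linarith [hy₁.1, hra i]) (by linarith [hy₂.2, hrb i])
  have hcont : ContinuousOn w (Icc y₁ y₂) := (hw.continuousOn hab).mono hsub
  have hmem : k ∈ w '' Icc y₁ y₂ := by
    rw [abs_le] at h1 h2
    rcases hσ with rfl | rfl
    · exact intermediate_value_Icc hle hcont ⟨by linarith, by linarith⟩
    · exact intermediate_value_Icc' hle hcont ⟨by linarith, by linarith⟩
  obtain ⟨x, hx, hxk⟩ := hmem
  refine ⟨x, hsub hx, hxk, ?_⟩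
  rw [abs_le]
  constructor <;> linarith [hx.1, hx.2, hy₁.1, hy₂.2]

end Layers

/-! ### Measure-theoretic preliminaries -/

/-- Cauchy–Schwarz against the constant `1`, obtained by expanding `∫ (m f - I)² ≥ 0`, where `m` is
the total mass and `I` the integral of `f`. -/
theorem sq_integral_le {α : Type*} [MeasurableSpace α] {μ : Measure α} [IsFiniteMeasure μ]
    {f : α → ℝ} (hf : MemLp f 2 μ) : (∫ x, f x ∂μ) ^ 2 ≤ μ.real univ * ∫ x, f x ^ 2 ∂μ := by
  have hi : Integrable f μ := hf.integrable (by norm_num)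
  have hi2 : Integrable (fun x => f x ^ 2) μ := hf.integrable_sq
  set m := μ.real univ with hm
  set I := ∫ x, f x ∂μ with hI
  have hm0 : 0 ≤ m := measureReal_nonneg
  rcases hm0.eq_or_lt with h0 | hpos
  · have : μ = 0 := by
      rw [← Measure.measure_univ_eq_zero]
      have := h0.symm
      rwa [hm, measureReal_eq_zero_iff] at this
    rw [hI, this]
    simp
  · have h1 : ∫ x, (m * f x - I) ^ 2 ∂μ = m * (m * ∫ x, f x ^ 2 ∂μ - I ^ 2) := by
      have : ∀ x, (m * f x - I) ^ 2 = m ^ 2 * f x ^ 2 - 2 * m * I * f x + I ^ 2 := by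
        intro x; ring
      simp_rw [this]
      have hA : Integrable (fun x => m ^ 2 * f x ^ 2 - 2 * m * I * f x) μ :=
        (hi2.const_mul _).sub (hi.const_mul _)
      rw [integral_add hA (integrable_const _), integral_sub (hi2.const_mul _) (hi.const_mul _), integral_const_mul, integral_const_mul,
        integral_const, smul_eq_mul, ← hm, ← hI]
      ring
    have h2 : 0 ≤ ∫ x, (m * f x - I) ^ 2 ∂μ := integral_nonneg fun x => sq_nonneg _
    rw [h1] at h2
    have := nonneg_of_mul_nonneg_right h2 hpos
    linarith

section Prod

variable {μ ν : Measure ℝ} [SFinite ν] {f g : ℝ → ℝ → ℝ}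

/-- The converse direction of Fubini for null sets needs a measurable set, hence the passage to
strongly measurable representatives. -/
theorem ae_prod_of_ae_ae (hf : AEStronglyMeasurable (Function.uncurry f) (μ.prod ν))
    (hg : AEStronglyMeasurable (Function.uncurry g) (μ.prod ν))
    (h : ∀ᵐ σ ∂μ, ∀ᵐ x ∂ν, f σ x = g σ x) :
    ∀ᵐ z ∂(μ.prod ν), f z.1 z.2 = g z.1 z.2 := by
  have hm : MeasurableSet {z | hf.mk _ z = hg.mk _ z} :=
    hf.stronglyMeasurable_mk.measurableSet_eq_fun hg.stronglyMeasurable_mk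
  have h1 : ∀ᵐ z ∂(μ.prod ν), hf.mk _ z = hg.mk _ z := by
    rw [Measure.ae_prod_iff_ae_ae hm]
    filter_upwards [h, Measure.ae_ae_of_ae_prod hf.ae_eq_mk, Measure.ae_ae_of_ae_prod hg.ae_eq_mk]
      with σ h1 h2 h3
    filter_upwards [h1, h2, h3] with x h1 h2 h3
    rw [← h2, ← h3]
    exact h1
  filter_upwards [h1, hf.ae_eq_mk, hg.ae_eq_mk] with z h1 h2 h3
  rw [← h2, ← h3] at h1
  exact h1

theorem ae_ae_of_ae_prod_swap [SFinite μ] {p : ℝ → ℝ → Prop} (h : ∀ᵐ z ∂(μ.prod ν), p z.1 z.2) :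
    ∀ᵐ x ∂ν, ∀ᵐ σ ∂μ, p σ x := by
  have h1 : ∀ᵐ z ∂(ν.prod μ), p z.2 z.1 :=
    (Measure.measurePreserving_swap (μ := ν) (ν := μ)).quasiMeasurePreserving.ae h
  exact Measure.ae_ae_of_ae_prod h1

theorem ae_prod_of_ae_ae_swap [SFinite μ] (hf : AEStronglyMeasurable (Function.uncurry f) (μ.prod ν))
    (hg : AEStronglyMeasurable (Function.uncurry g) (μ.prod ν))
    (h : ∀ᵐ x ∂ν, ∀ᵐ σ ∂μ, f σ x = g σ x) :
    ∀ᵐ z ∂(μ.prod ν), f z.1 z.2 = g z.1 z.2 := by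
  have h1 := ae_prod_of_ae_ae (μ := ν) (ν := μ) (f := fun x σ => f σ x) (g := fun x σ => g σ x)
    hf.prod_swap hg.prod_swap h
  exact (Measure.measurePreserving_swap (μ := μ) (ν := ν)).quasiMeasurePreserving.ae h1

end Prod

theorem volume_restrict_spaceTime (a b τ T : ℝ) :
    (volume.restrict (spaceTime a b τ T) : Measure (ℝ × ℝ))
      = (volume.restrict (Ioo τ T)).prod (volume.restrict (Ioo a b)) := by
  rw [Measure.prod_restrict, Measure.volume_eq_prod]
  rfl

/-- Hölder on the bounded space interval turns `L⁴` into `L²` for almost every time, and Tonelli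
does the rest. -/
theorem MemL2L4.memLp {a b τ T : ℝ} {g : ℝ → ℝ → ℝ} (hg : MemL2L4 a b τ T g) :
    MemLp (Function.uncurry g) 2 ((volume.restrict (Ioo τ T)).prod (volume.restrict (Ioo a b))) := by
  obtain ⟨hm, hlt⟩ := hg
  rw [volume_restrict_spaceTime] at hm
  refine ⟨hm, ?_⟩
  set μ := volume.restrict (Ioo τ T)
  set ν := volume.restrict (Ioo a b)
  have hpow : ∀ {α : Type} [MeasurableSpace α] (κ : Measure α) (f : α → ℝ),
      eLpNorm f 2 κ ^ 2 = ∫⁻ x, ‖f x‖ₑ ^ 2 ∂κ := by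
    intro α _ κ f
    have := eLpNorm_nnreal_pow_eq_lintegral (f := f) (μ := κ) (p := 2) (by norm_num)
    simpa using this
  have h2 : eLpNorm (Function.uncurry g) 2 (μ.prod ν) ^ 2 < ⊤ := by
    rw [hpow, lintegral_prod _ (hm.enorm.pow_const 2)]
    have h3 : ∀ᵐ σ ∂μ, ∫⁻ x, ‖Function.uncurry g (σ, x)‖ₑ ^ 2 ∂ν
        ≤ (ν univ ^ (1 / (2 : ENNReal).toReal - 1 / (4 : ENNReal).toReal)) ^ 2
          * eLpNorm (g σ) 4 ν ^ 2 := by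
      filter_upwards [hm.prodMk_left] with σ hσ
      have h4 := eLpNorm_le_eLpNorm_mul_rpow_measure_univ (p := 2) (q := 4) (by norm_num) hσ
      calc ∫⁻ x, ‖Function.uncurry g (σ, x)‖ₑ ^ 2 ∂ν = eLpNorm (g σ) 2 ν ^ 2 := (hpow _ _).symm
        _ ≤ _ := by
          rw [← mul_pow, mul_comm]
          gcongr
          exact h4
    refine (lintegral_mono_ae h3).trans_lt ?_
    rw [lintegral_const_mul' _ _ ?_]
    · refine ENNReal.mul_lt_top ?_ hlt
      refine ENNReal.pow_lt_top (ENNReal.rpow_lt_top_of_nonneg (by norm_num) ?_)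
      simp [ν]
    · refine (ENNReal.pow_lt_top (ENNReal.rpow_lt_top_of_nonneg (by norm_num) ?_)).ne
      simp [ν]
  by_contra hcon
  rw [not_lt, top_le_iff] at hcon
  rw [hcon] at h2
  simp at h2

/-- Functions of time and space with the same integrals over all time intervals coincide. -/
theorem ae_eq_of_time_integral_eq {a b τ T : ℝ} (hτT : τ ≤ T) {f g : ℝ → ℝ → ℝ}
    (hf : Integrable (Function.uncurry f)
      ((volume.restrict (Ioo τ T)).prod (volume.restrict (Ioo a b))))
    (hg : Integrable (Function.uncurry g)
      ((volume.restrict (Ioo τ T)).prod (volume.restrict (Ioo a b))))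
    (h : ∀ t ∈ Icc τ T, ∀ᵐ x ∂(volume.restrict (Ioo a b)),
      ∫ σ in τ..t, f σ x = ∫ σ in τ..t, g σ x) :
    ∀ᵐ z ∂((volume.restrict (Ioo τ T)).prod (volume.restrict (Ioo a b))),
      f z.1 z.2 = g z.1 z.2 := by
  refine ae_prod_of_ae_ae_swap hf.1 hg.1 ?_
  -- The exceptional null set of `x` depends on the time. Rational times, clamped to `[τ,T]`, share
  -- one null set, and continuity of the primitives then gives all times.
  have h1 : ∀ᵐ x ∂(volume.restrict (Ioo a b)), ∀ q : ℚ,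
      ∫ σ in τ..(max τ (min T q)), f σ x = ∫ σ in τ..(max τ (min T q)), g σ x :=
    ae_all_iff.2 fun q => h _ ⟨le_max_left _ _, max_le hτT (min_le_left _ _)⟩
  filter_upwards [h1, hf.prod_left_ae, hg.prod_left_ae] with x hx hfx hgx
  have hfi : IntervalIntegrable (fun σ => f σ x) volume τ T :=
    (intervalIntegrable_iff_integrableOn_Ioo_of_le hτT).2 hfx
  have hgi : IntervalIntegrable (fun σ => g σ x) volume τ T :=
    (intervalIntegrable_iff_integrableOn_Ioo_of_le hτT).2 hgx
  have hS : ∀ {k : ℝ → ℝ}, IntervalIntegrable k volume τ T →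
      HasSobolevDeriv τ T (fun t => ∫ σ in τ..t, k σ) k := fun hk =>
    ⟨hk, fun t _ => by simp⟩
  have hcont : ∀ {k : ℝ → ℝ}, IntervalIntegrable k volume τ T →
      Continuous fun y : ℝ => ∫ σ in τ..(max τ (min T y)), k σ := fun hk =>
    ((hS hk).continuousOn hτT).comp_continuous (by fun_prop)
      fun y => ⟨le_max_left _ _, max_le hτT (min_le_left _ _)⟩
  have heq := (hcont hfi).ext_on Rat.denseRange_cast (hcont hgi) (by
    rintro _ ⟨q, rfl⟩
    exact hx q)
  have h2 : HasSobolevDeriv τ T (fun t => ∫ σ in τ..t, f σ x) (fun σ => g σ x) := by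
    refine ⟨hgi, fun t ht => ?_⟩
    have := congrFun heq t
    simp only [min_eq_right ht.2, max_eq_right ht.1] at this
    simpa using this
  exact (hS hfi).ae_eq h2 hτT

/-- Countable exhaustion from inside; needed because `Ψ₂(u)` and `Ψ₃(u)` are Sobolev functions only
locally in space. -/
theorem ae_restrict_Ioo_of_forall {a b : ℝ} (hab : a < b) {p : ℝ → Prop}
    (h : ∀ c d, a < c → c < d → d < b → ∀ᵐ x ∂(volume.restrict (Ioo c d)), p x) :
    ∀ᵐ x ∂(volume.restrict (Ioo a b)), p x := by
  have hba : 0 < b - a := sub_pos.2 hab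
  have hsub : Ioo a b ⊆ ⋃ n : ℕ, Ioo (a + (b - a) / (n + 3)) (b - (b - a) / (n + 3)) := by
    intro x hx
    have hm : 0 < min (x - a) (b - x) := lt_min (sub_pos.2 hx.1) (sub_pos.2 hx.2)
    obtain ⟨n, hn⟩ := exists_nat_gt ((b - a) / min (x - a) (b - x))
    have h1 : (b - a) / (n + 3) < min (x - a) (b - x) := by
      rw [div_lt_iff₀ hm] at hn
      rw [div_lt_iff₀ (by positivity)]
      nlinarith
    refine mem_iUnion.2 ⟨n, ?_, ?_⟩
    · linarith [min_le_left (x - a) (b - x)]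
    · linarith [min_le_right (x - a) (b - x)]
  refine ae_restrict_of_ae_restrict_of_subset hsub ?_
  rw [ae_restrict_iUnion_iff]
  intro n
  have h0 : 0 < (b - a) / ((n : ℝ) + 3) := by positivity
  refine h _ _ (by linarith) ?_ (by linarith)
  have : 2 * ((b - a) / ((n : ℝ) + 3)) < b - a := by
    rw [← mul_div_assoc, div_lt_iff₀ (by positivity)]
    nlinarith [(Nat.cast_nonneg n : (0 : ℝ) ≤ n)]
  linarith

/-! ### Dissipation of the energy -/

/-- Continuously differentiable coefficients. -/
structure SmoothCoefficients (D F : ℝ → ℝ) : Prop where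
  hasDerivAt_D : ∀ s, HasDerivAt D (deriv D s) s
  hasDerivAt_F : ∀ s, HasDerivAt F (deriv F s) s
  continuous_deriv_D : Continuous (deriv D)
  continuous_deriv_F : Continuous (deriv F)

namespace SmoothCoefficients

variable {D F : ℝ → ℝ} (H : SmoothCoefficients D F)
include H

theorem continuous_D : Continuous D :=
  continuous_iff_continuousAt.2 fun s => (H.hasDerivAt_D s).continuousAt

theorem continuous_F : Continuous F :=
  continuous_iff_continuousAt.2 fun s => (H.hasDerivAt_F s).continuousAt

/-- The rate of change of the energy at a fixed time. -/
theorem integral_dissipation_eq {a b ε : ℝ} (hab : a < b) (hε : 0 < ε)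
    {u ux v vx w wx p q : ℝ → ℝ} (hu : HasSobolevDeriv a b u ux) (hv : HasSobolevDeriv a b v vx)
    (hw : HasSobolevDeriv a b (fun x => psi₁ D (u x)) w) (hwx : HasSobolevDeriv a b w wx)
    (hwa : w a = 0) (hwb : w b = 0)
    (hpq : ∀ c d : ℝ, a < c → c < d → d < b →
        HasSobolevDeriv c d (fun x => psi₂ D (u x)) p ∧
        HasSobolevDeriv c d (fun x => psi₃ D (u x)) q)
    (heq : ∀ᵐ x ∂(volume.restrict (Ioo a b)), v x = ε ^ 2 * wx x - ε ^ 2 / 2 * (p x) ^ 2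
        + ε ^ 2 / 2 * (q x) ^ 2 - deriv F (u x)) :
    ∫ x in a..b, (ε / 2 * (deriv D (u x) * v x * (ux x) ^ 2 + 2 * D (u x) * ux x * vx x)
      + deriv F (u x) * v x / ε) = -(1 / ε) * ∫ x in a..b, (v x) ^ 2 := by
  have hD' := H.continuous_deriv_D
  have hprim : ∀ {k : ℝ → ℝ}, Continuous k → ∀ s, HasDerivAt (fun s => ∫ y in (-1)..s, k y) (k s) s :=
    fun hk s => (hk.integral_hasStrictDerivAt (-1) s).hasDerivAt
  -- As `u` itself is weakly differentiable, the chain rule and uniqueness give `w = D(u) ux`, and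
  -- likewise for `p` and `q`.
  have hw' : w =ᵐ[volume.restrict (Ioo a b)] fun x => D (u x) * ux x :=
    hw.ae_eq (hu.comp hab.le (hprim H.continuous_D) H.continuous_D) hab.le
  have hp' : ∀ᵐ x ∂(volume.restrict (Ioo a b)),
      p x = Real.sqrt (max (deriv D (u x)) 0) * ux x := by
    refine ae_restrict_Ioo_of_forall hab fun c d hac hcd hdb => ?_
    have hk : Continuous fun s => Real.sqrt (max (deriv D s) 0) := by fun_prop
    exact (hpq c d hac hcd hdb).1.ae_eq
      ((hu.mono hac.le hcd.le hdb.le).comp hcd.le (hprim hk) hk) hcd.le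
  have hq' : ∀ᵐ x ∂(volume.restrict (Ioo a b)),
      q x = Real.sqrt (max (-deriv D (u x)) 0) * ux x := by
    refine ae_restrict_Ioo_of_forall hab fun c d hac hcd hdb => ?_
    have hk : Continuous fun s => Real.sqrt (max (-deriv D s) 0) := by fun_prop
    exact (hpq c d hac hcd hdb).2.ae_eq
      ((hu.mono hac.le hcd.le hdb.le).comp hcd.le (hprim hk) hk) hcd.le
  have hprod := hwx.mul hv hab.le
  -- Integration by parts; the boundary terms vanish by the Neumann condition on `w`.
  have hzero : ∫ x in a..b, (wx x * v x + w x * vx x) = 0 := by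
    rw [hprod.integral_eq hab.le, hwa, hwb]
    ring
  have hv2 : IntervalIntegrable (fun x => (v x) ^ 2) volume a b := by
    refine ContinuousOn.intervalIntegrable ?_
    rw [uIcc_of_le hab.le]
    exact (hv.continuousOn hab.le).pow 2
  -- With `p² - q² = D'(u) ux²`, eliminating `F'(u)` by means of the equation leaves `ε (w v)_x -
  -- v²/ε`.
  have hae : ∀ᵐ x ∂(volume.restrict (Ioo a b)),
      ε / 2 * (deriv D (u x) * v x * (ux x) ^ 2 + 2 * D (u x) * ux x * vx x)
        + deriv F (u x) * v x / ε = ε * (wx x * v x + w x * vx x) - 1 / ε * (v x) ^ 2 := by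
    filter_upwards [hw', hp', hq', heq] with x h1 h2 h3 h4
    have h5 : (p x) ^ 2 - (q x) ^ 2 = deriv D (u x) * (ux x) ^ 2 := by
      rw [h2, h3, mul_pow, mul_pow, Real.sq_sqrt (le_max_right _ _),
        Real.sq_sqrt (le_max_right _ _), ← sub_mul]
      congr 1
      rcases le_total 0 (deriv D (u x)) with h | h
      · rw [max_eq_left h, max_eq_right (neg_nonpos.2 h)]; ring
      · rw [max_eq_right h, max_eq_left (neg_nonneg.2 h)]; ring
    have h6 : v x = ε ^ 2 * wx x - ε ^ 2 / 2 * (deriv D (u x) * (ux x) ^ 2) - deriv F (u x) := by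
      rw [h4, ← h5]; ring
    have h7 : deriv F (u x)
        = ε ^ 2 * wx x - ε ^ 2 / 2 * (deriv D (u x) * (ux x) ^ 2) - v x := by linarith
    rw [h7, h1]
    field_simp
    ring
  rw [intervalIntegral.integral_congr_ae_restrict
    (g := fun x => ε * (wx x * v x + w x * vx x) - 1 / ε * (v x) ^ 2),
    intervalIntegral.integral_sub (hprod.1.const_mul ε) (hv2.const_mul _),
    intervalIntegral.integral_const_mul, intervalIntegral.integral_const_mul, hzero]
  · ring
  · rw [uIoc_of_le hab.le, ← restrict_Ioo_eq_restrict_Ioc]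
    exact hae

end SmoothCoefficients

/-- A curve of Sobolev functions on `[a,b]`, which is an absolutely continuous function of the time
in `[s,t]`: the values `u`, their spatial derivative `ux`, and the time derivatives `v`, `vx` of
these. -/
structure SobolevCurve (a b s t : ℝ) (u ux v vx : ℝ → ℝ → ℝ) : Prop where
  measurable_u : AEStronglyMeasurable (Function.uncurry u)
    ((volume.restrict (Ioo s t)).prod (volume.restrict (Ioo a b)))
  measurable_ux : AEStronglyMeasurable (Function.uncurry ux)
    ((volume.restrict (Ioo s t)).prod (volume.restrict (Ioo a b)))
  measurable_vx : StronglyMeasurable (Function.uncurry vx)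
  memLp_v : MemLp (Function.uncurry v) 2
    ((volume.restrict (Ioo s t)).prod (volume.restrict (Ioo a b)))
  memLp_vx : MemLp (Function.uncurry vx) 2
    ((volume.restrict (Ioo s t)).prod (volume.restrict (Ioo a b)))
  sobolev_u : ∀ᵐ σ ∂(volume.restrict (Ioo s t)), HasSobolevDeriv a b (u σ) (ux σ)
  sobolev_v : ∀ᵐ σ ∂(volume.restrict (Ioo s t)), HasSobolevDeriv a b (v σ) (vx σ)
  memH1_left : MemH1 a b (u s)
  memH1_right : MemH1 a b (u t)
  eq_integral : ∀ τ ∈ Icc s t, ∀ x ∈ Icc a b, u τ x = u s x + ∫ σ in s..τ, v σ x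
  bounded : ∀ τ ∈ Icc s t, ∀ x ∈ Icc a b, u τ x ∈ Icc (-1 : ℝ) 1

/-! ### Pointwise structure and bounds for curves of Sobolev functions -/

namespace SobolevCurve

variable {a b s t : ℝ} {u ux v vx : ℝ → ℝ → ℝ} (S : SobolevCurve a b s t u ux v vx)
include S

theorem integrable_v : Integrable (Function.uncurry v)
    ((volume.restrict (Ioo s t)).prod (volume.restrict (Ioo a b))) :=
  S.memLp_v.integrable (by norm_num)

theorem integrable_vx : Integrable (Function.uncurry vx)
    ((volume.restrict (Ioo s t)).prod (volume.restrict (Ioo a b))) :=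
  S.memLp_vx.integrable (by norm_num)

/-- A time-integrable bound for `|v|`, uniform in space. -/
theorem exists_bound_v (hab : a < b) : ∃ B : ℝ → ℝ, Integrable B (volume.restrict (Ioo s t)) ∧
    ∀ᵐ σ ∂(volume.restrict (Ioo s t)), ∀ x ∈ Icc a b, |v σ x| ≤ B σ := by
  refine ⟨fun σ => (b - a)⁻¹ * (∫ y in Ioo a b, |v σ y|) + ∫ y in Ioo a b, |vx σ y|, ?_, ?_⟩
  · exact (S.integrable_v.abs.integral_prod_left.const_mul _).add
      S.integrable_vx.abs.integral_prod_left
  · filter_upwards [S.sobolev_v] with σ hσ x hx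
    have := hσ.abs_le hab hx
    rwa [intervalIntegral.integral_of_le hab.le, intervalIntegral.integral_of_le hab.le,
      integral_Ioc_eq_integral_Ioo, integral_Ioc_eq_integral_Ioo] at this

/-- The time derivative is integrable in time at every point of `[a,b]`. -/
theorem integrableOn_v (hab : a < b) {x : ℝ} (hx : x ∈ Icc a b) :
    IntegrableOn (fun σ => v σ x) (Ioo s t) := by
  have hne : (ae (volume.restrict (Ioo a b))).NeBot := by
    rw [ae_neBot, Ne, Measure.restrict_eq_zero, Real.volume_Ioo, ENNReal.ofReal_eq_zero]
    linarith
  obtain ⟨y, hy, hyab⟩ := (S.integrable_v.prod_left_ae.and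
    (ae_restrict_mem measurableSet_Ioo)).exists
  -- Fubini gives integrability in time at almost every point `y`; from there `v σ x = v σ y + ∫_y^x
  -- vx` reaches every `x`. The signed integral is split into two set integrals, each a partial
  -- integral of `vx`.
  have hswap : ∀ c d, Integrable (fun σ => ∫ z in Ioc c d ∩ Ioo a b, vx σ z)
      (volume.restrict (Ioo s t)) := by
    intro c d
    have h1 : Integrable (Function.uncurry vx)
        ((volume.restrict (Ioo s t)).prod (volume.restrict (Ioc c d ∩ Ioo a b))) :=
      S.integrable_vx.mono_measure
        (Measure.prod_mono le_rfl (Measure.restrict_mono inter_subset_right le_rfl))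
    exact h1.integral_prod_left
  refine (((hswap y x).sub (hswap x y)).add hy).congr ?_
  filter_upwards [S.sobolev_v] with σ hσ
  have h1 : v σ x - v σ y = ∫ z in y..x, vx σ z := by
    rw [hσ.2 x hx, hσ.2 y (Ioo_subset_Icc_self hyab), add_sub_add_left_eq_sub]
    refine intervalIntegral.integral_interval_sub_left (hσ.1.mono_set ?_) (hσ.1.mono_set ?_)
    · rw [uIcc_of_le hab.le]; exact uIcc_subset_Icc (left_mem_Icc.2 hab.le) hx
    · rw [uIcc_of_le hab.le]
      exact uIcc_subset_Icc (left_mem_Icc.2 hab.le) (Ioo_subset_Icc_self hyab)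
  have h2 : ∀ c d, c ∈ Icc a b → d ∈ Icc a b →
      ∫ z in Ioc c d ∩ Ioo a b, vx σ z = ∫ z in Ioc c d, vx σ z := by
    intro c d hc hd
    have : (Ioc c d ∩ Ioo a b : Set ℝ) =ᵐ[volume] Ioc c d := by
      have h3 : (Ioc c d ∩ Ioo a b : Set ℝ) =ᵐ[volume] (Ioc c d ∩ Ioc a b : Set ℝ) :=
        (ae_eq_refl _).inter Ioo_ae_eq_Ioc
      rwa [inter_eq_left.2 (Ioc_subset_Ioc hc.1 hd.2)] at h3
    exact setIntegral_congr_set this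
  have hy' := Ioo_subset_Icc_self hyab
  have h4 : ∫ z in y..x, vx σ z = (∫ z in Ioc y x, vx σ z) - ∫ z in Ioc x y, vx σ z := rfl
  simp only [Pi.add_apply, Pi.sub_apply, Function.uncurry_apply_pair]
  rw [h2 y x hy' hx, h2 x y hx hy', ← h4, ← h1]
  ring

/-- The spatial derivative at time `τ`, reconstructed from its value at time `s`. -/
theorem ae_eq_add_integral (hab : a < b) {τ : ℝ} (hτ : τ ∈ Icc s t) {k : ℝ → ℝ}
    (hk : HasSobolevDeriv a b (u τ) k) :
    ∀ᵐ x ∂(volume.restrict (Ioo a b)), k x = deriv (u s) x + ∫ σ in s..τ, vx σ x := by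
  have hus := S.memH1_left.hasSobolevDeriv hab.le
  have hle : (volume.restrict (Ioc s τ)) ≤ volume.restrict (Ioo s t) := by
    rw [restrict_Ioo_eq_restrict_Ioc]
    exact Measure.restrict_mono (Ioc_subset_Ioc_right hτ.2) le_rfl
  have hint : ∀ y ∈ Icc a b, Integrable (Function.uncurry fun x σ => vx σ x)
      ((volume.restrict (Ioc a y)).prod (volume.restrict (Ioc s τ))) := by
    intro y hy
    refine (S.integrable_vx.mono_measure (Measure.prod_mono hle ?_)).swap
    rw [restrict_Ioo_eq_restrict_Ioc]
    exact Measure.restrict_mono (Ioc_subset_Ioc_right hy.2) le_rfl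
  have hV : ∀ y ∈ Icc a b, IntervalIntegrable (fun x => ∫ σ in s..τ, vx σ x) volume a y := by
    intro y hy
    rw [intervalIntegrable_iff_integrableOn_Ioc_of_le hy.1]
    simp_rw [intervalIntegral.integral_of_le hτ.1]
    exact (hint y hy).integral_prod_left
  refine hk.ae_eq ⟨hus.1.add (hV b (right_mem_Icc.2 hab.le)), fun y hy => ?_⟩ hab.le
  have hsub : uIcc a y ⊆ uIcc a b := by
    rw [uIcc_of_le hab.le, uIcc_of_le hy.1]; exact Icc_subset_Icc_right hy.2
  have ha := left_mem_Icc.2 hab.le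
  rw [intervalIntegral.integral_add (hus.1.mono_set hsub) (hV y hy)]
  -- Fubini makes the space primitive of the candidate equal to `u τ - u τ a`; uniqueness of the
  -- weak derivative then identifies `k`.
  have h1 : ∫ x in a..y, ∫ σ in s..τ, vx σ x = ∫ σ in s..τ, (v σ y - v σ a) := by
    rw [intervalIntegral.integral_of_le hy.1]
    simp_rw [intervalIntegral.integral_of_le hτ.1]
    rw [integral_integral_swap (hint y hy)]
    refine integral_congr_ae ?_
    filter_upwards [ae_mono hle S.sobolev_v] with σ hσ
    rw [hσ.2 y hy, intervalIntegral.integral_of_le hy.1]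
    ring
  have hvi : ∀ y ∈ Icc a b, IntervalIntegrable (fun σ => v σ y) volume s τ := by
    intro y hy
    rw [intervalIntegrable_iff_integrableOn_Ioc_of_le hτ.1]
    exact Integrable.mono_measure (S.integrableOn_v hab hy) hle
  rw [h1, intervalIntegral.integral_sub (hvi y hy) (hvi a ha), S.eq_integral τ hτ y hy,
    S.eq_integral τ hτ a ha, hus.2 y hy]
  ring

/-- The identity at almost every time becomes one at almost every `(t,x)`, which provides a version
of `ux` that is absolutely continuous in time for almost every `x`. -/
theorem ae_ux_eq (hab : a < b) :
    ∀ᵐ z ∂((volume.restrict (Ioo s t)).prod (volume.restrict (Ioo a b))),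
      ux z.1 z.2 = deriv (u s) z.2 + ∫ σ in s..z.1, vx σ z.2 := by
  -- Joint measurability: the indicator turns the variable upper limit into a parameter of a fixed
  -- integral.
  have hm : StronglyMeasurable
      (fun z : ℝ × ℝ => deriv (u s) z.2 + ∫ σ, (if s < σ ∧ σ ≤ z.1 then vx σ z.2 else 0)) := by
    refine ((measurable_deriv (u s)).comp measurable_snd).stronglyMeasurable.add ?_
    refine StronglyMeasurable.integral_prod_right
      (f := fun (z : ℝ × ℝ) (σ : ℝ) => if s < σ ∧ σ ≤ z.1 then vx σ z.2 else 0) ?_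
    have hset : MeasurableSet {p : (ℝ × ℝ) × ℝ | s < p.2 ∧ p.2 ≤ p.1.1} :=
      (measurableSet_lt measurable_const measurable_snd).inter
        (measurableSet_le measurable_snd (measurable_fst.comp measurable_fst))
    have hvm : StronglyMeasurable (fun p : (ℝ × ℝ) × ℝ => vx p.2 p.1.2) :=
      S.measurable_vx.comp_measurable
        (measurable_snd.prodMk (measurable_snd.comp measurable_fst))
    exact StronglyMeasurable.ite hset hvm stronglyMeasurable_const
  have hfor : ∀ τ x, s ≤ τ → ∫ σ, (if s < σ ∧ σ ≤ τ then vx σ x else 0)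
      = ∫ σ in s..τ, vx σ x := by
    intro τ x hτ
    rw [intervalIntegral.integral_of_le hτ, ← integral_indicator measurableSet_Ioc]
    simp only [indicator_apply, mem_Ioc]
  have h1 := ae_prod_of_ae_ae (μ := volume.restrict (Ioo s t)) (ν := volume.restrict (Ioo a b))
    (f := ux)
    (g := fun τ x => deriv (u s) x + ∫ σ, (if s < σ ∧ σ ≤ τ then vx σ x else 0))
    S.measurable_ux hm.aestronglyMeasurable (by
      filter_upwards [S.sobolev_u, ae_restrict_mem measurableSet_Ioo] with σ hσ hm
      filter_upwards [S.ae_eq_add_integral hab (Ioo_subset_Icc_self hm) hσ] with x hx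
      rw [hfor _ _ hm.1.le, hx])
  have h2 : ∀ᵐ z ∂((volume.restrict (Ioo s t)).prod (volume.restrict (Ioo a b))),
      z.1 ∈ Ioo s t := by
    rw [Measure.prod_restrict]
    exact (ae_restrict_mem (measurableSet_Ioo.prod measurableSet_Ioo)).mono fun z hz => hz.1
  filter_upwards [h1, h2] with z hz hz2
  rw [hz, hfor _ _ hz2.1.le]

/-- A square integrable bound for `ux`, uniform in time. -/
theorem exists_bound_ux (hab : a < b) (hst : s < t) :
    ∃ M : ℝ → ℝ, Integrable M (volume.restrict (Ioo a b)) ∧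
      ∀ᵐ z ∂((volume.restrict (Ioo s t)).prod (volume.restrict (Ioo a b))),
        (ux z.1 z.2) ^ 2 ≤ M z.2 := by
  -- From `(p + q)² ≤ 2p² + 2q²` and Cauchy–Schwarz in time.
  refine ⟨fun x => 2 * (deriv (u s) x) ^ 2 + 2 * ((t - s) * ∫ σ in Ioo s t, (vx σ x) ^ 2),
    ?_, ?_⟩
  · refine ((S.memH1_left.memLp_deriv hab.le).integrable_sq.const_mul 2).add
      (Integrable.const_mul (Integrable.const_mul ?_ _) _)
    exact S.memLp_vx.integrable_sq.integral_prod_right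
  · have h1 : ∀ᵐ x ∂(volume.restrict (Ioo a b)), ∀ τ ∈ Ioo s t,
        (∫ σ in s..τ, vx σ x) ^ 2 ≤ (t - s) * ∫ σ in Ioo s t, (vx σ x) ^ 2 := by
      filter_upwards [S.integrable_vx.prod_left_ae, S.memLp_vx.integrable_sq.prod_left_ae]
        with x h1 h2 τ hτ
      have h3 : MemLp (fun σ => |vx σ x|) 2 (volume.restrict (Ioo s t)) := by
        refine (memLp_two_iff_integrable_sq h1.abs.1).2 ?_
        simpa using h2
      have h4 := sq_integral_le h3
      simp only [sq_abs, measureReal_restrict_apply_univ, Real.volume_real_Ioo_of_le hst.le] at h4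
      refine le_trans ?_ h4
      rw [sq_le_sq]
      refine le_trans ?_ (le_abs_self _)
      rw [intervalIntegral.integral_of_le hτ.1.le]
      refine (norm_integral_le_integral_norm (fun σ => vx σ x)).trans ?_
      rw [← integral_Ioc_eq_integral_Ioo]
      refine setIntegral_mono_set ?_ (Eventually.of_forall fun x => norm_nonneg _)
        (LE.le.eventuallyLE (Ioc_subset_Ioc_right hτ.2.le))
      rw [IntegrableOn, ← restrict_Ioo_eq_restrict_Ioc]
      exact h1.norm
    have h2 : ∀ᵐ z ∂((volume.restrict (Ioo s t)).prod (volume.restrict (Ioo a b))),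
        ∀ τ ∈ Ioo s t, (∫ σ in s..τ, vx σ z.2) ^ 2
          ≤ (t - s) * ∫ σ in Ioo s t, (vx σ z.2) ^ 2 :=
      Measure.quasiMeasurePreserving_snd.ae h1
    have h3 : ∀ᵐ z ∂((volume.restrict (Ioo s t)).prod (volume.restrict (Ioo a b))),
        z.1 ∈ Ioo s t := by
      rw [Measure.prod_restrict]
      exact (ae_restrict_mem (measurableSet_Ioo.prod measurableSet_Ioo)).mono fun z hz => hz.1
    filter_upwards [S.ae_ux_eq hab, h2, h3] with z h1 h2 h3
    rw [h1]
    have := h2 z.1 h3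
    nlinarith [sq_nonneg (deriv (u s) z.2 - ∫ σ in s..z.1, vx σ z.2)]

end SobolevCurve

theorem SmoothCoefficients.exists_bound {D F : ℝ → ℝ} (H : SmoothCoefficients D F) :
    ∃ C : ℝ, 0 ≤ C ∧ ∀ y ∈ Icc (-1 : ℝ) 1, |D y| ≤ C ∧ |deriv D y| ≤ C ∧ |deriv F y| ≤ C := by
  obtain ⟨C₁, h1⟩ := (isCompact_Icc (a := (-1 : ℝ)) (b := 1)).exists_bound_of_continuousOn
    H.continuous_D.continuousOn
  obtain ⟨C₂, h2⟩ := (isCompact_Icc (a := (-1 : ℝ)) (b := 1)).exists_bound_of_continuousOn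
    H.continuous_deriv_D.continuousOn
  obtain ⟨C₃, h3⟩ := (isCompact_Icc (a := (-1 : ℝ)) (b := 1)).exists_bound_of_continuousOn
    H.continuous_deriv_F.continuousOn
  refine ⟨max C₁ (max C₂ C₃), ?_, fun y hy => ⟨?_, ?_, ?_⟩⟩
  · exact le_max_of_le_left ((norm_nonneg _).trans (h1 0 (by norm_num)))
  · exact (h1 y hy).trans (le_max_left _ _)
  · exact (h2 y hy).trans ((le_max_left _ _).trans (le_max_right _ _))
  · exact (h3 y hy).trans ((le_max_right _ _).trans (le_max_right _ _))

/-! ### Absolute continuity in time of the energy -/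

namespace SobolevCurve

variable {a b s t : ℝ} {u ux v vx : ℝ → ℝ → ℝ} (S : SobolevCurve a b s t u ux v vx)
  {D F : ℝ → ℝ} (H : SmoothCoefficients D F)
include S H

/-- The cubic term `D'(u) v ux²` is the delicate one. Bounding `|v|` by an integrable function of
time and `ux²` by an integrable function of space dominates it by a tensor product. This justifies
Fubini in `energy_sub_eq`. -/
theorem integrable_energy_rate (hab : a < b) (hst : s < t) {ε : ℝ} (hε : 0 < ε) :
    Integrable (Function.uncurry fun σ x =>
      ε / 2 * (deriv D (u σ x) * v σ x * (ux σ x) ^ 2 + 2 * D (u σ x) * ux σ x * vx σ x)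
        + deriv F (u σ x) * v σ x / ε)
      ((volume.restrict (Ioo s t)).prod (volume.restrict (Ioo a b))) := by
  obtain ⟨C, hC, hCb⟩ := H.exists_bound
  obtain ⟨B, hB, hvB⟩ := S.exists_bound_v hab
  obtain ⟨M, hM, hux⟩ := S.exists_bound_ux hab hst
  have hg : Integrable (fun z : ℝ × ℝ =>
      ε / 2 * C * (B z.1 * M z.2 + (M z.2 + (vx z.1 z.2) ^ 2)) + C / ε * B z.1)
      ((volume.restrict (Ioo s t)).prod (volume.restrict (Ioo a b))) := by
    refine (((hB.mul_prod hM).add ((hM.comp_snd _).add ?_)).const_mul _).add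
      ((hB.comp_fst _).const_mul _)
    exact S.memLp_vx.integrable_sq
  have hmv := S.memLp_v.1
  have hmvx := S.memLp_vx.1
  have hmu := S.measurable_u
  have hmux := S.measurable_ux
  have hc : ∀ {k : ℝ → ℝ}, Continuous k → AEStronglyMeasurable (fun z : ℝ × ℝ => k (u z.1 z.2))
      ((volume.restrict (Ioo s t)).prod (volume.restrict (Ioo a b))) := fun hk =>
    hk.comp_aestronglyMeasurable hmu
  refine hg.mono' ?_ ?_
  · refine ((((hc H.continuous_deriv_D).mul hmv).mul (hmux.pow 2)).add
      ((((hc H.continuous_D).const_mul 2).mul hmux).mul hmvx)).const_mul (ε / 2) |>.add ?_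
    have := ((hc H.continuous_deriv_F).mul hmv).mul_const ε⁻¹
    simpa [div_eq_mul_inv, Function.uncurry_def] using this
  · have h3 : ∀ᵐ z ∂((volume.restrict (Ioo s t)).prod (volume.restrict (Ioo a b))),
        z ∈ Ioo s t ×ˢ Ioo a b := by
      rw [Measure.prod_restrict]
      exact ae_restrict_mem (measurableSet_Ioo.prod measurableSet_Ioo)
    have h4 : ∀ᵐ z ∂((volume.restrict (Ioo s t)).prod (volume.restrict (Ioo a b))),
        ∀ x ∈ Icc a b, |v z.1 x| ≤ B z.1 := Measure.quasiMeasurePreserving_fst.ae hvB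
    filter_upwards [hux, h3, h4] with z h1 h3 h4
    have hv := h4 z.2 (Ioo_subset_Icc_self h3.2)
    obtain ⟨c1, c2, c3⟩ := hCb _
      (S.bounded z.1 (Ioo_subset_Icc_self h3.1) z.2 (Ioo_subset_Icc_self h3.2))
    simp only [Function.uncurry, Real.norm_eq_abs]
    have e1 : |deriv D (u z.1 z.2) * v z.1 z.2 * (ux z.1 z.2) ^ 2| ≤ C * (B z.1 * M z.2) := by
      rw [abs_mul, abs_mul, abs_of_nonneg (sq_nonneg (ux z.1 z.2)), mul_assoc]
      have hB0 : 0 ≤ B z.1 := (abs_nonneg _).trans hv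
      gcongr
    have e2 : |2 * D (u z.1 z.2) * ux z.1 z.2 * vx z.1 z.2|
        ≤ C * (M z.2 + (vx z.1 z.2) ^ 2) := by
      have : |2 * D (u z.1 z.2) * ux z.1 z.2 * vx z.1 z.2|
          = |D (u z.1 z.2)| * (2 * |ux z.1 z.2| * |vx z.1 z.2|) := by
        rw [abs_mul, abs_mul, abs_mul, abs_two]; ring
      rw [this]
      have h5 : 2 * |ux z.1 z.2| * |vx z.1 z.2| ≤ M z.2 + (vx z.1 z.2) ^ 2 := by
        have := two_mul_le_add_sq |ux z.1 z.2| |vx z.1 z.2|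
        rw [sq_abs, sq_abs] at this
        linarith
      gcongr
    have e3 : |deriv F (u z.1 z.2) * v z.1 z.2 / ε| ≤ C / ε * B z.1 := by
      rw [abs_div, abs_mul, abs_of_pos hε, div_mul_eq_mul_div]
      gcongr
    calc _ ≤ |ε / 2 * (deriv D (u z.1 z.2) * v z.1 z.2 * (ux z.1 z.2) ^ 2
          + 2 * D (u z.1 z.2) * ux z.1 z.2 * vx z.1 z.2)|
          + |deriv F (u z.1 z.2) * v z.1 z.2 / ε| := abs_add_le _ _
      _ ≤ ε / 2 * (C * (B z.1 * M z.2) + C * (M z.2 + (vx z.1 z.2) ^ 2)) + C / ε * B z.1 := by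
        refine add_le_add ?_ e3
        rw [abs_mul, abs_of_pos (half_pos hε)]
        gcongr
        exact (abs_add_le _ _).trans (add_le_add e1 e2)
      _ = _ := by ring

/-- At almost every fixed `x`, both `u` and the reconstructed `ux` are absolutely continuous in
time, so the chain and product rules apply in the time variable. -/
theorem energyDensity_sub_eq (hab : a < b) (hst : s < t) (ε : ℝ) :
    ∀ᵐ x ∂(volume.restrict (Ioo a b)),
      energyDensity D F ε (u t) x - energyDensity D F ε (u s) x = ∫ σ in s..t,
        (ε / 2 * (deriv D (u σ x) * v σ x * (ux σ x) ^ 2 + 2 * D (u σ x) * ux σ x * vx σ x)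
          + deriv F (u σ x) * v σ x / ε) := by
  filter_upwards [S.ae_eq_add_integral hab (right_mem_Icc.2 hst.le)
    (S.memH1_right.hasSobolevDeriv hab.le), S.integrable_vx.prod_left_ae,
    ae_ae_of_ae_prod_swap (p := fun σ x => ux σ x = deriv (u s) x + ∫ τ in s..σ, vx τ x)
      (S.ae_ux_eq hab), ae_restrict_mem measurableSet_Ioo]
    with x h1 h2 h3 hx
  have hx' := Ioo_subset_Icc_self hx
  have A : HasSobolevDeriv s t (fun τ => u τ x) (fun τ => v τ x) := by
    refine ⟨(intervalIntegrable_iff_integrableOn_Ioo_of_le hst.le).2 (S.integrableOn_v hab hx'),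
      fun τ hτ => S.eq_integral τ hτ x hx'⟩
  have B : HasSobolevDeriv s t (fun τ => deriv (u s) x + ∫ σ in s..τ, vx σ x)
      (fun τ => vx τ x) := by
    refine ⟨(intervalIntegrable_iff_integrableOn_Ioo_of_le hst.le).2 h2, fun τ hτ => by simp⟩
  have P := (A.comp hst.le H.hasDerivAt_D H.continuous_deriv_D).mul (B.mul B hst.le) hst.le
  have Q := A.comp hst.le H.hasDerivAt_F H.continuous_deriv_F
  have eP := P.integral_eq hst.le
  have eQ := Q.integral_eq hst.le
  simp only [intervalIntegral.integral_same, add_zero] at eP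
  rw [intervalIntegral.integral_congr_ae_restrict
    (g := fun σ => ε / 2 * (deriv D (u σ x) * v σ x *
      ((deriv (u s) x + ∫ τ in s..σ, vx τ x) * (deriv (u s) x + ∫ τ in s..σ, vx τ x)) +
      D (u σ x) * (vx σ x * (deriv (u s) x + ∫ τ in s..σ, vx τ x) +
        (deriv (u s) x + ∫ τ in s..σ, vx τ x) * vx σ x)) + 1 / ε * (deriv F (u σ x) * v σ x)),
    intervalIntegral.integral_add (P.1.const_mul _) (Q.1.const_mul _),
    intervalIntegral.integral_const_mul, intervalIntegral.integral_const_mul, eP, eQ, ← h1]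
  · unfold energyDensity
    ring
  · rw [uIoc_of_le hst.le, ← restrict_Ioo_eq_restrict_Ioc]
    filter_upwards [h3] with σ hσ
    rw [hσ]
    ring

/-- The energy is absolutely continuous along a Sobolev curve. -/
theorem energy_sub_eq (hab : a < b) (hst : s < t) {ε : ℝ} (hε : 0 < ε) :
    energy D F ε a b (u t) - energy D F ε a b (u s) = ∫ σ in s..t, ∫ x in a..b,
      (ε / 2 * (deriv D (u σ x) * v σ x * (ux σ x) ^ 2 + 2 * D (u σ x) * ux σ x * vx σ x)
        + deriv F (u σ x) * v σ x / ε) := by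
  have e1 : energy D F ε a b (u t) - energy D F ε a b (u s) =
      ∫ x in a..b, (energyDensity D F ε (u t) x - energyDensity D F ε (u s) x) :=
    (intervalIntegral.integral_sub
      (S.memH1_right.intervalIntegrable_energyDensity hab.le H.continuous_D H.continuous_F ε)
      (S.memH1_left.intervalIntegrable_energyDensity hab.le H.continuous_D H.continuous_F ε)).symm
  rw [e1, intervalIntegral.integral_of_le hab.le, intervalIntegral.integral_of_le hst.le,
    integral_Ioc_eq_integral_Ioo, integral_Ioc_eq_integral_Ioo,
    integral_congr_ae (S.energyDensity_sub_eq H hab hst ε)]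
  simp_rw [intervalIntegral.integral_of_le hab.le, intervalIntegral.integral_of_le hst.le,
    integral_Ioc_eq_integral_Ioo]
  exact (integral_integral_swap (S.integrable_energy_rate H hab hst hε)).symm

omit H in
-- Since `u t - u s = ∫ v`, this is Cauchy–Schwarz on a rectangle of area `(t - s)(b - a)`.
theorem sq_integral_abs_sub_le (hab : a < b) (hst : s < t) :
    (∫ x in a..b, |u t x - u s x|) ^ 2
      ≤ (t - s) * (b - a) * ∫ σ in s..t, ∫ x in a..b, (v σ x) ^ 2 := by
  have habs : MemLp (fun z : ℝ × ℝ => |v z.1 z.2|) 2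
      ((volume.restrict (Ioo s t)).prod (volume.restrict (Ioo a b))) := S.memLp_v.abs
  have h1 := sq_integral_le habs
  have h2 : ((volume.restrict (Ioo s t)).prod (volume.restrict (Ioo a b))).real univ
      = (t - s) * (b - a) := by
    rw [← univ_prod_univ, measureReal_prod_prod, measureReal_restrict_apply_univ,
      measureReal_restrict_apply_univ, Real.volume_real_Ioo_of_le hst.le,
      Real.volume_real_Ioo_of_le hab.le]
  simp only [sq_abs] at h1
  rw [h2, integral_prod (fun z : ℝ × ℝ => v z.1 z.2 ^ 2) S.memLp_v.integrable_sq] at h1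
  simp_rw [intervalIntegral.integral_of_le hab.le, intervalIntegral.integral_of_le hst.le,
    integral_Ioc_eq_integral_Ioo]
  refine le_trans ?_ h1
  rw [sq_le_sq₀ (integral_nonneg fun x => abs_nonneg _) (integral_nonneg fun z => abs_nonneg _)]
  have hvi : Integrable (fun z : ℝ × ℝ => |v z.1 z.2|)
      ((volume.restrict (Ioo s t)).prod (volume.restrict (Ioo a b))) := S.integrable_v.abs
  rw [integral_prod_symm _ hvi]
  have hc : IntervalIntegrable (fun x => |u t x - u s x|) volume a b :=
    ((S.memH1_right.intervalIntegrable_comp hab.le continuous_id).sub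
      (S.memH1_left.intervalIntegrable_comp hab.le continuous_id)).abs
  refine setIntegral_mono_on ((intervalIntegrable_iff_integrableOn_Ioo_of_le hab.le).1 hc)
    hvi.integral_prod_right measurableSet_Ioo fun x hx => ?_
  rw [S.eq_integral t (right_mem_Icc.2 hst.le) x (Ioo_subset_Icc_self hx), add_sub_cancel_left,
    intervalIntegral.integral_of_le hst.le, integral_Ioc_eq_integral_Ioo]
  exact norm_integral_le_integral_norm (fun σ => v σ x)

end SobolevCurve

/-! ### Continuity of the energy in `H¹` -/

theorem MemH1.sub {a b : ℝ} {f g : ℝ → ℝ} (hf : MemH1 a b f) (hg : MemH1 a b g) (hab : a ≤ b) :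
    MemH1 a b (fun x => f x - g x) :=
  ⟨_, (hf.hasSobolevDeriv hab).sub (hg.hasSobolevDeriv hab) hab,
    (hf.memLp_deriv hab).sub (hg.memLp_deriv hab)⟩

theorem MemH1.integral_abs_le {a b ρ : ℝ} {f : ℝ → ℝ} (hab : a ≤ b) (hρ : 0 ≤ ρ)
    (hf : MemLp f 2 (volume.restrict (Ioo a b))) (h : ∫ x in a..b, (f x) ^ 2 ≤ ρ ^ 2) :
    ∫ x in a..b, |f x| ≤ Real.sqrt (b - a) * ρ := by
  have hfa : MemLp (fun x => |f x|) 2 (volume.restrict (Ioo a b)) := hf.abs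
  have h1 := sq_integral_le hfa
  rw [intervalIntegral.integral_of_le hab, integral_Ioc_eq_integral_Ioo] at h ⊢
  simp only [sq_abs, measureReal_restrict_apply_univ, Real.volume_real_Ioo_of_le hab] at h1
  refine abs_le_of_sq_le_sq' ?_ (by positivity) |>.2
  rw [mul_pow, Real.sq_sqrt (sub_nonneg.2 hab)]
  exact h1.trans (by gcongr)

theorem MemH1.memLp {a b : ℝ} {f : ℝ → ℝ} (hf : MemH1 a b f) (hab : a ≤ b) :
    MemLp f 2 (volume.restrict (Ioo a b)) := by
  have h1 := hf.intervalIntegrable_comp hab continuous_id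
  have h2 := hf.intervalIntegrable_comp hab (continuous_pow 2)
  rw [intervalIntegrable_iff_integrableOn_Ioo_of_le hab] at h1 h2
  exact (memLp_two_iff_integrable_sq h1.1).2 h2

theorem MemH1.integral_sq_le_h1NormSq {a b : ℝ} {f : ℝ → ℝ} (hf : MemH1 a b f) (hab : a ≤ b) :
    ∫ x in a..b, (f x) ^ 2 ≤ h1NormSq a b f ∧ ∫ x in a..b, (deriv f x) ^ 2 ≤ h1NormSq a b f := by
  have h1 := hf.intervalIntegrable_comp hab (continuous_pow 2)
  have h2 := hf.intervalIntegrable_comp_mul_deriv_sq hab (φ := fun _ => 1) continuous_const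
  simp only [one_mul] at h2
  unfold h1NormSq
  rw [intervalIntegral.integral_add h1 h2]
  have h3 : 0 ≤ ∫ x in a..b, (f x) ^ 2 := intervalIntegral.integral_nonneg hab fun x _ => sq_nonneg _
  have h4 : 0 ≤ ∫ x in a..b, (deriv f x) ^ 2 :=
    intervalIntegral.integral_nonneg hab fun x _ => sq_nonneg _
  constructor <;> linarith

theorem MemH1.integral_abs_le_of_h1NormSq_le {a b ρ : ℝ} {f : ℝ → ℝ} (hf : MemH1 a b f)
    (hab : a ≤ b) (hρ : 0 ≤ ρ) (h : h1NormSq a b f ≤ ρ ^ 2) :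
    ∫ x in a..b, |f x| ≤ Real.sqrt (b - a) * ρ :=
  MemH1.integral_abs_le hab hρ (hf.memLp hab) ((hf.integral_sq_le_h1NormSq hab).1.trans h)

theorem MemH1.abs_le_of_h1NormSq_le {a b ρ : ℝ} {f : ℝ → ℝ} (hf : MemH1 a b f) (hab : a < b)
    (hρ : 0 ≤ ρ) (h : h1NormSq a b f ≤ ρ ^ 2) {x : ℝ} (hx : x ∈ Icc a b) :
    |f x| ≤ ((b - a)⁻¹ + 1) * Real.sqrt (b - a) * ρ := by
  have h1 := (hf.hasSobolevDeriv hab.le).abs_le hab hx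
  have h2 := hf.integral_abs_le_of_h1NormSq_le hab.le hρ h
  have h3 := MemH1.integral_abs_le hab.le hρ (hf.memLp_deriv hab.le)
    ((hf.integral_sq_le_h1NormSq hab.le).2.trans h)
  have h4 := mul_le_mul_of_nonneg_left h2 (inv_nonneg.2 (sub_pos.2 hab).le)
  linarith

/-- Coefficients are Lipschitz on `[-1,1]` and `H¹` controls the supremum norm; the constant `A` may
depend on `ε` and on the fixed function `z`. -/
theorem exists_energy_lipschitz {D F : ℝ → ℝ} (H : SmoothCoefficients D F) {a b : ℝ} (hab : a < b)
    {ε : ℝ} (hε : 0 < ε) {z : ℝ → ℝ} (hz : MemH1 a b z)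
    (hzb : ∀ x ∈ Icc a b, z x ∈ Icc (-1 : ℝ) 1) :
    ∃ A : ℝ, 0 ≤ A ∧ ∀ ρ : ℝ, 0 < ρ → ρ ≤ 1 → ∀ w : ℝ → ℝ, MemH1 a b w →
      (∀ x ∈ Icc a b, w x ∈ Icc (-1 : ℝ) 1) → h1NormSq a b (fun x => w x - z x) ≤ ρ ^ 2 →
      |energy D F ε a b w - energy D F ε a b z| ≤ A * ρ := by
  obtain ⟨C, hC, hCb⟩ := H.exists_bound
  have hLD : ∀ x ∈ Icc (-1 : ℝ) 1, ∀ y ∈ Icc (-1 : ℝ) 1, |D x - D y| ≤ C * |x - y| :=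
    fun x hx y hy => (convex_Icc (-1 : ℝ) 1).norm_image_sub_le_of_norm_deriv_le
      (fun s _ => (H.hasDerivAt_D s).differentiableAt) (fun s hs => (hCb s hs).2.1) hy hx
  have hLF : ∀ x ∈ Icc (-1 : ℝ) 1, ∀ y ∈ Icc (-1 : ℝ) 1, |F x - F y| ≤ C * |x - y| :=
    fun x hx y hy => (convex_Icc (-1 : ℝ) 1).norm_image_sub_le_of_norm_deriv_le
      (fun s _ => (H.hasDerivAt_F s).differentiableAt) (fun s hs => (hCb s hs).2.2) hy hx
  set K := ((b - a)⁻¹ + 1) * Real.sqrt (b - a) with hK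
  have hba : 0 < b - a := sub_pos.2 hab
  have hK0 : 0 ≤ K := by positivity
  set Z := ∫ x in a..b, (deriv z x) ^ 2 with hZ
  have hZ0 : 0 ≤ Z := intervalIntegral.integral_nonneg hab.le fun x _ => sq_nonneg _
  refine ⟨ε / 2 * (C * Z + 2 * C + C * K * Z) + C * K * (b - a) / ε, by positivity,
    fun ρ hρ hρ1 w hw hwb hwz => ?_⟩
  have hg := hw.sub hz hab.le
  have hiz : IntervalIntegrable (fun x => (deriv z x) ^ 2) volume a b := by
    simpa using hz.intervalIntegrable_comp_mul_deriv_sq hab.le (φ := fun _ => 1) continuous_const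
  have hig : IntervalIntegrable (fun x => (deriv (fun x => w x - z x) x) ^ 2) volume a b := by
    simpa using hg.intervalIntegrable_comp_mul_deriv_sq hab.le (φ := fun _ => 1) continuous_const
  have hiw := hw.intervalIntegrable_energyDensity hab.le H.continuous_D H.continuous_F ε
  have hizz := hz.intervalIntegrable_energyDensity hab.le H.continuous_D H.continuous_F ε
  have e1 : energy D F ε a b w - energy D F ε a b z
      = ∫ x in a..b, (energyDensity D F ε w x - energyDensity D F ε z x) :=
    (intervalIntegral.integral_sub hiw hizz).symm
  have hbound : ∀ᵐ x ∂(volume.restrict (Ioc a b)),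
      |energyDensity D F ε w x - energyDensity D F ε z x| ≤
        ε / 2 * (C * ρ + C * K * ρ) * (deriv z x) ^ 2
          + ε / 2 * C * (1 + ρ⁻¹) * (deriv (fun x => w x - z x) x) ^ 2 + C * K * ρ / ε := by
    rw [← restrict_Ioo_eq_restrict_Ioc]
    filter_upwards [((hw.hasSobolevDeriv hab.le).sub (hz.hasSobolevDeriv hab.le) hab.le).ae_deriv_eq
      hab.le, ae_restrict_mem measurableSet_Ioo] with x hx hxm
    have hxm' := Ioo_subset_Icc_self hxm
    have hgx := hg.abs_le_of_h1NormSq_le hab hρ.le hwz hxm'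
    have d1 := (hLD _ (hwb x hxm') _ (hzb x hxm')).trans
      (mul_le_mul_of_nonneg_left hgx hC)
    have d2 := (hLF _ (hwb x hxm') _ (hzb x hxm')).trans
      (mul_le_mul_of_nonneg_left hgx hC)
    have d3 := (hCb _ (hwb x hxm')).1
    rw [← hK] at d1 d2
    set g := deriv (fun x => w x - z x) x
    have hwx : deriv w x = deriv z x + g := by rw [hx]; ring
    have e2 : energyDensity D F ε w x - energyDensity D F ε z x
        = ε / 2 * (D (w x) * (2 * deriv z x * g + g ^ 2) + (D (w x) - D (z x)) * (deriv z x) ^ 2)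
          + (F (w x) - F (z x)) / ε := by
      unfold energyDensity
      rw [hwx]
      ring
    -- Young's inequality with weight `ρ`: as `∫ g² ≤ ρ²`, both resulting terms contribute `O(ρ)`.
    have e3 : |2 * deriv z x * g + g ^ 2| ≤ ρ * (deriv z x) ^ 2 + (1 + ρ⁻¹) * g ^ 2 := by
      have s1 : ρ * (deriv z x) ^ 2 + ρ⁻¹ * g ^ 2 - 2 * deriv z x * g
          = ρ * (deriv z x - ρ⁻¹ * g) ^ 2 := by field_simp; ring
      have s2 : ρ * (deriv z x) ^ 2 + ρ⁻¹ * g ^ 2 + 2 * deriv z x * g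
          = ρ * (deriv z x + ρ⁻¹ * g) ^ 2 := by field_simp; ring
      have s3 : 0 ≤ ρ * (deriv z x - ρ⁻¹ * g) ^ 2 := by positivity
      have s4 : 0 ≤ ρ * (deriv z x + ρ⁻¹ * g) ^ 2 := by positivity
      rw [abs_le]
      constructor <;> nlinarith [sq_nonneg g]
    rw [e2]
    calc _ ≤ |ε / 2 * (D (w x) * (2 * deriv z x * g + g ^ 2)
            + (D (w x) - D (z x)) * (deriv z x) ^ 2)| + |(F (w x) - F (z x)) / ε| := abs_add_le _ _
      _ ≤ ε / 2 * (C * (ρ * (deriv z x) ^ 2 + (1 + ρ⁻¹) * g ^ 2)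
            + C * (K * ρ) * (deriv z x) ^ 2) + C * (K * ρ) / ε := by
          rw [abs_mul, abs_of_pos (half_pos hε), abs_div, abs_of_pos hε]
          gcongr
          refine (abs_add_le _ _).trans ?_
          rw [abs_mul, abs_mul, abs_of_nonneg (sq_nonneg (deriv z x))]
          gcongr
      _ = _ := by ring
  have hint : IntervalIntegrable (fun x => ε / 2 * (C * ρ + C * K * ρ) * (deriv z x) ^ 2
      + ε / 2 * C * (1 + ρ⁻¹) * (deriv (fun x => w x - z x) x) ^ 2 + C * K * ρ / ε) volume a b :=
    ((hiz.const_mul _).add (hig.const_mul _)).add intervalIntegrable_const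
  rw [e1]
  refine (intervalIntegral.norm_integral_le_of_norm_le hab.le
    (f := fun x => energyDensity D F ε w x - energyDensity D F ε z x)
    ((ae_restrict_iff' measurableSet_Ioc).1 hbound) hint).trans ?_
  rw [intervalIntegral.integral_add ((hiz.const_mul _).add (hig.const_mul _))
    intervalIntegrable_const, intervalIntegral.integral_add (hiz.const_mul _) (hig.const_mul _),
    intervalIntegral.integral_const_mul, intervalIntegral.integral_const_mul, ← hZ,
    intervalIntegral.integral_const, smul_eq_mul]
  have hgn := (hg.integral_sq_le_h1NormSq hab.le).2.trans hwz
  have e4 : ε / 2 * C * (1 + ρ⁻¹) * ∫ x in a..b, (deriv (fun x => w x - z x) x) ^ 2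
      ≤ ε / 2 * (2 * C) * ρ := by
    calc _ ≤ ε / 2 * C * (1 + ρ⁻¹) * ρ ^ 2 := by gcongr
      _ = ε / 2 * C * (ρ + 1) * ρ := by field_simp
      _ ≤ ε / 2 * C * (1 + 1) * ρ := by gcongr
      _ = _ := by ring
  calc _ ≤ ε / 2 * (C * ρ + C * K * ρ) * Z + ε / 2 * (2 * C) * ρ
        + (b - a) * (C * K * ρ / ε) := by linarith
    _ = _ := by ring

/-! ### Solutions -/

namespace IsSolution

variable {D F : ℝ → ℝ} {ε a b : ℝ} {u₀ : ℝ → ℝ} {u : ℝ → ℝ → ℝ}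
  (hu : IsSolution D F ε a b u₀ u)
include hu

theorem bounded {t : ℝ} (ht : 0 ≤ t) : ∀ x ∈ Icc a b, u t x ∈ Icc (-1 : ℝ) 1 :=
  (hu.strong (t + 1) (by linarith)).bounded t ⟨ht, by linarith⟩

theorem continuousOn_energy (H : SmoothCoefficients D F) (hab : a < b) (hε : 0 < ε) :
    ContinuousOn (fun t => energy D F ε a b (u t)) (Ici 0) := by
  intro s hs
  obtain ⟨A, hA, h⟩ := exists_energy_lipschitz H hab hε (hu.memH1 s hs) (hu.bounded hs)
  rw [ContinuousWithinAt, Metric.tendsto_nhds]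
  intro e he
  set ρ := min 1 (e / (2 * (A + 1)))
  have hρ : 0 < ρ := lt_min one_pos (by positivity)
  filter_upwards [(hu.continuous s hs).eventually (gt_mem_nhds (pow_pos hρ 2)),
    self_mem_nhdsWithin] with t ht ht0
  rw [Real.dist_eq]
  refine (h ρ hρ (min_le_left _ _) (u t) (hu.memH1 t ht0) (hu.bounded ht0) ht.le).trans_lt ?_
  calc A * ρ ≤ (A + 1) * (e / (2 * (A + 1))) := by
        gcongr
        · linarith
        · exact min_le_right _ _
    _ = e / 2 := by field_simp
    _ < e := by linarith

theorem tendsto_integral_abs_sub (hab : a < b) {s : ℝ} (hs : 0 ≤ s) :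
    Tendsto (fun t => ∫ x in a..b, |u t x - u s x|) (𝓝[Ici 0] s) (𝓝 0) := by
  rw [Metric.tendsto_nhds]
  intro e he
  set q := Real.sqrt (b - a)
  have hq : 0 ≤ q := Real.sqrt_nonneg _
  have hρ : 0 < e / (2 * (q + 1)) := by positivity
  filter_upwards [(hu.continuous s hs).eventually (gt_mem_nhds (pow_pos hρ 2)),
    self_mem_nhdsWithin] with t ht ht0
  have h1 := ((hu.memH1 t ht0).sub (hu.memH1 s hs) hab.le).integral_abs_le_of_h1NormSq_le hab.le
    hρ.le ht.le
  have h2 : 0 ≤ ∫ x in a..b, |u t x - u s x| :=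
    intervalIntegral.integral_nonneg hab.le fun x _ => abs_nonneg _
  rw [Real.dist_eq, sub_zero, abs_of_nonneg h2]
  refine h1.trans_lt ?_
  calc q * (e / (2 * (q + 1))) ≤ (q + 1) * (e / (2 * (q + 1))) := by gcongr; linarith
    _ = e / 2 := by field_simp
    _ < e := by linarith

/-- The energy controls the `L¹` distance covered by a solution, for positive times. -/
theorem sq_integral_abs_sub_le_of_pos (H : SmoothCoefficients D F) (hab : a < b) (hε : 0 < ε)
    {s t : ℝ} (hs : 0 < s) (hst : s < t) :
    (∫ x in a..b, |u t x - u s x|) ^ 2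
      ≤ (t - s) * (b - a) * (ε * (energy D F ε a b (u s) - energy D F ε a b (u t))) := by
  have ht : 0 < t := hs.trans hst
  obtain ⟨ux, v, vx, hmu, hmux, hmv, hmvx, hsu, hsv, hint⟩ := hu.regular s t hs hst
  obtain ⟨ut, w, wx, p, q, ⟨hut2, huti⟩, ⟨-, -, -, hw⟩, ⟨-, -, -, -, hpq⟩, heq, hbd⟩ :=
    (hu.strong t ht).equation
  have hvx := hmvx.memLp
  have hvxm : StronglyMeasurable (hvx.1.mk _) := hvx.1.stronglyMeasurable_mk
  have hvxe := hvx.1.ae_eq_mk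
  -- A strongly measurable representative, as needed for the parametric integrals in `SobolevCurve`.
  set vx' : ℝ → ℝ → ℝ := fun σ x => hvx.1.mk _ (σ, x) with hvx'
  have hvx'' : Function.uncurry vx' = hvx.1.mk _ := by
    ext ⟨σ, x⟩
    rfl
  have S : SobolevCurve a b s t u ux v vx' :=
    { measurable_u := hmu.memLp.1
      measurable_ux := hmux.memLp.1
      measurable_vx := by rw [hvx'']; exact hvxm
      memLp_v := hmv.memLp
      memLp_vx := by rw [hvx'']; exact hvx.ae_eq hvxe
      sobolev_u := hsu
      sobolev_v := by
        filter_upwards [hsv, Measure.ae_ae_of_ae_prod hvxe] with σ h1 h2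
        exact h1.congr_deriv hab.le h2
      memH1_left := hu.memH1 s hs.le
      memH1_right := hu.memH1 t ht.le
      eq_integral := fun τ hτ x hx => hint s (left_mem_Icc.2 hst.le) τ hτ x hx
      bounded := fun τ hτ => hu.bounded (hs.le.trans hτ.1) }
  have hsub : Ioo s t ⊆ Ioo 0 t := Ioo_subset_Ioo_left hs.le
  have hsub2 : spaceTime a b s t ⊆ spaceTime a b 0 t := prod_mono hsub le_rfl
  have hutI : Integrable (Function.uncurry ut)
      ((volume.restrict (Ioo s t)).prod (volume.restrict (Ioo a b))) := by
    rw [← volume_restrict_spaceTime]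
    have := hut2.mono_measure (Measure.restrict_mono hsub2 le_rfl)
    rw [volume_restrict_spaceTime] at this ⊢
    exact this.integrable (by norm_num)
  -- The time derivative from the `W^{1,4}` regularity and the one in the strong formulation have
  -- the same time integrals, hence agree.
  have hvut : ∀ᵐ z ∂((volume.restrict (Ioo s t)).prod (volume.restrict (Ioo a b))),
      v z.1 z.2 = ut z.1 z.2 := by
    refine ae_eq_of_time_integral_eq hst.le S.integrable_v hutI fun τ hτ => ?_
    filter_upwards [huti s ⟨hs.le, hst.le⟩ τ ⟨hs.le.trans hτ.1, hτ.2⟩,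
      ae_restrict_mem measurableSet_Ioo] with x hx hxm
    have := S.eq_integral τ hτ x (Ioo_subset_Icc_self hxm)
    linarith
  have heq' : ∀ᵐ z ∂((volume.restrict (Ioo s t)).prod (volume.restrict (Ioo a b))),
      ut z.1 z.2 = ε ^ 2 * wx z.1 z.2 - ε ^ 2 / 2 * (p z.1 z.2) ^ 2
        + ε ^ 2 / 2 * (q z.1 z.2) ^ 2 - deriv F (u z.1 z.2) := by
    rw [← volume_restrict_spaceTime]
    exact ae_restrict_of_ae_restrict_of_subset hsub2 heq
  have hrate : ∀ᵐ σ ∂(volume.restrict (Ioo s t)),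
      ∫ x in a..b, (ε / 2 * (deriv D (u σ x) * v σ x * (ux σ x) ^ 2
        + 2 * D (u σ x) * ux σ x * vx' σ x) + deriv F (u σ x) * v σ x / ε)
      = -(1 / ε) * ∫ x in a..b, (v σ x) ^ 2 := by
    filter_upwards [S.sobolev_u, S.sobolev_v, Measure.ae_ae_of_ae_prod hvut,
      Measure.ae_ae_of_ae_prod heq', ae_restrict_of_ae_restrict_of_subset hsub hw,
      ae_restrict_of_ae_restrict_of_subset hsub hpq,
      ae_restrict_of_ae_restrict_of_subset hsub hbd] with σ h1 h2 h3 h4 h5 h6 h7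
    refine H.integral_dissipation_eq hab hε h1 h2 h5.1 h5.2 h7.1 h7.2 h6 ?_
    filter_upwards [h3, h4] with x h3 h4
    rw [h3, h4]
  have hE := S.energy_sub_eq H hab hst hε
  rw [intervalIntegral.integral_congr_ae_restrict
    (g := fun σ => -(1 / ε) * ∫ x in a..b, (v σ x) ^ 2)
    (by rwa [uIoc_of_le hst.le, ← restrict_Ioo_eq_restrict_Ioc]),
    intervalIntegral.integral_const_mul] at hE
  have hL := S.sq_integral_abs_sub_le hab hst
  have : ε * (energy D F ε a b (u s) - energy D F ε a b (u t))
      = ∫ σ in s..t, ∫ x in a..b, (v σ x) ^ 2 := by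
    rw [← neg_sub, hE]
    field_simp
  rw [this]
  exact hL

/-- The energy controls the `L¹` distance covered by a solution. -/
theorem sq_integral_abs_sub_le (H : SmoothCoefficients D F) (hab : a < b) (hε : 0 < ε)
    {t : ℝ} (ht : 0 < t) :
    (∫ x in a..b, |u t x - u 0 x|) ^ 2
      ≤ t * (b - a) * (ε * (energy D F ε a b (u 0) - energy D F ε a b (u t))) := by
  have hmono : 𝓝[>] (0 : ℝ) ≤ 𝓝[Ici 0] 0 := nhdsWithin_mono _ Ioi_subset_Ici_self
  have hE : Tendsto (fun s => energy D F ε a b (u s)) (𝓝[>] 0) (𝓝 (energy D F ε a b (u 0))) :=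
    (hu.continuousOn_energy H hab hε 0 self_mem_Ici).mono_left hmono
  have hL := (hu.tendsto_integral_abs_sub hab le_rfl).mono_left hmono
  have hid : Tendsto (fun s : ℝ => s) (𝓝[>] 0) (𝓝 0) := tendsto_id.mono_left nhdsWithin_le_nhds
  -- Dissipation is known only on `[s,t]` with `s > 0`. The limit `s → 0⁺` uses continuity of the
  -- solution and of its energy at time `0`.
  have hR : Tendsto (fun s => Real.sqrt ((t - s) * (b - a)
      * (ε * (energy D F ε a b (u s) - energy D F ε a b (u t)))) + ∫ x in a..b, |u s x - u 0 x|)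
      (𝓝[>] 0) (𝓝 (Real.sqrt ((t - 0) * (b - a)
      * (ε * (energy D F ε a b (u 0) - energy D F ε a b (u t)))) + 0)) :=
    ((((tendsto_const_nhds.sub hid).mul_const _).mul
      ((hE.sub_const _).const_mul ε)).sqrt).add hL
  rw [sub_zero, add_zero] at hR
  have hkey : ∀ᶠ s in 𝓝[>] (0 : ℝ), 0 ≤ (t - s) * (b - a)
      * (ε * (energy D F ε a b (u s) - energy D F ε a b (u t))) ∧
      ∫ x in a..b, |u t x - u 0 x| ≤ Real.sqrt ((t - s) * (b - a)
      * (ε * (energy D F ε a b (u s) - energy D F ε a b (u t)))) + ∫ x in a..b, |u s x - u 0 x| := by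
    filter_upwards [Ioo_mem_nhdsGT ht] with s hs
    have h1 := hu.sq_integral_abs_sub_le_of_pos H hab hε hs.1 hs.2
    have hi : ∀ p q, 0 ≤ p → 0 ≤ q →
        IntervalIntegrable (fun x => |u p x - u q x|) volume a b := fun p q hp hq =>
      (((hu.memH1 p hp).sub (hu.memH1 q hq) hab.le).intervalIntegrable_comp hab.le continuous_abs)
    refine ⟨(sq_nonneg _).trans h1, ?_⟩
    calc ∫ x in a..b, |u t x - u 0 x| ≤ ∫ x in a..b, (|u t x - u s x| + |u s x - u 0 x|) :=
          intervalIntegral.integral_mono_on hab.le (hi t 0 ht.le le_rfl)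
            ((hi t s ht.le hs.1.le).add (hi s 0 hs.1.le le_rfl)) fun x _ => abs_sub_le _ _ _
      _ = (∫ x in a..b, |u t x - u s x|) + ∫ x in a..b, |u s x - u 0 x| :=
          intervalIntegral.integral_add (hi t s ht.le hs.1.le) (hi s 0 hs.1.le le_rfl)
      _ ≤ _ := by
          gcongr
          exact Real.le_sqrt_of_sq_le h1
  have h1 := ge_of_tendsto hR (hkey.mono fun s hs => hs.2)
  have h2 : 0 ≤ t * (b - a) * (ε * (energy D F ε a b (u 0) - energy D F ε a b (u t))) := by
    have hR2 : Tendsto (fun s => (t - s) * (b - a)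
        * (ε * (energy D F ε a b (u s) - energy D F ε a b (u t))))
        (𝓝[>] 0) (𝓝 ((t - 0) * (b - a)
        * (ε * (energy D F ε a b (u 0) - energy D F ε a b (u t))))) :=
      ((tendsto_const_nhds.sub hid).mul_const _).mul ((hE.sub_const _).const_mul ε)
    rw [sub_zero] at hR2
    exact ge_of_tendsto hR2 (hkey.mono fun s hs => hs.1)
  have h3 : 0 ≤ ∫ x in a..b, |u t x - u 0 x| :=
    intervalIntegral.integral_nonneg hab.le fun x _ => abs_nonneg _
  calc _ ≤ Real.sqrt _ ^ 2 := pow_le_pow_left₀ h3 h1 2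
    _ = _ := Real.sq_sqrt h2

end IsSolution

/-! ### Slow motion -/

/-- The derivative at an interior point sees only values in `[a,b]`, and the end points are null.
This transfers the energy bound from `u₀` to `u 0`, which agree only on `[a,b]`. -/
theorem energy_congr {D F : ℝ → ℝ} {ε a b : ℝ} (hab : a ≤ b) {w z : ℝ → ℝ}
    (h : ∀ x ∈ Icc a b, w x = z x) : energy D F ε a b w = energy D F ε a b z := by
  unfold energy
  rw [intervalIntegral.integral_of_le hab, intervalIntegral.integral_of_le hab,
    integral_Ioc_eq_integral_Ioo, integral_Ioc_eq_integral_Ioo]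
  refine setIntegral_congr_fun measurableSet_Ioo fun x hx => ?_
  have hd : deriv w x = deriv z x := by
    refine Filter.EventuallyEq.deriv_eq ?_
    filter_upwards [Ioo_mem_nhds hx.1 hx.2] with y hy
    exact h y (Ioo_subset_Icc_self hy)
  simp only [h x (Ioo_subset_Icc_self hx), hd]

/-- Near the wells `F` controls the transition cost with a rate which makes the defect of the energy
of a transition layer of width `2r`, compared with a full transition, of the order of `θ`. -/
def HasTailRate (D F θ : ℝ → ℝ) (r : ℝ) : Prop :=
  ∃ v₀ η C : ℝ, 0 < v₀ ∧ 0 < η ∧ η ≤ r ∧ ∀ᶠ ε in 𝓝[>] (0 : ℝ), ∃ l ω : ℝ, 0 ≤ l ∧ 0 ≤ ω ∧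
    TailBound D F v₀ l ω ∧
    2 * ω + 4 * transitionEnergy D F * Real.exp (-(2 * (l * (r - η) / ε))) ≤ C * θ ε

/-- An energy loss of order `θ` over a time of order `1/θ` permits a squared `L¹` displacement of
order `ε` only, which is too small to escape from the neighbourhood of `v` in which the loss is
controlled. -/
theorem slow_motion {D F θ : ℝ → ℝ} (H : AdmissibleCoefficients D F) (H' : SmoothCoefficients D F)
    {a b : ℝ} (hab : a < b) {N : ℕ} (hN : 0 < N) {h : Fin N → ℝ} {v : ℝ → ℝ} (hv : IsStep a b h v)
    {r : ℝ} (hr : IsSeparated a b h r) (hθ0 : ∀ ε, 0 < ε → 0 < θ ε)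
    (hθ : Tendsto θ (𝓝[>] 0) (𝓝 0)) (hT : HasTailRate D F θ r)
    {u₀ : ℝ → ℝ → ℝ} (hu₀ : HasLayerStructure D F θ a b N v u₀) {u : ℝ → ℝ → ℝ → ℝ}
    (hu : ∀ᶠ ε in 𝓝[>] (0 : ℝ), IsSolution D F ε a b (u₀ ε) (u ε))
    {δ₁ : ℝ} (hδ₁ : 0 < δ₁) {K : Set ℝ} (hK : IsClosed K) (hK1 : K ⊆ {-1, 1}ᶜ) :
    ∀ᶠ ε in 𝓝[>] (0 : ℝ), (((θ ε)⁻¹ : ℝ) : EReal) < exitTime a b K (u₀ ε) (u ε) δ₁ := by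
  obtain ⟨v₀, η, C₁, hv₀, hη, hηr, hT⟩ := hT
  obtain ⟨-, hlim, C, hC, hE⟩ := hu₀
  obtain ⟨δA, hδA, hA⟩ := energy_lower_bound H hab.le hv hr hη hηr hv₀
  obtain ⟨δB, κ, hδB, hκ, hB⟩ := interface_near_jumps H hab.le hv hN hr hK hK1 (half_pos hδ₁)
  -- One value `k ∈ K ∩ (-1,1)` suffices: the solution takes it near every jump. Without such a
  -- value all interfaces are empty, and any `δ` will do.
  obtain ⟨δC, hδC, hCk⟩ : ∃ δ : ℝ, 0 < δ ∧ ∀ k₁ ∈ K ∩ Ioo (-1) 1, ∃ k ∈ K,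
      ∀ w : ℝ → ℝ, MemH1 a b w → ∫ x in a..b, |w x - v x| ≤ δ →
      ∀ i, ∃ x ∈ Icc a b, w x = k ∧ |x - h i| ≤ δ₁ / 2 := by
    by_cases hne : (K ∩ Ioo (-1 : ℝ) 1).Nonempty
    · obtain ⟨k, hkK, hk⟩ := hne
      obtain ⟨δ, hδ, h1⟩ := exists_eq_near_jump H hab.le hv hr hk (half_pos hδ₁)
      exact ⟨δ, hδ, fun _ _ => ⟨k, hkK, h1⟩⟩
    · exact ⟨1, one_pos, fun k hk => absurd ⟨k, hk⟩ hne⟩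
  obtain ⟨δ, hδ, hδA', hδB', hδC'⟩ : ∃ δ : ℝ, 0 < δ ∧ δ ≤ δA ∧ δ ≤ δB ∧ δ ≤ δC :=
    ⟨min δA (min δB δC), lt_min hδA (lt_min hδB hδC), min_le_left _ _,
      (min_le_right _ _).trans (min_le_left _ _), (min_le_right _ _).trans (min_le_right _ _)⟩
  -- This is the bound for the squared displacement up to time `2/θ`; the factor `θ` cancels there.
  have hεs : ∀ᶠ ε in 𝓝[>] (0 : ℝ), 2 * (b - a) * (C + N * C₁) * ε < (δ / 2) ^ 2 := by
    have h1 : Tendsto (fun ε : ℝ => 2 * (b - a) * (C + N * C₁) * ε) (𝓝[>] 0) (𝓝 0) := by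
      have : Tendsto (fun ε : ℝ => 2 * (b - a) * (C + N * C₁) * ε) (𝓝 0) (𝓝 (_ * 0)) :=
        (continuous_const_mul _).tendsto 0
      rw [mul_zero] at this
      exact this.mono_left nhdsWithin_le_nhds
    exact h1.eventually (gt_mem_nhds (by positivity))
  have hθκ : ∀ᶠ ε in 𝓝[>] (0 : ℝ), C * θ ε < κ := by
    have h1 := hθ.const_mul C
    rw [mul_zero] at h1
    exact h1.eventually (gt_mem_nhds hκ)
  filter_upwards [hu, hE, hT, hlim.eventually (gt_mem_nhds (half_pos hδ)), hεs, hθκ,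
    self_mem_nhdsWithin] with ε hu hE hT hlim hεs hθκ hε
  have hε : 0 < ε := hε
  have hθε := hθ0 ε hε
  obtain ⟨l, ω, hl, hω, htail, hrate⟩ := hT
  have h0 : ∀ x ∈ Icc a b, u ε 0 x = u₀ ε x := (hu.strong 1 one_pos).initial
  rw [← energy_congr hab.le h0] at hE
  have hlim0 : ∫ x in a..b, |u ε 0 x - v x| < δ / 2 := by
    rwa [intervalIntegral.integral_congr (g := fun x => |u₀ ε x - v x|)]
    intro x hx
    rw [uIcc_of_le hab.le] at hx
    simp only [h0 x hx]
  have hI0 : interfaceSet a b K (u₀ ε) = interfaceSet a b K (u ε 0) := by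
    ext x
    simp only [interfaceSet, mem_ofPred_eq]
    exact and_congr_right fun hx => by rw [h0 x hx]
  have hclose : ∀ t, 0 ≤ t → ∫ x in a..b, |u ε t x - u ε 0 x| ≤ δ / 2 →
      ∫ x in a..b, |u ε t x - v x| ≤ δ := by
    intro t ht h1
    have i1 : IntervalIntegrable (fun x => |u ε t x - u ε 0 x|) volume a b :=
      ((hu.memH1 t ht).sub (hu.memH1 0 le_rfl) hab.le).intervalIntegrable_comp hab.le
        continuous_abs
    have i2 : ∀ s, 0 ≤ s → IntervalIntegrable (fun x => |u ε s x - v x|) volume a b := fun s hs =>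
      (((hu.memH1 s hs).intervalIntegrable_comp hab.le continuous_id).sub
        (hv.intervalIntegrable hab.le)).abs
    calc ∫ x in a..b, |u ε t x - v x|
        ≤ ∫ x in a..b, (|u ε t x - u ε 0 x| + |u ε 0 x - v x|) :=
          intervalIntegral.integral_mono_on hab.le (i2 t ht) (i1.add (i2 0 le_rfl))
            fun x _ => abs_sub_le _ _ _
      _ = (∫ x in a..b, |u ε t x - u ε 0 x|) + ∫ x in a..b, |u ε 0 x - v x| :=
          intervalIntegral.integral_add i1 (i2 0 le_rfl)
      _ ≤ δ := by linarith
  set E : ℝ → ℝ := fun t => energy D F ε a b (u ε t) with hEdef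
  have hsq : ∀ t, 0 < t → (∫ x in a..b, |u ε t x - u ε 0 x|) ^ 2
      ≤ t * (b - a) * (ε * (E 0 - E t)) := fun t ht => hu.sq_integral_abs_sub_le H' hab hε ht
  have hba : 0 < b - a := sub_pos.2 hab
  -- The horizon is `2/θ` rather than `1/θ` to obtain a strict inequality for the exit time.
  have hstay : ∀ t, 0 ≤ t → t ≤ 2 / θ ε → ∫ x in a..b, |u ε t x - u ε 0 x| ≤ δ / 2 := by
    intro t ht0 ht
    rcases ht0.eq_or_lt with rfl | htpos
    · simp only [sub_self, abs_zero, intervalIntegral.integral_zero]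
      positivity
    by_contra! hcon
    have hGt : (δ / 2) ^ 2 ≤ t * (b - a) * (ε * (E 0 - E t)) :=
      (pow_le_pow_left₀ (half_pos hδ).le hcon.le 2).trans (hsq t htpos)
    have hcont : ContinuousOn (fun t => t * (b - a) * (ε * (E 0 - E t))) (Icc 0 t) := by
      have := (hu.continuousOn_energy H' hab hε).mono fun x (hx : x ∈ Icc 0 t) => mem_Ici.2 hx.1
      exact (continuousOn_id.mul continuousOn_const).mul
        (continuousOn_const.mul (continuousOn_const.sub this))
    -- At `t₁` the dissipation bound equals `(δ/2)²` exactly. Hence `u t₁` is still close to `v`,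
    -- the lower energy bound applies, and it forces the same quantity below `(δ/2)²`.
    obtain ⟨t₁, ht₁, hG⟩ := intermediate_value_Icc ht0 hcont
      (show (δ / 2) ^ 2 ∈ Icc _ _ from ⟨by simp only [zero_mul]; positivity, hGt⟩)
    have ht₁0 : 0 < t₁ := by
      rcases ht₁.1.eq_or_lt with h1 | h1
      · rw [← h1] at hG
        simp only [zero_mul] at hG
        have : 0 < (δ / 2) ^ 2 := by positivity
        linarith
      · exact h1
    have h1 := hsq t₁ ht₁0
    simp only at hG
    rw [hG] at h1
    have h2 := (abs_le_of_sq_le_sq' h1 (half_pos hδ).le).2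
    have h3 := hA ε l ω hε hl hω htail (u ε t₁) (hu.memH1 t₁ ht₁0.le) (hu.bounded ht₁0.le)
      ((hclose t₁ ht₁0.le h2).trans hδA')
    have hN0 : (0 : ℝ) ≤ N := Nat.cast_nonneg N
    have h4 : E 0 - E t₁ ≤ (C + N * C₁) * θ ε := by
      have := mul_le_mul_of_nonneg_left hrate hN0
      simp only [hEdef]
      linarith
    -- The constant `C₁` carries no sign; a negative value would make the dissipation bound at `t₁`
    -- nonpositive.
    have hCC : 0 ≤ (C + N * C₁) * θ ε := by
      by_contra! hneg
      have : t₁ * (b - a) * (ε * (E 0 - E t₁)) ≤ 0 :=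
        mul_nonpos_of_nonneg_of_nonpos (by positivity)
          (mul_nonpos_of_nonneg_of_nonpos hε.le (by linarith))
      have : 0 < (δ / 2) ^ 2 := by positivity
      linarith
    have h5 : t₁ * (b - a) * (ε * (E 0 - E t₁)) ≤ 2 / θ ε * (b - a) * (ε * ((C + N * C₁) * θ ε)) := by
      calc _ ≤ t₁ * (b - a) * (ε * ((C + N * C₁) * θ ε)) := by gcongr
        _ ≤ _ := by
          gcongr
          exact ht₁.2.trans ht
    have h6 : 2 / θ ε * (b - a) * (ε * ((C + N * C₁) * θ ε)) = 2 * (b - a) * (C + N * C₁) * ε := by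
      field_simp
    linarith
  have hnear : ∀ t, 0 ≤ t → t ≤ 2 / θ ε → ∀ x ∈ interfaceSet a b K (u ε t),
      ∃ i, |x - h i| ≤ δ₁ / 2 := by
    intro t ht0 ht x hx
    have hle : E t ≤ E 0 := by
      rcases ht0.eq_or_lt with rfl | htpos
      · exact le_rfl
      · have h1 := (sq_nonneg _).trans (hsq t htpos)
        have h2 := nonneg_of_mul_nonneg_right (nonneg_of_mul_nonneg_right h1 (by positivity)) hε
        linarith
    refine hB ε hε (u ε t) (hu.memH1 t ht0) (hu.bounded ht0)
      ((hclose t ht0 (hstay t ht0 ht)).trans hδB') ?_ x hx.1 hx.2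
    have : E t ≤ N * transitionEnergy D F + κ := by
      simp only [hEdef] at hle ⊢
      linarith
    exact this
  -- Both points lie within `δ₁/2` of the same jump. The statement is symmetric in `t` and `s`, so
  -- it gives both halves of the Hausdorff distance.
  have hhaus : ∀ t, 0 ≤ t → t ≤ 2 / θ ε → ∀ s, 0 ≤ s → s ≤ 2 / θ ε →
      ∀ x ∈ interfaceSet a b K (u ε t), ∃ y ∈ interfaceSet a b K (u ε s),
        edist x y ≤ ENNReal.ofReal δ₁ := by
    intro t ht0 ht s hs0 hs x hx
    obtain ⟨i, hi⟩ := hnear t ht0 ht x hx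
    have hxb := hu.bounded ht0 x hx.1
    have hxne := hK1 hx.2
    simp only [mem_compl_iff, mem_insert_iff, mem_singleton_iff, not_or] at hxne
    obtain ⟨k, hkK, hk⟩ := hCk (u ε t x) ⟨hx.2, lt_of_le_of_ne hxb.1 (Ne.symm hxne.1),
      lt_of_le_of_ne hxb.2 hxne.2⟩
    obtain ⟨y, hy, hyk, hyi⟩ := hk (u ε s) (hu.memH1 s hs0)
      ((hclose s hs0 (hstay s hs0 hs)).trans hδC') i
    refine ⟨y, ⟨hy, by rw [hyk]; exact hkK⟩, ?_⟩
    rw [edist_dist]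
    refine ENNReal.ofReal_le_ofReal ?_
    rw [Real.dist_eq]
    have := abs_sub_le x (h i) y
    rw [abs_sub_comm (h i) y] at this
    linarith
  have hpos : 0 ≤ 2 / θ ε := by positivity
  have hlt : (θ ε)⁻¹ < 2 / θ ε := by
    rw [inv_eq_one_div]
    gcongr
    norm_num
  refine lt_of_lt_of_le (EReal.coe_lt_coe_iff.2 hlt) ?_
  unfold exitTime
  refine le_sInf ?_
  rintro _ ⟨t, ⟨ht0, ht⟩, rfl⟩
  refine EReal.coe_le_coe_iff.2 ?_
  by_contra! hcon
  refine absurd ht (not_lt.2 ?_)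
  rw [hI0]
  exact Metric.hausdorffEDist_le_of_mem_edist (hhaus t ht0 hcon.le 0 le_rfl hpos)
    fun x hx => by
      obtain ⟨y, hy, hxy⟩ := hhaus 0 le_rfl hpos t ht0 hcon.le x hx
      exact ⟨y, hy, hxy⟩

/-! ### Rates -/

/-- Inserting the factor `s/s₀ ≥ 1` makes the integrand an exact derivative, at a price tending to
`1` as `s₀ → 1`. -/
theorem integral_le_rpow {Q : ℝ → ℝ} (hQ : Continuous Q) {c k s₀ y : ℝ} (hc : 0 ≤ c) (hk : 0 < k)
    (hs₀ : 0 < s₀) (hy : s₀ ≤ y) (hy1 : y ≤ 1)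
    (h : ∀ s ∈ Icc y 1, Q s ≤ c * (1 - s ^ 2) ^ k) :
    ∫ s in y..1, Q s ≤ c / (2 * (k + 1) * s₀) * (1 - y ^ 2) ^ (k + 1) := by
  have hd : ∀ s ∈ uIcc y 1, HasDerivAt
      (fun s : ℝ => -(c / (2 * (k + 1) * s₀) * (1 - s ^ 2) ^ (k + 1)))
      (c / s₀ * (s * (1 - s ^ 2) ^ k)) s := by
    intro s _
    have h1 : HasDerivAt (fun s : ℝ => 1 - s ^ 2) (-(2 * s)) s := by
      simpa using (hasDerivAt_pow 2 s).const_sub 1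
    have h2 := ((h1.rpow_const (p := k + 1) (Or.inr (by linarith))).const_mul
      (c / (2 * (k + 1) * s₀))).neg
    refine h2.congr_deriv ?_
    rw [add_sub_cancel_right]
    field_simp
  have hcont : Continuous fun s : ℝ => c / s₀ * (s * (1 - s ^ 2) ^ k) := by
    have : Continuous fun s : ℝ => (1 - s ^ 2) ^ k :=
      (continuous_const.sub (continuous_pow 2)).rpow_const fun s => Or.inr hk.le
    fun_prop
  have hint := intervalIntegral.integral_eq_sub_of_hasDerivAt hd (hcont.intervalIntegrable y 1)
  have hle : ∫ s in y..1, Q s ≤ ∫ s in y..1, c / s₀ * (s * (1 - s ^ 2) ^ k) := by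
    refine intervalIntegral.integral_mono_on hy1 (hQ.intervalIntegrable _ _)
      (hcont.intervalIntegrable _ _) fun s hs => (h s hs).trans ?_
    have h1 : 0 ≤ (1 - s ^ 2) ^ k := Real.rpow_nonneg (by nlinarith [hs.1, hs.2]) k
    have h2 : 1 ≤ s / s₀ := (one_le_div hs₀).2 (hy.trans hs.1)
    calc c * (1 - s ^ 2) ^ k ≤ c * (1 - s ^ 2) ^ k * (s / s₀) :=
          le_mul_of_one_le_right (mul_nonneg hc h1) h2
      _ = _ := by ring
  refine hle.trans (le_of_eq ?_)
  rw [hint]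
  have : (0 : ℝ) ^ (k + 1) = 0 := Real.zero_rpow (by linarith)
  simp [this]

namespace AdmissibleCoefficients

variable {D F : ℝ → ℝ} (H : AdmissibleCoefficients D F)
include H

theorem transitionCost_le_rpow {c k : ℝ} (hc : 0 ≤ c) (hk : 0 < k)
    (hP : ∀ s ∈ Icc (-1 : ℝ) 1, Real.sqrt (2 * D s * F s) ≤ c * (1 - s ^ 2) ^ k)
    {s₀ σ y : ℝ} (hσ : σ = -1 ∨ σ = 1) (hs₀ : 0 < s₀) (hy : s₀ ≤ σ * y) (hy1 : y ∈ Icc (-1 : ℝ) 1) :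
    transitionCost D F σ y ≤ c / (2 * (k + 1) * s₀) * (1 - y ^ 2) ^ (k + 1) := by
  rcases hσ with rfl | rfl
  · have h1 := integral_le_rpow (H.continuous_sqrt.comp continuous_neg) (c := c) (k := k)
      (s₀ := s₀) (y := -y) hc hk hs₀ (by linarith) (by linarith [hy1.1]) (fun s hs => by
        have := hP (-s) ⟨by linarith [hs.2], by linarith [hs.1, hy1.2]⟩
        rwa [neg_sq] at this)
    have h2 : ∫ s in (-y)..1, Real.sqrt (2 * D (-s) * F (-s))
        = ∫ s in (-1)..y, Real.sqrt (2 * D s * F s) := by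
      rw [intervalIntegral.integral_comp_neg (fun s => Real.sqrt (2 * D s * F s)), neg_neg]
    rw [neg_sq] at h1
    unfold transitionCost
    rw [neg_neg, one_mul, ← h2]
    exact h1
  · have h1 := integral_le_rpow H.continuous_sqrt (c := c) (k := k) (s₀ := s₀) (y := y) hc hk hs₀
      (by linarith) hy1.2 (fun s hs => hP s ⟨by linarith [hs.1, hy1.1], hs.2⟩)
    unfold transitionCost
    rw [intervalIntegral.integral_symm]
    linarith

/-- Points with a small transition cost are close to the well. -/
theorem exists_le_mul_of_transitionCost_le {s₀ : ℝ} (hs₀ : s₀ ∈ Ioo (0 : ℝ) 1) :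
    ∃ v₀ : ℝ, 0 < v₀ ∧ ∀ σ : ℝ, σ = -1 ∨ σ = 1 → ∀ s ∈ Icc (-1 : ℝ) 1,
      transitionCost D F σ s ≤ v₀ → s₀ ≤ σ * s := by
  have hmem : ∀ σ : ℝ, σ = -1 ∨ σ = 1 → σ * s₀ ∈ Ioo (-1 : ℝ) 1 := by
    rintro σ (rfl | rfl) <;> constructor <;> linarith [hs₀.1, hs₀.2]
  have hpos : ∀ σ : ℝ, σ = -1 ∨ σ = 1 → 0 < transitionCost D F σ (σ * s₀) :=
    fun σ hσ => H.transitionCost_pos hσ (hmem σ hσ)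
  have hi : ∀ x y : ℝ, IntervalIntegrable (fun s => Real.sqrt (2 * D s * F s)) volume x y :=
    fun x y => H.continuous_sqrt.intervalIntegrable x y
  have hm := lt_min (hpos (-1) (Or.inl rfl)) (hpos 1 (Or.inr rfl))
  refine ⟨_, half_pos hm, fun σ hσ s hs hcost => ?_⟩
  by_contra! hlt
  have hmono : transitionCost D F σ (σ * s₀) ≤ transitionCost D F σ s := by
    unfold transitionCost
    rw [← intervalIntegral.integral_add_adjacent_intervals (hi σ (σ * s₀)) (hi (σ * s₀) s)]
    rcases hσ with rfl | rfl
    · have := intervalIntegral.integral_nonneg (μ := volume) (a := -1 * s₀) (b := s) (by linarith)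
        fun y _ => Real.sqrt_nonneg (2 * D y * F y)
      linarith
    · have := intervalIntegral.integral_nonneg (μ := volume) (a := s) (b := 1 * s₀) (by linarith)
        fun y _ => Real.sqrt_nonneg (2 * D y * F y)
      rw [intervalIntegral.integral_symm (1 * s₀) s] at this
      linarith
  have h1 : min (transitionCost D F (-1) (-1 * s₀)) (transitionCost D F 1 (1 * s₀))
      ≤ transitionCost D F σ (σ * s₀) := by
    rcases hσ with rfl | rfl
    · exact min_le_left _ _
    · exact min_le_right _ _
  linarith

end AdmissibleCoefficients

/-! ### Tail rates for the power-law potential -/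

section Potential

variable {D : ℝ → ℝ} {n c k : ℝ}

theorem potential_eq {s : ℝ} (hs : s ∈ Icc (-1 : ℝ) 1) :
    potential n s = 1 / (2 * n) * (1 - s ^ 2) ^ n := by
  unfold potential
  rw [abs_of_nonneg (by nlinarith [hs.1, hs.2])]

/-- When `k + 1 = n`, cost and potential vanish to the same order at the wells, so `l = s₀/c` works
with `ω = 0`. -/
theorem hasTailRate_exp (H : AdmissibleCoefficients D (potential n)) (hc : 0 < c) (hk : 0 < k)
    (hkn : k + 1 = n)
    (hP : ∀ s ∈ Icc (-1 : ℝ) 1, Real.sqrt (2 * D s * potential n s) ≤ c * (1 - s ^ 2) ^ k)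
    {r B : ℝ} (hr : 0 < r) (hB : B * c < 2 * r) :
    HasTailRate D (potential n) (fun ε => Real.exp (-(B / ε))) r := by
  -- The decay exponent obtained is `2 s₀ (r - η)/c`; letting `s₀ → 1` and `η → 0` reaches every `B
  -- < 2r/c`.
  obtain ⟨s₀, hs₀, η, hη, hηr, hsη⟩ : ∃ s₀ ∈ Ioo (0 : ℝ) 1, ∃ η, 0 < η ∧ η ≤ r ∧
      B * c ≤ 2 * s₀ * (r - η) := by
    have h1 : Tendsto (fun x : ℝ => 2 * (1 - x) * (r - r * x)) (𝓝[>] 0) (𝓝 (2 * r)) := by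
      have : ContinuousAt (fun x : ℝ => 2 * (1 - x) * (r - r * x)) 0 := by fun_prop
      have h2 := this.tendsto
      simp only [sub_zero, mul_zero, mul_one] at h2
      exact h2.mono_left nhdsWithin_le_nhds
    obtain ⟨x, hx, hx01⟩ := ((h1.eventually (lt_mem_nhds hB)).and
      (Ioo_mem_nhdsGT one_pos)).exists
    exact ⟨1 - x, ⟨by linarith [hx01.2], by linarith [hx01.1]⟩, r * x, mul_pos hr hx01.1,
      by nlinarith [hx01.2], hx.le⟩
  obtain ⟨v₀, hv₀, hnear⟩ := H.exists_le_mul_of_transitionCost_le hs₀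
  have hγ := H.transitionEnergy_nonneg
  have hs₀0 := hs₀.1
  refine ⟨v₀, η, 4 * transitionEnergy D (potential n), hv₀, hη, hηr, ?_⟩
  filter_upwards [self_mem_nhdsWithin] with ε (hε : 0 < ε)
  refine ⟨s₀ / c, 0, by positivity, le_rfl, fun σ hσ s hs hcost => ?_, ?_⟩
  · have h1 := H.transitionCost_le_rpow hc.le hk hP hσ hs₀0 (hnear σ hσ s hs hcost) hs
    rw [hkn] at h1
    rw [potential_eq hs, sub_zero]
    calc s₀ / c * transitionCost D (potential n) σ s
        ≤ s₀ / c * (c / (2 * n * s₀) * (1 - s ^ 2) ^ n) := by gcongr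
      _ = 1 / (2 * n) * (1 - s ^ 2) ^ n := by field_simp
  · rw [mul_zero, zero_add]
    gcongr
    rw [show 2 * (s₀ / c * (r - η) / ε) = (2 * s₀ * (r - η) / c) / ε by ring]
    gcongr
    rwa [le_div_iff₀ hc]

/-- Here `F` is of higher order than the cost. Where `x^(n-k-1) ≥ 2nCl`, with `x = 1 - s²`, it still
dominates `l` times the cost; closer to the well the cost itself is at most `C (2nCl)^β`, which is
taken as `ω`. -/
theorem hasTailRate_rpow (H : AdmissibleCoefficients D (potential n)) (hn : 0 < n) (hc : 0 < c)
    (hk : 0 < k) (hkn : k + 1 < n)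
    (hP : ∀ s ∈ Icc (-1 : ℝ) 1, Real.sqrt (2 * D s * potential n s) ≤ c * (1 - s ^ 2) ^ k)
    {r p : ℝ} (hr : 0 < r) (hp0 : 0 < p) (hp : p < (k + 1) / (n - k - 1)) :
    HasTailRate D (potential n) (fun ε => ε ^ p) r := by
  obtain ⟨v₀, hv₀, hnear⟩ := H.exists_le_mul_of_transitionCost_le (s₀ := 1 / 2) (by norm_num)
  have hγ := H.transitionEnergy_nonneg
  have hq : 0 < n - k - 1 := by linarith
  set β := (k + 1) / (n - k - 1) with hβ
  have hβ0 : 0 < β := by positivity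
  set C := c / (k + 1) with hC
  have hC0 : 0 < C := by positivity
  -- With `l = ε^(1-ς)` the error `ω` is of order `ε^((1-ς)β) = ε^p`, while `exp(-r ε^(-ς))` is
  -- smaller than any power of `ε`.
  obtain ⟨ς, hς0, hς⟩ : ∃ ς : ℝ, 0 < ς ∧ p = (1 - ς) * β :=
    ⟨1 - p / β, by rw [sub_pos, div_lt_one hβ0]; exact hp, by field_simp; ring⟩
  refine ⟨v₀, r / 2, 2 * (C * (2 * n * C) ^ β) + 4 * transitionEnergy D (potential n), hv₀,
    half_pos hr, by linarith, ?_⟩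
  have hexp : ∀ᶠ ε in 𝓝[>] (0 : ℝ), (ε ^ (-ς)) ^ (p / ς) * Real.exp (-r * ε ^ (-ς)) ≤ 1 := by
    have h1 : Tendsto (fun ε : ℝ => ε ^ (-ς)) (𝓝[>] 0) atTop :=
      tendsto_rpow_neg_nhdsGT_zero (by linarith)
    have h2 := (tendsto_rpow_mul_exp_neg_mul_atTop_nhds_zero (p / ς) r hr).comp h1
    exact (h2.eventually (gt_mem_nhds one_pos)).mono fun ε h => h.le
  filter_upwards [hexp, self_mem_nhdsWithin] with ε hexp (hε : 0 < ε)
  have hl : 0 < ε ^ (1 - ς) := Real.rpow_pos_of_pos hε _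
  set l := ε ^ (1 - ς) with hldef
  have hlβ : l ^ β = ε ^ p := by rw [hldef, ← Real.rpow_mul hε.le, ← hς]
  refine ⟨l, C * (2 * n * C * l) ^ β, hl.le, by positivity, fun σ hσ s hs hcost => ?_, ?_⟩
  · have h1 := H.transitionCost_le_rpow hc.le hk hP hσ (by norm_num : (0 : ℝ) < 1 / 2)
      (hnear σ hσ s hs hcost) hs
    have hC' : c / (2 * (k + 1) * (1 / 2)) = C := by rw [hC]; congr 1; ring
    rw [hC'] at h1
    have hx : 0 ≤ 1 - s ^ 2 := by nlinarith [hs.1, hs.2]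
    rw [potential_eq hs]
    set x := 1 - s ^ 2
    have hxn : 0 ≤ 1 / (2 * n) * x ^ n := by positivity
    rcases le_total (2 * n * C * l) (x ^ (n - k - 1)) with hcase | hcase
    · have hωpos : 0 ≤ C * (2 * n * C * l) ^ β := by positivity
      have hsplit : x ^ n = x ^ (n - k - 1) * x ^ (k + 1) := by
        rw [← Real.rpow_add_of_nonneg hx hq.le (by linarith)]
        congr 1; ring
      calc l * (transitionCost D (potential n) σ s - C * (2 * n * C * l) ^ β)
          ≤ l * (C * x ^ (k + 1)) := by gcongr; linarith
        _ = 1 / (2 * n) * (2 * n * C * l * x ^ (k + 1)) := by field_simp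
        _ ≤ 1 / (2 * n) * (x ^ (n - k - 1) * x ^ (k + 1)) := by gcongr
        _ = _ := by rw [hsplit]
    · have h2 : x ^ (k + 1) ≤ (2 * n * C * l) ^ β := by
        have := Real.rpow_le_rpow (by positivity) hcase hβ0.le
        rwa [← Real.rpow_mul hx, hβ, mul_div_cancel₀ _ hq.ne'] at this
      have h3 : transitionCost D (potential n) σ s - C * (2 * n * C * l) ^ β ≤ 0 := by
        have := mul_le_mul_of_nonneg_left h2 hC0.le
        linarith
      exact (mul_nonpos_of_nonneg_of_nonpos hl.le h3).trans hxn
  · have h1 : (ε ^ (-ς)) ^ (p / ς) = (ε ^ p)⁻¹ := by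
      rw [← Real.rpow_mul hε.le, ← Real.rpow_neg hε.le]
      congr 1
      field_simp
    have h2 : 2 * (l * (r - r / 2) / ε) = r * ε ^ (-ς) := by
      rw [hldef, show -ς = (1 - ς) - 1 by ring, Real.rpow_sub_one hε.ne']
      ring
    have h3 : 0 < ε ^ p := Real.rpow_pos_of_pos hε p
    have h4 : Real.exp (-(2 * (l * (r - r / 2) / ε))) ≤ ε ^ p := by
      rw [h1, inv_mul_le_iff₀ h3, mul_one] at hexp
      rw [h2, ← neg_mul]
      exact hexp
    rw [Real.mul_rpow (by positivity) hl.le, hlβ]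
    calc _ ≤ 2 * (C * ((2 * n * C) ^ β * ε ^ p)) + 4 * transitionEnergy D (potential n) * ε ^ p := by
          gcongr
      _ = _ := by ring

end Potential

/-! ### The model coefficients -/

theorem contDiff_diffusivity (κ : Degeneracy) {m : ℝ} (hm : 1 < m) :
    ContDiff ℝ 1 (diffusivity κ m) := by
  cases κ
  · have h : ContDiff ℝ 1 fun s : ℝ => 1 - s ^ 2 := by fun_prop
    exact h.norm_rpow hm
  · have h : ContDiff ℝ 1 fun s : ℝ => 1 - s := by fun_prop
    exact h.norm_rpow hm

theorem contDiff_potential {n : ℝ} (hn : 1 < n) : ContDiff ℝ 1 (potential n) := by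
  have h : ContDiff ℝ 1 fun s : ℝ => 1 - s ^ 2 := by fun_prop
  exact contDiff_const.mul (h.norm_rpow hn)

theorem smoothCoefficients (κ : Degeneracy) {m n : ℝ} (hm : 1 < m) (hn : 1 < n) :
    SmoothCoefficients (diffusivity κ m) (potential n) where
  hasDerivAt_D _ :=
    ((contDiff_diffusivity κ hm).differentiable one_ne_zero).differentiableAt.hasDerivAt
  hasDerivAt_F _ := ((contDiff_potential hn).differentiable one_ne_zero).differentiableAt.hasDerivAt
  continuous_deriv_D := (contDiff_diffusivity κ hm).continuous_deriv le_rfl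
  continuous_deriv_F := (contDiff_potential hn).continuous_deriv le_rfl

theorem admissibleCoefficients (κ : Degeneracy) {m n : ℝ} (hm : 1 < m) (hn : 1 < n) :
    AdmissibleCoefficients (diffusivity κ m) (potential n) where
  continuous_D := (smoothCoefficients κ hm hn).continuous_D
  continuous_F := (smoothCoefficients κ hm hn).continuous_F
  nonneg_D s := by
    cases κ <;> exact Real.rpow_nonneg (abs_nonneg _) _
  nonneg_F s := by
    have : 0 < n := by linarith
    unfold potential
    positivity
  pos s hs := by
    have hn0 : 0 < n := by linarith
    have h1 : 0 < |1 - s ^ 2| := abs_pos.2 (by nlinarith [hs.1, hs.2])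
    have h2 : 0 < |1 - s| := abs_pos.2 (by linarith [hs.2])
    refine mul_pos ?_ ?_
    · cases κ
      · exact Real.rpow_pos_of_pos h1 _
      · exact Real.rpow_pos_of_pos h2 _
    · unfold potential
      positivity

theorem sq_rpow_half {x : ℝ} (hx : 0 ≤ x) (p : ℝ) : (x ^ (p / 2)) ^ 2 = x ^ p := by
  rw [← Real.rpow_natCast, ← Real.rpow_mul hx]
  congr 1
  push_cast
  ring

theorem sqrt_double_le {m n : ℝ} (hn : 0 < n) {s : ℝ} (hs : s ∈ Icc (-1 : ℝ) 1) (hmn : 0 < m + n) :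
    Real.sqrt (2 * diffusivity .double m s * potential n s)
      ≤ (Real.sqrt n)⁻¹ * (1 - s ^ 2) ^ ((m + n) / 2) := by
  have hx : 0 ≤ 1 - s ^ 2 := by nlinarith [hs.1, hs.2]
  refine Real.sqrt_le_iff.2 ⟨by positivity, le_of_eq ?_⟩
  rw [potential_eq hs]
  simp only [diffusivity]
  rw [abs_of_nonneg hx, mul_pow, inv_pow, Real.sq_sqrt hn.le, sq_rpow_half hx,
    Real.rpow_add' hx hmn.ne']
  field_simp

/-- The degenerate factor is bounded by its value `2^m` at the well `-1`, so one bound serves both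
wells. -/
theorem sqrt_single_le {m n : ℝ} (hm : 0 < m) (hn : 0 < n) {s : ℝ} (hs : s ∈ Icc (-1 : ℝ) 1) :
    Real.sqrt (2 * diffusivity .single m s * potential n s)
      ≤ (2 : ℝ) ^ (m / 2) / Real.sqrt n * (1 - s ^ 2) ^ (n / 2) := by
  have hx : 0 ≤ 1 - s ^ 2 := by nlinarith [hs.1, hs.2]
  have hy : 0 ≤ 1 - s := by linarith [hs.2]
  refine Real.sqrt_le_iff.2 ⟨by positivity, ?_⟩
  rw [potential_eq hs]
  simp only [diffusivity]
  rw [abs_of_nonneg hy, mul_pow, div_pow, Real.sq_sqrt hn.le, sq_rpow_half hx,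
    sq_rpow_half two_pos.le]
  have h1 : (1 - s) ^ m ≤ 2 ^ m := Real.rpow_le_rpow hy (by linarith [hs.1]) hm.le
  calc 2 * (1 - s) ^ m * (1 / (2 * n) * (1 - s ^ 2) ^ n)
      = (1 - s) ^ m / n * (1 - s ^ 2) ^ n := by field_simp
    _ ≤ _ := by gcongr

theorem algExponent_pos {α κ : ℝ} (hα : 0 < α) (hκ : 0 < κ) (i : ℕ) : 0 < algExponent α κ i := by
  induction i with
  | zero => exact hκ
  | succ i ih =>
    unfold algExponent
    positivity

/-- The increasing map `k ↦ α (k + 1)` has the fixed point `β`, so iterates that start below it stay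
below it. -/
theorem algExponent_lt {α κ β : ℝ} (hα : 0 < α) (hβ : α * (β + 1) = β) (hκ : κ < β) (i : ℕ) :
    algExponent α κ i < β := by
  induction i with
  | zero => exact hκ
  | succ i ih =>
    unfold algExponent
    rw [← hβ]
    gcongr

theorem mul_add_one_eq {n k : ℝ} (hn : n ≠ 0) (hq : n - k - 1 ≠ 0) :
    (k + 1) / n * ((k + 1) / (n - k - 1) + 1) = (k + 1) / (n - k - 1) := by
  rw [div_add_one hq, show k + 1 + (n - k - 1) = n by ring, div_mul_div_cancel₀ hn]

/-! ### The admissible rates -/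

namespace IsRate

theorem pos {r m n : ℝ} {κ : Degeneracy} {θ : ℝ → ℝ} (h : IsRate r m n κ θ) :
    ∀ ε, 0 < ε → 0 < θ ε := by
  intro ε hε
  cases h
  case double_alg => exact Real.rpow_pos_of_pos hε _
  case single_alg => exact Real.rpow_pos_of_pos hε _
  all_goals exact Real.exp_pos _

theorem tendsto_exp_neg_div {B : ℝ} (hB : 0 < B) :
    Tendsto (fun ε : ℝ => Real.exp (-(B / ε))) (𝓝[>] 0) (𝓝 0) := by
  refine Real.tendsto_exp_neg_atTop_nhds_zero.comp ?_
  exact tendsto_inv_nhdsGT_zero.const_mul_atTop hB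

theorem tendsto_rpow {p : ℝ} (hp : 0 < p) :
    Tendsto (fun ε : ℝ => ε ^ p) (𝓝[>] 0) (𝓝 0) := by
  have := (Real.continuousAt_rpow_const (0 : ℝ) p (Or.inr hp.le)).tendsto
  rw [Real.zero_rpow hp.ne'] at this
  exact this.mono_left nhdsWithin_le_nhds

theorem tendsto {r m n : ℝ} (hm : 1 < m) (hn : 2 ≤ n) {κ : Degeneracy} {θ : ℝ → ℝ}
    (h : IsRate r m n κ θ) : Tendsto θ (𝓝[>] 0) (𝓝 0) := by
  cases h with
  | double_exp_large A _ _ hA _ => exact tendsto_exp_neg_div (by positivity)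
  | double_exp_small A _ _ _ hA _ => exact tendsto_exp_neg_div hA
  | single_exp A _ _ _ hA _ => exact tendsto_exp_neg_div hA
  | double_alg i _ _ =>
    have : 0 < (n + m + 2) / (2 * n) := by positivity
    exact tendsto_rpow (algExponent_pos this this i)
  | single_alg i κ _ _ hκ =>
    refine tendsto_rpow (algExponent_pos (by positivity) ?_ i)
    rcases hκ with rfl | rfl <;> positivity

theorem hasTailRate {r m n : ℝ} (hr : 0 < r) (hm : 1 < m) (hn : 2 ≤ n) {κ : Degeneracy}
    {θ : ℝ → ℝ} (h : IsRate r m n κ θ) : HasTailRate (diffusivity κ m) (potential n) θ r := by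
  have H := fun κ => admissibleCoefficients κ hm (show 1 < n by linarith)
  have hn0 : 0 < n := by linarith
  have hsn : 0 < Real.sqrt n := Real.sqrt_pos.2 hn0
  have hsn1 : 1 ≤ Real.sqrt n := Real.one_le_sqrt.2 (by linarith)
  have hdouble : ∀ s ∈ Icc (-1 : ℝ) 1, _ := fun s hs =>
    sqrt_double_le (m := m) hn0 hs (by linarith)
  have hsingle : ∀ s ∈ Icc (-1 : ℝ) 1, _ := fun s hs =>
    sqrt_single_le (m := m) (by linarith) hn0 hs
  cases h with
  | double_exp_large A _ hnm hA hAr =>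
    refine hasTailRate_exp (H _) (inv_pos.2 hsn) (by linarith) (by linarith) hdouble hr ?_
    rwa [mul_assoc, mul_inv_cancel₀ hsn.ne', mul_one]
  -- The constant is `c = 1/√n ≤ 1`, so the condition `A c < 2r` holds with room to spare.
  | double_exp_small A _ _ hnm hA hAr =>
    refine hasTailRate_exp (H _) (inv_pos.2 hsn) (by linarith) (by linarith) hdouble hr ?_
    exact (mul_le_of_le_one_right hA.le (inv_le_one_of_one_le₀ hsn1)).trans_lt hAr
  | single_exp A _ _ hn2 hA hAr =>
    subst hn2
    refine hasTailRate_exp (H _) (by positivity) (by norm_num) (by norm_num) hsingle hr ?_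
    have h1 : (2 : ℝ) ^ ((2 - m) / 2) * 2 ^ (m / 2) = 2 := by
      rw [← Real.rpow_add two_pos]
      rw [show (2 - m) / 2 + m / 2 = 1 by ring, Real.rpow_one]
    have h2 : A * (2 : ℝ) ^ (m / 2) < 2 * r := by
      calc A * (2 : ℝ) ^ (m / 2) < 2 ^ ((2 - m) / 2) * r * 2 ^ (m / 2) := by gcongr
        _ = 2 * r := by rw [mul_right_comm, h1]
    rw [← mul_div_assoc]
    exact (div_le_self (by positivity) hsn1).trans_lt h2
  | double_alg i _ hnm =>
    have hα : 0 < (n + m + 2) / (2 * n) := by positivity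
    have hden : 0 < n - (m + n) / 2 - 1 := by linarith
    refine hasTailRate_rpow (H _) hn0 (inv_pos.2 hsn) (by linarith) (by linarith) hdouble hr
      (algExponent_pos hα hα i) (algExponent_lt hα ?_ ?_ i)
    -- With `k = (m + n)/2` the recursion factor is `(k + 1)/n`, whose fixed point is `(k + 1)/(n -
    -- k - 1)`.
    · rw [show (n + m + 2) / (2 * n) = ((m + n) / 2 + 1) / n by field_simp; ring]
      exact mul_add_one_eq hn0.ne' hden.ne'
    · rw [div_lt_div_iff₀ (by positivity) hden]
      nlinarith
  | single_alg i κ _ hn2 hκ =>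
    have hα : 0 < (n + 2) / (2 * n) := by positivity
    have hden : 0 < n - n / 2 - 1 := by linarith
    have hαβ : (n + 2) / (2 * n) < (n / 2 + 1) / (n - n / 2 - 1) := by
      rw [div_lt_div_iff₀ (by positivity) hden]
      nlinarith
    have hκα : (n + 1) / (2 * n) ≤ (n + 2) / (2 * n) := by gcongr; norm_num
    refine hasTailRate_rpow (H _) hn0 (by positivity) (by linarith) (by linarith) hsingle hr
      (algExponent_pos hα ?_ i) (algExponent_lt hα ?_ ?_ i)
    · rcases hκ with rfl | rfl <;> positivity
    · rw [show (n + 2) / (2 * n) = (n / 2 + 1) / n by field_simp]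
      exact mul_add_one_eq hn0.ne' hden.ne'
    · rcases hκ with rfl | rfl
      · exact hκα.trans_lt hαβ
      · exact hαβ

end IsRate

end DegenerateAllenCahn

theorem mainTheorem2 (κ : DegenerateAllenCahn.Degeneracy) (m n : ℝ) (hm : 1 < m) (hn : 2 ≤ n)
    (a b : ℝ) (hab : a < b)
    (N : ℕ) (hN : 0 < N) (h : Fin N → ℝ) (v : ℝ → ℝ)
    (hv : DegenerateAllenCahn.IsStep a b h v)
    (r : ℝ) (hr : DegenerateAllenCahn.IsSeparated a b h r)
    (θ : ℝ → ℝ) (hθ : DegenerateAllenCahn.IsRate r m n κ θ)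
    (u₀ : ℝ → ℝ → ℝ)
    (hu₀ : DegenerateAllenCahn.HasLayerStructure (DegenerateAllenCahn.diffusivity κ m)
      (DegenerateAllenCahn.potential n) θ a b N v u₀)
    (u : ℝ → ℝ → ℝ → ℝ)
    (hu : ∀ᶠ ε in 𝓝[>] (0 : ℝ),
      DegenerateAllenCahn.IsSolution (DegenerateAllenCahn.diffusivity κ m)
        (DegenerateAllenCahn.potential n) ε a b (u₀ ε) (u ε))
    (δ₁ : ℝ) (hδ₁ : δ₁ ∈ Ioo 0 r)
    (K : Set ℝ) (hK : IsClosed K) (hK1 : K ⊆ {-1, 1}ᶜ) :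
    ∃ ε₀ : ℝ, 0 < ε₀ ∧ ∀ ε ∈ Ioo 0 ε₀,
      (((θ ε)⁻¹ : ℝ) : EReal) <
        DegenerateAllenCahn.exitTime a b K (u₀ ε) (u ε) δ₁ := by
  have hn1 : 1 < n := by linarith
  have hev := DegenerateAllenCahn.slow_motion
    (DegenerateAllenCahn.admissibleCoefficients κ hm hn1)
    (DegenerateAllenCahn.smoothCoefficients κ hm hn1) hab hN hv hr hθ.pos (hθ.tendsto hm hn)
    (hθ.hasTailRate hr.1 hm hn) hu₀ hu hδ₁.1 hK hK1
  obtain ⟨ε₀, hε₀, hsub⟩ := mem_nhdsGT_iff_exists_Ioo_subset.1 hev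
  exact ⟨ε₀, hε₀, fun ε hε => hsub hε⟩
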